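/- Let $d\ge 1$, $1\le p<\infty$, let $\Omega\subset\mathbb{R}^d$ be open and let $u\in L^p(\Omega)$ be real-valued. Let $|\mathbb{S}^{d-1}|$ be the surface area of the unit sphere, and let $K_{d,p}=\frac{1}{|\mathbb{S}^{d-1}|}\int_{\mathbb{S}^{d-1}}|w\cdot e|^p\,d\sigma_{d-1}(w)$, where $e$ is any unit vector. Put $\|\nabla u\|_{L^p(\Omega)}^p=\int_\Omega|\nabla u|^p\,dx$ if $u$ has a distributional gradient that is a function in $L^p(\Omega)$, and $\|\nabla u\|_{L^p(\Omega)}^p=\infty$ otherwise. Put $$|u|_{BV(\Omega)}=\sup\Big\{\int_\Omega u\,\operatorname{div}\phi\,dx:\ \phi\in C_c^\infty(\Omega,\mathbb{R}^d),\ |\phi|\le 1\Big\}\in[0,\infty].$$ The open set $\Omega$ is a $W^{1,p}$-extension domain if there are a linear map $E:W^{1,p}(\Omega)\to W^{1,p}(\mathbb{R}^d)$ and a constant $C$ with $Eu|_\Omega=u$ and $\|Eu\|_{W^{1,p}(\mathbb{R}^d)}\le C\|u\|_{W^{1,p}(\Omega)}$ for all $u\in W^{1,p}(\Omega)$. It is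 a $BV$-extension domain if the same holds with $BV$ in place of $W^{1,p}$ and, moreover, $|\nabla Eu|(\partial\Omega)=0$ for all $u\in BV(\Omega)$. Assume one of the following, and define $G\in[0,\infty]$ accordingly: (a) $\Omega$ is a $W^{1,p}$-extension domain, and either $p>1$, or $p=1$ and $u\in W^{1,1}(\Omega)$; then $G=\|\nabla u\|_{L^p(\Omega)}^p$; (b) $p=1$ and $\Omega$ is a $BV$-extension domain; then $G=|u|_{BV(\Omega)}$. Then, as limits in $[0,\infty]$, $$\lim_{s\to1^-}(1-s)\int_\Omega\int_\Omega\frac{|u(x)-u(y)|^p}{|x-y|^{d+sp}}\,dy\,dx=\frac{|\mathbb{S}^{d-1}|}{p}K_{d,p}\,G,$$ $$\lim_{\varepsilon\to0^+}\varepsilon^{-d}\iint_{\Omega\times\Omega\cap\{|x-y|<\varepsilon\}}\frac{|u(x)-u(y)|^p}{|x-y|^p}\,dy\,dx=\frac{|\mathbb{S}^{d-1}|}{d}K_{d,p}\,G,$$ $$\lim_{\varepsilon\to0^+}\frac1{|\log\varepsilon|}\iint_{\Omega\times\Omega\cap\{|x-y|>\varepsilon\}}\frac{|u(x)-u(y)|^p}{|x-y|^{d+p}}\,dy\,dx=|\mathbb{S}^{d-1}|K_{d,p}\,G.$$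 -/

import Mathlib

open MeasureTheory Filter Topology Set
open scoped ENNReal NNReal ContDiff

namespace BBM

/-- Smooth functions on `ℝ^d` with compact support contained in `Ω`, i.e. `C_c^∞(Ω, F)`. -/
def IsTestFunction {d : ℕ} {F : Type*} [NormedAddCommGroup F] [NormedSpace ℝ F]
    (Ω : Set (EuclideanSpace ℝ (Fin d))) (φ : EuclideanSpace ℝ (Fin d) → F) : Prop :=
  ContDiff ℝ ∞ φ ∧ HasCompactSupport φ ∧ tsupport φ ⊆ Ω

/-- The partial derivative `∂_i φ`. -/
noncomputable def partialDeriv {d : ℕ} {F : Type*} [NormedAddCommGroup F] [NormedSpace ℝ F]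
    (i : Fin d) (φ : EuclideanSpace ℝ (Fin d) → F) (x : EuclideanSpace ℝ (Fin d)) : F :=
  fderiv ℝ φ x (EuclideanSpace.single i 1)

/-- The divergence of a vector field on `ℝ^d`. -/
noncomputable def divergence {d : ℕ}
    (φ : EuclideanSpace ℝ (Fin d) → EuclideanSpace ℝ (Fin d))
    (x : EuclideanSpace ℝ (Fin d)) : ℝ :=
  ∑ i, (partialDeriv i φ x) i

/-- `g` is the distributional gradient of `u` on the open set `Ω`. -/
def HasWeakGradient {d : ℕ} (Ω : Set (EuclideanSpace ℝ (Fin d)))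
    (u : EuclideanSpace ℝ (Fin d) → ℝ)
    (g : EuclideanSpace ℝ (Fin d) → EuclideanSpace ℝ (Fin d)) : Prop :=
  LocallyIntegrableOn u Ω ∧ LocallyIntegrableOn g Ω ∧
    ∀ φ : EuclideanSpace ℝ (Fin d) → ℝ, IsTestFunction Ω φ → ∀ i : Fin d,
      ∫ x in Ω, u x * partialDeriv i φ x = -∫ x in Ω, g x i * φ x

/-- `u ∈ W^{1,p}(Ω)`. -/
def MemSobolev {d : ℕ} (Ω : Set (EuclideanSpace ℝ (Fin d))) (p : ℝ)
    (u : EuclideanSpace ℝ (Fin d) → ℝ) : Prop :=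
  MemLp u (ENNReal.ofReal p) (volume.restrict Ω) ∧
    ∃ g, HasWeakGradient Ω u g ∧ MemLp g (ENNReal.ofReal p) (volume.restrict Ω)

/-- `‖∇u‖_{L^p(Ω)}^p`, with the convention that it is `∞` when `u` has no distributional gradient
which is a function in `L^p(Ω)`. The distributional gradient is unique up to null sets, so that the
infimum is over at most one value. -/
noncomputable def gradNormPow {d : ℕ} (Ω : Set (EuclideanSpace ℝ (Fin d))) (p : ℝ)
    (u : EuclideanSpace ℝ (Fin d) → ℝ) : ℝ≥0∞ :=
  ⨅ (g : EuclideanSpace ℝ (Fin d) → EuclideanSpace ℝ (Fin d)) (_ : HasWeakGradient Ω u g),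
    ∫⁻ x in Ω, ‖g x‖ₑ ^ p

/-- `‖u‖_{W^{1,p}(Ω)} = (‖u‖_{L^p(Ω)}^p + ‖∇u‖_{L^p(Ω)}^p)^{1/p}`. -/
noncomputable def sobolevNorm {d : ℕ} (Ω : Set (EuclideanSpace ℝ (Fin d))) (p : ℝ)
    (u : EuclideanSpace ℝ (Fin d) → ℝ) : ℝ≥0∞ :=
  ((∫⁻ x in Ω, ‖u x‖ₑ ^ p) + gradNormPow Ω p u) ^ (1 / p)

/-- The variation `|u|_{BV(Ω)}`, for `u ∈ L^1(Ω)`. -/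
noncomputable def variation {d : ℕ} (Ω : Set (EuclideanSpace ℝ (Fin d)))
    (u : EuclideanSpace ℝ (Fin d) → ℝ) : ℝ≥0∞ :=
  ⨆ (φ : EuclideanSpace ℝ (Fin d) → EuclideanSpace ℝ (Fin d))
    (_ : IsTestFunction Ω φ ∧ ∀ x, ‖φ x‖ ≤ 1),
      ENNReal.ofReal (∫ x in Ω, u x * divergence φ x)

/-- `u ∈ BV(Ω)`. -/
def MemBV {d : ℕ} (Ω : Set (EuclideanSpace ℝ (Fin d)))
    (u : EuclideanSpace ℝ (Fin d) → ℝ) : Prop :=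
  MemLp u 1 (volume.restrict Ω) ∧ variation Ω u < ⊤

/-- `‖u‖_{BV(Ω)} = ‖u‖_{L^1(Ω)} + |u|_{BV(Ω)}`. -/
noncomputable def bvNorm {d : ℕ} (Ω : Set (EuclideanSpace ℝ (Fin d)))
    (u : EuclideanSpace ℝ (Fin d) → ℝ) : ℝ≥0∞ :=
  (∫⁻ x in Ω, ‖u x‖ₑ) + variation Ω u

/-- The value `|∇u|(A)` on a Borel set `A` of the Radon measure `|∇u|` of `u ∈ BV(ℝ^d)`: this
measure satisfies `|∇u|(U) = |u|_{BV(U)}` for `U` open and is outer regular. -/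
noncomputable def variationMeasure {d : ℕ} (u : EuclideanSpace ℝ (Fin d) → ℝ)
    (A : Set (EuclideanSpace ℝ (Fin d))) : ℝ≥0∞ :=
  ⨅ (U : Set (EuclideanSpace ℝ (Fin d))) (_ : IsOpen U ∧ A ⊆ U), variation U u

/-! ### The spaces `W^{1,p}(Ω)` and `BV(Ω)` as vector spaces of classes of functions -/

theorem integrableOn_mul {d : ℕ} {Ω : Set (EuclideanSpace ℝ (Fin d))}
    {u ψ : EuclideanSpace ℝ (Fin d) → ℝ} (hu : LocallyIntegrableOn u Ω) (hψ : Continuous ψ)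
    (hc : HasCompactSupport ψ) (hs : tsupport ψ ⊆ Ω) :
    IntegrableOn (fun x => u x * ψ x) Ω := by
  have h1 : IntegrableOn u (tsupport ψ) := hu.integrableOn_compact_subset hs hc
  have h2 : IntegrableOn (fun x => u x * ψ x) (tsupport ψ) :=
    h1.mul_continuousOn hψ.continuousOn hc
  have h3 : Function.support (fun x => u x * ψ x) ⊆ tsupport ψ := by
    intro x hx
    refine subset_tsupport ψ ?_
    intro h0
    exact hx (by simp [h0])
  exact ((integrableOn_iff_integrable_of_support_subset h3).1 h2).integrableOn

theorem IsTestFunction.continuous_partialDeriv {d : ℕ} {F : Type*} [NormedAddCommGroup F]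
    [NormedSpace ℝ F] {Ω : Set (EuclideanSpace ℝ (Fin d))} {φ : EuclideanSpace ℝ (Fin d) → F}
    (h : IsTestFunction Ω φ) (i : Fin d) : Continuous (partialDeriv i φ) :=
  (h.1.continuous_fderiv (by simp)).clm_apply continuous_const

theorem support_partialDeriv {d : ℕ} {F : Type*} [NormedAddCommGroup F]
    [NormedSpace ℝ F] {φ : EuclideanSpace ℝ (Fin d) → F} (i : Fin d) :
    Function.support (partialDeriv i φ) ⊆ tsupport φ := by
  intro x hx
  refine support_fderiv_subset ℝ ?_
  intro h0
  exact hx (by simp [partialDeriv, h0])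

theorem IsTestFunction.integrableOn_partialDeriv {d : ℕ} {Ω : Set (EuclideanSpace ℝ (Fin d))}
    {u φ : EuclideanSpace ℝ (Fin d) → ℝ} (h : IsTestFunction Ω φ) (hu : LocallyIntegrableOn u Ω)
    (i : Fin d) : IntegrableOn (fun x => u x * partialDeriv i φ x) Ω := by
  have hs : tsupport (partialDeriv i φ) ⊆ tsupport φ :=
    closure_minimal (support_partialDeriv i) (isClosed_tsupport φ)
  exact integrableOn_mul hu (h.continuous_partialDeriv i)
    (h.2.1.of_isClosed_subset (isClosed_tsupport _) hs) (hs.trans h.2.2)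

theorem IsTestFunction.integrableOn_divergence {d : ℕ} {Ω : Set (EuclideanSpace ℝ (Fin d))}
    {u : EuclideanSpace ℝ (Fin d) → ℝ}
    {φ : EuclideanSpace ℝ (Fin d) → EuclideanSpace ℝ (Fin d)}
    (h : IsTestFunction Ω φ) (hu : LocallyIntegrableOn u Ω) :
    IntegrableOn (fun x => u x * divergence φ x) Ω := by
  have h1 : Function.support (divergence φ) ⊆ tsupport φ := by
    intro x hx
    by_contra h0
    refine hx (Finset.sum_eq_zero fun i _ => ?_)
    have : partialDeriv i φ x = 0 := by
      by_contra h2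
      exact h0 (support_partialDeriv i h2)
    simp [this]
  have hs : tsupport (divergence φ) ⊆ tsupport φ := closure_minimal h1 (isClosed_tsupport φ)
  have hcont : Continuous (divergence φ) := by
    refine continuous_finsetSum _ fun i _ => ?_
    exact (EuclideanSpace.proj (𝕜 := ℝ) i).continuous.comp (h.continuous_partialDeriv i)
  exact integrableOn_mul hu hcont (h.2.1.of_isClosed_subset (isClosed_tsupport _) hs)
    (hs.trans h.2.2)

theorem HasWeakGradient.congr {d : ℕ} {Ω : Set (EuclideanSpace ℝ (Fin d))}
    {u v : EuclideanSpace ℝ (Fin d) → ℝ}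
    {g : EuclideanSpace ℝ (Fin d) → EuclideanSpace ℝ (Fin d)}
    (h : HasWeakGradient Ω u g) (huv : u =ᵐ[volume.restrict Ω] v) : HasWeakGradient Ω v g := by
  refine ⟨h.1.congr huv, h.2.1, fun φ hφ i => ?_⟩
  rw [← h.2.2 φ hφ i]
  refine integral_congr_ae ?_
  filter_upwards [huv] with x hx
  rw [hx]

theorem locallyIntegrableOn_apply {d : ℕ} {Ω : Set (EuclideanSpace ℝ (Fin d))}
    {g : EuclideanSpace ℝ (Fin d) → EuclideanSpace ℝ (Fin d)} (h : LocallyIntegrableOn g Ω)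
    (i : Fin d) : LocallyIntegrableOn (fun x => g x i) Ω := by
  intro x hx
  obtain ⟨s, hs, hi⟩ := h x hx
  exact ⟨s, hs, (EuclideanSpace.proj (𝕜 := ℝ) i).integrable_comp hi⟩

theorem IsTestFunction.integrableOn_apply {d : ℕ} {Ω : Set (EuclideanSpace ℝ (Fin d))}
    {φ : EuclideanSpace ℝ (Fin d) → ℝ}
    {g : EuclideanSpace ℝ (Fin d) → EuclideanSpace ℝ (Fin d)}
    (hφ : IsTestFunction Ω φ) (h : LocallyIntegrableOn g Ω)
    (i : Fin d) : IntegrableOn (fun x => g x i * φ x) Ω :=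
  integrableOn_mul (locallyIntegrableOn_apply h i) hφ.1.continuous hφ.2.1 hφ.2.2

theorem HasWeakGradient.add {d : ℕ} {Ω : Set (EuclideanSpace ℝ (Fin d))}
    {u v : EuclideanSpace ℝ (Fin d) → ℝ}
    {g k : EuclideanSpace ℝ (Fin d) → EuclideanSpace ℝ (Fin d)}
    (hu : HasWeakGradient Ω u g) (hv : HasWeakGradient Ω v k) :
    HasWeakGradient Ω (u + v) (g + k) := by
  refine ⟨hu.1.add hv.1, hu.2.1.add hv.2.1, fun φ hφ i => ?_⟩
  have e1 : (fun x => (u + v) x * partialDeriv i φ x)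
      = fun x => u x * partialDeriv i φ x + v x * partialDeriv i φ x := by
    funext x; simp [add_mul]
  have e2 : (fun x => (g + k) x i * φ x) = fun x => g x i * φ x + k x i * φ x := by
    funext x; simp [add_mul]
  rw [e1, e2, integral_add (hφ.integrableOn_partialDeriv hu.1 i)
      (hφ.integrableOn_partialDeriv hv.1 i),
    integral_add (hφ.integrableOn_apply hu.2.1 i) (hφ.integrableOn_apply hv.2.1 i),
    hu.2.2 φ hφ i, hv.2.2 φ hφ i]
  ring

theorem HasWeakGradient.smul {d : ℕ} {Ω : Set (EuclideanSpace ℝ (Fin d))}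
    {u : EuclideanSpace ℝ (Fin d) → ℝ}
    {g : EuclideanSpace ℝ (Fin d) → EuclideanSpace ℝ (Fin d)}
    (hu : HasWeakGradient Ω u g) (c : ℝ) : HasWeakGradient Ω (c • u) (c • g) := by
  refine ⟨hu.1.smul c, hu.2.1.smul c, fun φ hφ i => ?_⟩
  have e1 : (fun x => (c • u) x * partialDeriv i φ x)
      = fun x => c * (u x * partialDeriv i φ x) := by
    funext x; simp [mul_assoc]
  have e2 : (fun x => (c • g) x i * φ x) = fun x => c * (g x i * φ x) := by
    funext x; simp [mul_assoc]
  rw [e1, e2, integral_const_mul, integral_const_mul, hu.2.2 φ hφ i]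
  ring

theorem HasWeakGradient.zero {d : ℕ} (Ω : Set (EuclideanSpace ℝ (Fin d))) :
    HasWeakGradient Ω 0 0 :=
  ⟨locallyIntegrableOn_zero, locallyIntegrableOn_zero, fun φ hφ i => by simp⟩

/-- The space `W^{1,p}(Ω)`. -/
noncomputable def sobolevSpace {d : ℕ} (Ω : Set (EuclideanSpace ℝ (Fin d))) (p : ℝ) :
    Submodule ℝ (Lp ℝ (ENNReal.ofReal p) (volume.restrict Ω)) where
  carrier := {f | MemSobolev Ω p f}
  zero_mem' := ⟨Lp.memLp _, 0, (HasWeakGradient.zero Ω).congr (Lp.coeFn_zero _ _ _).symm,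
    MemLp.zero⟩
  add_mem' := by
    rintro f k ⟨-, g, hg, hgp⟩ ⟨-, l, hl, hlp⟩
    exact ⟨Lp.memLp _, g + l, (hg.add hl).congr (Lp.coeFn_add f k).symm, hgp.add hlp⟩
  smul_mem' := by
    rintro c f ⟨-, g, hg, hgp⟩
    exact ⟨Lp.memLp _, c • g, (hg.smul c).congr (Lp.coeFn_smul c f).symm, hgp.const_smul c⟩

theorem variation_congr {d : ℕ} {Ω : Set (EuclideanSpace ℝ (Fin d))}
    {u v : EuclideanSpace ℝ (Fin d) → ℝ} (huv : u =ᵐ[volume.restrict Ω] v) :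
    variation Ω u = variation Ω v := by
  unfold variation
  refine iSup_congr fun φ => iSup_congr fun _ => ?_
  congr 1
  refine integral_congr_ae ?_
  filter_upwards [huv] with x hx
  rw [hx]

theorem variation_add_le {d : ℕ} {Ω : Set (EuclideanSpace ℝ (Fin d))}
    {u v : EuclideanSpace ℝ (Fin d) → ℝ} (hu : LocallyIntegrableOn u Ω)
    (hv : LocallyIntegrableOn v Ω) :
    variation Ω (u + v) ≤ variation Ω u + variation Ω v := by
  refine iSup₂_le fun φ hφ => ?_
  have e1 : (fun x => (u + v) x * divergence φ x)
      = fun x => u x * divergence φ x + v x * divergence φ x := by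
    funext x; simp [add_mul]
  rw [e1, integral_add (hφ.1.integrableOn_divergence hu) (hφ.1.integrableOn_divergence hv)]
  refine ENNReal.ofReal_add_le.trans (add_le_add ?_ ?_)
  · exact le_iSup₂_of_le φ hφ le_rfl
  · exact le_iSup₂_of_le φ hφ le_rfl

theorem divergence_neg {d : ℕ}
    (φ : EuclideanSpace ℝ (Fin d) → EuclideanSpace ℝ (Fin d)) (x : EuclideanSpace ℝ (Fin d)) :
    divergence (-φ) x = -divergence φ x := by
  simp [divergence, partialDeriv, fderiv_neg, Finset.sum_neg_distrib]

theorem variation_smul_le {d : ℕ} {Ω : Set (EuclideanSpace ℝ (Fin d))}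
    {u : EuclideanSpace ℝ (Fin d) → ℝ} (c : ℝ) :
    variation Ω (c • u) ≤ ENNReal.ofReal |c| * variation Ω u := by
  refine iSup₂_le fun φ hφ => ?_
  have e1 : (fun x => (c • u) x * divergence φ x) = fun x => c * (u x * divergence φ x) := by
    funext x; simp [mul_assoc]
  rw [e1, integral_const_mul]
  rcases le_total 0 c with hc | hc
  · rw [ENNReal.ofReal_mul hc, abs_of_nonneg hc]
    gcongr
    exact le_iSup₂_of_le φ hφ le_rfl
  · have e2 : c * ∫ x in Ω, u x * divergence φ x
        = -c * ∫ x in Ω, u x * divergence (-φ) x := by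
      simp [divergence_neg, integral_neg]
    have hn : tsupport (-φ) = tsupport φ := by
      simp only [tsupport, Function.support_neg]
    have hφ' : IsTestFunction Ω (-φ) ∧ ∀ x, ‖(-φ) x‖ ≤ 1 :=
      ⟨⟨hφ.1.1.neg, hφ.1.2.1.neg, hn ▸ hφ.1.2.2⟩, fun x => by simpa using hφ.2 x⟩
    rw [e2, ENNReal.ofReal_mul (by linarith), abs_of_nonpos hc]
    gcongr
    exact le_iSup₂_of_le (-φ) hφ' le_rfl

/-- The space `BV(Ω)`. -/
noncomputable def bvSpace {d : ℕ} (Ω : Set (EuclideanSpace ℝ (Fin d))) :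
    Submodule ℝ (Lp ℝ 1 (volume.restrict Ω)) where
  carrier := {f | MemBV Ω f}
  zero_mem' := by
    refine ⟨Lp.memLp _, ?_⟩
    rw [variation_congr (Lp.coeFn_zero _ _ _)]
    simp [variation]
  add_mem' := by
    rintro f k ⟨-, hf⟩ ⟨-, hk⟩
    refine ⟨Lp.memLp _, ?_⟩
    rw [variation_congr (Lp.coeFn_add f k)]
    have h (w : Lp ℝ 1 (volume.restrict Ω)) : LocallyIntegrableOn w Ω :=
      IntegrableOn.locallyIntegrableOn (memLp_one_iff_integrable.1 (Lp.memLp w))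
    exact (variation_add_le (h f) (h k)).trans_lt (ENNReal.add_lt_top.2 ⟨hf, hk⟩)
  smul_mem' := by
    rintro c f ⟨-, hf⟩
    refine ⟨Lp.memLp _, ?_⟩
    rw [variation_congr (Lp.coeFn_smul c f)]
    exact (variation_smul_le c).trans_lt (ENNReal.mul_lt_top ENNReal.ofReal_lt_top hf)

/-- `Ω` is a `W^{1,p}`-extension domain: there is a bounded linear extension operator
`E : W^{1,p}(Ω) → W^{1,p}(ℝ^d)`. -/
def IsSobolevExtensionDomain {d : ℕ} (Ω : Set (EuclideanSpace ℝ (Fin d))) (p : ℝ) : Prop :=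
  IsOpen Ω ∧
  ∃ (E : sobolevSpace Ω p →ₗ[ℝ] sobolevSpace (univ : Set (EuclideanSpace ℝ (Fin d))) p)
    (C : ℝ≥0), ∀ u : sobolevSpace Ω p,
      ⇑(E u).1 =ᵐ[volume.restrict Ω] ⇑u.1 ∧
      sobolevNorm univ p (E u).1 ≤ C * sobolevNorm Ω p u.1

/-- `Ω` is a `BV`-extension domain: there is a bounded linear extension operator
`E : BV(Ω) → BV(ℝ^d)` such that `|∇(E u)|(∂Ω) = 0` for all `u ∈ BV(Ω)`. -/
def IsBVExtensionDomain {d : ℕ} (Ω : Set (EuclideanSpace ℝ (Fin d))) : Prop :=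
  IsOpen Ω ∧
  ∃ (E : bvSpace Ω →ₗ[ℝ] bvSpace (univ : Set (EuclideanSpace ℝ (Fin d))))
    (C : ℝ≥0), ∀ u : bvSpace Ω,
      ⇑(E u).1 =ᵐ[volume.restrict Ω] ⇑u.1 ∧
      bvNorm univ (E u).1 ≤ C * bvNorm Ω u.1 ∧
      variationMeasure (E u).1 (frontier Ω) = 0

/-- The surface measure `σ_{d-1}` on the unit sphere `𝕊^{d-1}` of `ℝ^d`. -/
noncomputable def sphereMeasure (d : ℕ) :
    Measure (Metric.sphere (0 : EuclideanSpace ℝ (Fin d)) 1) :=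
  (volume : Measure (EuclideanSpace ℝ (Fin d))).toSphere

/-- The area `|𝕊^{d-1}|` of the unit sphere. -/
noncomputable def sphereArea (d : ℕ) : ℝ≥0∞ := sphereMeasure d univ

/-- The mean value of `|w · e|^p` over `w ∈ 𝕊^{d-1}`; this is the constant `K_{d,p}` for every unit
vector `e`. -/
noncomputable def sphereMean {d : ℕ} (p : ℝ) (e : EuclideanSpace ℝ (Fin d)) : ℝ≥0∞ :=
  ⨍⁻ w, ‖inner ℝ (w : EuclideanSpace ℝ (Fin d)) e‖ₑ ^ p ∂(sphereMeasure d)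

end BBM

set_option linter.unusedSectionVars false

/-! All three double integrals are `energy p (k n) Ω Ω u` for suitable radial kernels `k n`. The
mass of `r^(d-1+p) k n(r) dr` on every `(0, δ)` tends to a constant `c`, while the mass of `r^(d-1)
k n(r) dr` on `[δ, ∞)` tends to `0`. This is `ConcentratingKernel`, with `c = 1/p`, `1/d` and `1`
respectively. Near the diagonal `u(x+h) - u(x)` behaves like `∇u(x) · h`, so polar coordinates turn
the inner integral into `c ∫ |w · ∇u(x)|^p dσ(w)`, which rotation invariance (`sphereMoment_eq`)
evaluates as `c * sphereMoment p e * |∇u(x)|^p`. `ConcentratingKernel.tendsto_energy` makes this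
rigorous by two one-sided bounds.

The lower bound asks nothing of `Ω` but openness. A mollification averages translates of `u`, so by
Jensen its short-range energy on a compact subset of `Ω` is at most the energy of `u`
(`lintegral_mollify_le_energy`). The mollification is smooth, so Fatou's lemma and differentiability
bound the integral of its gradient on the compact set. As the bump shrinks, this bound passes to the
variation by duality with test fields and to a weak gradient by Fatou. If `p > 1` and the energies
have finite liminf, the mollified gradients are bounded in `L^p` on compact sets, and weak
compactness produces a weak gradient (`ConcentratingKernel.exists_hasWeakGradient`).

The upper bound uses an extension `v` of `u`. For `v` in `W^{1,p}`, increments are linear up to an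
error `o(|h|)` in `L^p`, and the estimate is local in `x`: with `x` restricted to `Ω`, only the
gradient on `Ω` enters. For `v` in `BV` the increments are controlled by the variation on the whole
space only. The bound is localized by subtracting the lower bound on the exterior of `Ω`; since `∂Ω`
carries no variation, exactly the variation on `Ω` remains
(`ConcentratingKernel.limsup_energy_le_variation_of_frontier`). -/

namespace BBM

/-! ### Polar coordinates and moments of the sphere. -/

section Polar

variable {E : Type*} [NormedAddCommGroup E] [InnerProductSpace ℝ E] [FiniteDimensional ℝ E]
  [MeasurableSpace E] [BorelSpace E]

local notation "dim" => Module.finrank ℝ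

/-- Integration in polar coordinates. -/
theorem lintegral_polar [Nontrivial E] {f : E → ℝ≥0∞} (hf : Measurable f) :
    ∫⁻ x, f x = ∫⁻ w : Metric.sphere (0 : E) 1, ∫⁻ r in Ioi (0 : ℝ),
      ENNReal.ofReal (r ^ (dim E - 1)) * f (r • (w : E)) ∂volume
        ∂(volume : Measure E).toSphere := by
  have h0 : MeasurableSet ({0}ᶜ : Set E) := (measurableSet_singleton _).compl
  have hg : Measurable (fun z : Metric.sphere (0 : E) 1 × Ioi (0 : ℝ) => f (z.2.1 • z.1.1)) := by
    fun_prop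
  calc ∫⁻ x, f x = ∫⁻ x in ({0}ᶜ : Set E), f x := by rw [restrict_compl_singleton]
    _ = ∫⁻ x : ({0}ᶜ : Set E), f x ∂(volume.comap Subtype.val) := by
      rw [lintegral_subtype_comap h0]
    _ = ∫⁻ x : ({0}ᶜ : Set E), (fun z : Metric.sphere (0 : E) 1 × Ioi (0 : ℝ) =>
          f (z.2.1 • z.1.1)) (homeomorphUnitSphereProd E x) ∂(volume.comap Subtype.val) := by
      refine lintegral_congr fun x => ?_
      have hx : ‖(x : E)‖ ≠ 0 := norm_ne_zero_iff.2 x.2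
      simp [smul_smul, hx]
    _ = ∫⁻ z : Metric.sphere (0 : E) 1 × Ioi (0 : ℝ), f (z.2.1 • z.1.1)
          ∂((volume : Measure E).toSphere.prod (Measure.volumeIoiPow (dim E - 1))) :=
      (Measure.measurePreserving_homeomorphUnitSphereProd volume).lintegral_comp hg
    _ = _ := by
      rw [lintegral_prod _ hg.aemeasurable]
      refine lintegral_congr fun w => ?_
      have hw : Measurable fun r : ℝ => f (r • (w : E)) := by fun_prop
      have hw' : Measurable fun r : Ioi (0 : ℝ) => f ((r : ℝ) • (w : E)) :=
        hw.comp measurable_subtype_coe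
      refine (lintegral_withDensity_eq_lintegral_mul _ (by fun_prop) hw').trans ?_
      exact lintegral_subtype_comap measurableSet_Ioi
        (fun r => ENNReal.ofReal (r ^ (dim E - 1)) * f (r • (w : E)))

/-- Homogeneity of `H` separates radius from angle. Every bound for increments below is first
replaced by a homogeneous `H`, so that this factorization applies. -/
theorem lintegral_ball_radial_mul [Nontrivial E] {k : ℝ → ℝ≥0∞} (hk : Measurable k) {p : ℝ}
    {H : E → ℝ≥0∞} (hH : Measurable H)
    (hom : ∀ (r : ℝ) (x : E), 0 < r → H (r • x) = ENNReal.ofReal r ^ p * H x) (δ : ℝ) :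
    ∫⁻ x in Metric.ball (0 : E) δ, k ‖x‖ * H x =
      (∫⁻ r in Ioo 0 δ, ENNReal.ofReal (r ^ (dim E - 1)) * (k r * ENNReal.ofReal r ^ p)) *
        ∫⁻ w : Metric.sphere (0 : E) 1, H w ∂(volume : Measure E).toSphere := by
  have hm : Measurable fun x : E => k ‖x‖ * H x := by fun_prop
  have hH' : Measurable fun w : Metric.sphere (0 : E) 1 => H w := hH.comp measurable_subtype_coe
  rw [← lintegral_indicator Metric.isOpen_ball.measurableSet,
    lintegral_polar (hm.indicator Metric.isOpen_ball.measurableSet),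
    ← lintegral_const_mul _ hH']
  refine lintegral_congr fun w => ?_
  have hw : ‖(w : E)‖ = 1 := by simp
  rw [← lintegral_mul_const _ (by fun_prop), ← lintegral_indicator measurableSet_Ioi,
    ← lintegral_indicator measurableSet_Ioo]
  refine lintegral_congr fun r => ?_
  by_cases hr : 0 < r
  · by_cases hd : r < δ
    · simp [indicator, hr, hd, norm_smul, hw, abs_of_pos hr, hom r _ hr, mul_assoc]
    · simp [indicator, hr, hd, norm_smul, hw, abs_of_pos hr]
  · simp [indicator, hr]

theorem lintegral_radial_compl_ball [Nontrivial E] {k : ℝ → ℝ≥0∞} (hk : Measurable k) {δ : ℝ}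
    (hδ : 0 < δ) :
    ∫⁻ x in (Metric.ball (0 : E) δ)ᶜ, k ‖x‖ =
      (∫⁻ r in Ici δ, ENNReal.ofReal (r ^ (dim E - 1)) * k r) *
        (volume : Measure E).toSphere univ := by
  have hm : Measurable fun x : E => k ‖x‖ := by fun_prop
  have hs : MeasurableSet (Metric.ball (0 : E) δ)ᶜ := Metric.isOpen_ball.measurableSet.compl
  rw [← lintegral_indicator hs, lintegral_polar (hm.indicator hs), ← lintegral_const]
  refine lintegral_congr fun w => ?_
  have hw : ‖(w : E)‖ = 1 := by simp
  rw [← lintegral_indicator measurableSet_Ioi, ← lintegral_indicator measurableSet_Ici]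
  refine lintegral_congr fun r => ?_
  by_cases hr : 0 < r
  · by_cases hd : δ ≤ r
    · simp [indicator, hr, hd, norm_smul, hw, abs_of_pos hr]
    · simp [indicator, hr, hd, norm_smul, hw, abs_of_pos hr]
  · have : ¬ δ ≤ r := by linarith
    simp [indicator, hr, this]

/-- The integral of `|w · v|^p` over the unit sphere. -/
noncomputable def sphereMoment (p : ℝ) (v : E) : ℝ≥0∞ :=
  ∫⁻ w : Metric.sphere (0 : E) 1, ‖inner ℝ (w : E) v‖ₑ ^ p ∂(volume : Measure E).toSphere

theorem measurable_enorm_inner_rpow (p : ℝ) (v : E) :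
    Measurable fun x : E => ‖inner ℝ x v‖ₑ ^ p := by
  have : Continuous fun x : E => inner ℝ x v := by fun_prop
  exact (this.measurable.enorm).pow_const p

theorem enorm_inner_rpow_smul {p : ℝ} (hp : 0 ≤ p) (v : E) (r : ℝ) (x : E) (hr : 0 < r) :
    ‖inner ℝ (r • x) v‖ₑ ^ p = ENNReal.ofReal r ^ p * ‖inner ℝ x v‖ₑ ^ p := by
  rw [real_inner_smul_left, enorm_mul, ENNReal.mul_rpow_of_nonneg _ _ hp, Real.enorm_of_nonneg hr.le]

theorem sphereMoment_lt_top {p : ℝ} (hp : 0 ≤ p) (v : E) : sphereMoment p v < ⊤ := by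
  have h : sphereMoment p v ≤ ∫⁻ _ : Metric.sphere (0 : E) 1, ‖v‖ₑ ^ p
      ∂(volume : Measure E).toSphere := by
    refine lintegral_mono fun w => ENNReal.rpow_le_rpow ?_ hp
    have h1 : ‖inner ℝ (w : E) v‖ ≤ ‖v‖ := by
      simpa using norm_inner_le_norm (𝕜 := ℝ) (w : E) v
    exact enorm_le_iff_norm_le.2 h1
  refine h.trans_lt ?_
  rw [lintegral_const]
  exact ENNReal.mul_lt_top (ENNReal.rpow_lt_top_of_nonneg hp enorm_ne_top) (measure_lt_top _ _)

theorem lintegral_Ioo_zero_one_ne_zero (m : ℕ) (p : ℝ) :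
    ∫⁻ r in Ioo (0 : ℝ) 1, ENNReal.ofReal (r ^ m) * (1 * ENNReal.ofReal r ^ p) ≠ 0 := by
  have hm : Measurable fun r : ℝ => ENNReal.ofReal (r ^ m) * (1 * ENNReal.ofReal r ^ p) := by
    fun_prop
  rw [← pos_iff_ne_zero, setLIntegral_pos_iff hm]
  have : Function.support (fun r : ℝ => ENNReal.ofReal (r ^ m) * (1 * ENNReal.ofReal r ^ p))
      ∩ Ioo 0 1 = Ioo 0 1 := by
    refine inter_eq_right.2 fun r hr => ?_
    have h1 : ENNReal.ofReal r ≠ 0 := by simpa using hr.1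
    refine mul_ne_zero (by simpa using pow_pos hr.1 m) (mul_ne_zero one_ne_zero ?_)
    exact (ENNReal.rpow_pos (pos_iff_ne_zero.2 h1) ENNReal.ofReal_ne_top).ne'
  rw [this]
  simp

theorem lintegral_Ioo_zero_one_ne_top (m : ℕ) {p : ℝ} (hp : 0 ≤ p) :
    ∫⁻ r in Ioo (0 : ℝ) 1, ENNReal.ofReal (r ^ m) * (1 * ENNReal.ofReal r ^ p) ≠ ⊤ := by
  have : ∫⁻ r in Ioo (0 : ℝ) 1, ENNReal.ofReal (r ^ m) * (1 * ENNReal.ofReal r ^ p)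
      ≤ ∫⁻ r in Ioo (0 : ℝ) 1, 1 := by
    refine setLIntegral_mono measurable_const fun r hr => ?_
    rw [one_mul]
    refine mul_le_one' (ENNReal.ofReal_le_one.2 (pow_le_one₀ hr.1.le hr.2.le)) ?_
    exact ENNReal.rpow_le_one (ENNReal.ofReal_le_one.2 hr.2.le) hp
  refine (this.trans_lt ?_).ne
  simp

theorem lintegral_ball_enorm_inner [Nontrivial E] {p : ℝ} (hp : 0 ≤ p) (v : E) :
    ∫⁻ x in Metric.ball (0 : E) 1, ‖inner ℝ x v‖ₑ ^ p =
      (∫⁻ r in Ioo (0 : ℝ) 1, ENNReal.ofReal (r ^ (dim E - 1)) * (1 * ENNReal.ofReal r ^ p)) *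
        sphereMoment p v := by
  simpa [sphereMoment] using lintegral_ball_radial_mul (E := E) (k := fun _ => 1) measurable_const
    (measurable_enorm_inner_rpow p v) (fun r x hr => enorm_inner_rpow_smul hp v r x hr) 1

/-- Lebesgue measure on the unit ball is invariant under isometries. The integral over the ball is
the spherical moment times a radial factor that is neither `0` nor `∞`, so this factor cancels and
the invariance descends to the sphere. -/
theorem sphereMoment_isometry [Nontrivial E] {p : ℝ} (hp : 0 ≤ p) (L : E ≃ₗᵢ[ℝ] E) (v : E) :
    sphereMoment p (L v) = sphereMoment p v := by
  have h : ∫⁻ x in Metric.ball (0 : E) 1, ‖inner ℝ x (L v)‖ₑ ^ p =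
      ∫⁻ x in Metric.ball (0 : E) 1, ‖inner ℝ x v‖ₑ ^ p := by
    have h1 := L.measurePreserving.setLIntegral_comp_preimage
      (Metric.isOpen_ball (x := (0 : E)) (ε := 1)).measurableSet
      (measurable_enorm_inner_rpow p (L v))
    simpa [LinearIsometryEquiv.inner_map_map] using h1.symm
  rw [lintegral_ball_enorm_inner hp, lintegral_ball_enorm_inner hp] at h
  exact (ENNReal.mul_right_inj (lintegral_Ioo_zero_one_ne_zero _ p)
    (lintegral_Ioo_zero_one_ne_top _ hp)).1 h

theorem sphereMoment_smul {p : ℝ} (hp : 0 ≤ p) (c : ℝ) (v : E) :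
    sphereMoment p (c • v) = ‖c‖ₑ ^ p * sphereMoment p v := by
  unfold sphereMoment
  have hm : Measurable fun w : Metric.sphere (0 : E) 1 => ‖inner ℝ (w : E) v‖ₑ ^ p :=
    (measurable_enorm_inner_rpow p v).comp measurable_subtype_coe
  rw [← lintegral_const_mul _ hm]
  refine lintegral_congr fun w => ?_
  rw [real_inner_smul_right, enorm_mul, ENNReal.mul_rpow_of_nonneg _ _ hp]

theorem sphereMoment_eq [Nontrivial E] {p : ℝ} (hp : 0 < p) {e : E} (he : ‖e‖ = 1) (v : E) :
    sphereMoment p v = ‖v‖ₑ ^ p * sphereMoment p e := by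
  -- Two vectors of equal norm are exchanged by the reflection in the hyperplane orthogonal to their
  -- difference.
  have h : ∃ L : E ≃ₗᵢ[ℝ] E, L (‖v‖ • e) = v :=
    ⟨Submodule.reflection (ℝ ∙ (‖v‖ • e - v))ᗮ, by
      apply Submodule.reflection_sub; simp [norm_smul, he]⟩
  obtain ⟨L, hL⟩ := h
  rw [← sphereMoment_isometry hp.le L.symm v, ← hL, L.symm_apply_apply, sphereMoment_smul hp.le, hL,
    enorm_norm]

/-- A vanishing moment would make `|x · e|^p` vanish almost everywhere in the ball, whereas it is
positive on a nonempty open subset. Positivity of the constant matters when the local energy is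
infinite and when gradients are bounded by energies. -/
theorem sphereMoment_ne_zero [Nontrivial E] {p : ℝ} (hp : 0 ≤ p) {e : E} (he : ‖e‖ = 1) :
    sphereMoment p e ≠ 0 := by
  intro h0
  have h := lintegral_ball_enorm_inner hp e
  rw [h0, mul_zero, setLIntegral_eq_zero_iff Metric.isOpen_ball.measurableSet
    (measurable_enorm_inner_rpow p e)] at h
  have hU : IsOpen (Metric.ball (0 : E) 1 ∩ {x : E | inner ℝ x e ≠ 0}) := by
    refine Metric.isOpen_ball.inter ?_
    exact isOpen_ne_fun (by fun_prop) continuous_const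
  have hne : (Metric.ball (0 : E) 1 ∩ {x : E | inner ℝ x e ≠ 0}).Nonempty := by
    refine ⟨(2⁻¹ : ℝ) • e, ?_, ?_⟩
    · simp [norm_smul, he]; norm_num
    · simp [real_inner_smul_left, he]
  refine (hU.measure_pos volume hne).ne' ?_
  rw [← nonpos_iff_eq_zero]
  refine (measure_mono (fun x hx => ?_)).trans_eq h
  simp only [mem_compl_iff, mem_ofPred_eq, Classical.not_imp]
  refine ⟨hx.1, ?_⟩
  have h2 : 0 < ‖inner ℝ x e‖ₑ := by simpa using hx.2
  exact (ENNReal.rpow_pos h2 enorm_ne_top).ne'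

end Polar

/-! ### Concentrating kernels, nonlocal energies and the pointwise lower bound. -/

section Energy

/-- A sequence of radial kernels on a space of dimension `m + 1` which concentrates at the origin:
`c` is the limit of the radial part of the integral of `k n ‖h‖ * ‖h‖ ^ p` over balls. -/
structure ConcentratingKernel (m : ℕ) (p : ℝ) (k : ℕ → ℝ → ℝ≥0∞) (c : ℝ≥0∞) : Prop where
  measurable : ∀ n, Measurable (k n)
  near : ∀ δ : ℝ, 0 < δ → Tendsto (fun n => ∫⁻ r in Ioo 0 δ,
    ENNReal.ofReal (r ^ m) * (k n r * ENNReal.ofReal r ^ p)) atTop (𝓝 c)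
  far : ∀ δ : ℝ, 0 < δ → Tendsto (fun n => ∫⁻ r in Ici δ, ENNReal.ofReal (r ^ m) * k n r) atTop
    (𝓝 0)
  ne_zero : c ≠ 0
  ne_top : c ≠ ⊤

variable {E : Type*} [NormedAddCommGroup E] [InnerProductSpace ℝ E] [FiniteDimensional ℝ E]
  [MeasurableSpace E] [BorelSpace E]

/-- The nonlocal energy of `u` between the sets `A` and `B` with the radial kernel `k`. -/
noncomputable def energy (p : ℝ) (k : ℝ → ℝ≥0∞) (A B : Set E) (u : E → ℝ) : ℝ≥0∞ :=
  ∫⁻ x in A, ∫⁻ y in B, k ‖x - y‖ * ‖u x - u y‖ₑ ^ p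

theorem energy_congr {p : ℝ} {k : ℝ → ℝ≥0∞} {A B : Set E} {u v : E → ℝ}
    (hA : u =ᵐ[volume.restrict A] v) (hB : u =ᵐ[volume.restrict B] v) :
    energy p k A B u = energy p k A B v := by
  refine lintegral_congr_ae ?_
  filter_upwards [hA] with x hx
  refine lintegral_congr_ae ?_
  filter_upwards [hB] with y hy
  rw [hx, hy]

theorem energy_mono {p : ℝ} {k : ℝ → ℝ≥0∞} {A A' B B' : Set E} (u : E → ℝ)
    (hA : A ⊆ A') (hB : B ⊆ B') : energy p k A B u ≤ energy p k A' B' u :=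
  (lintegral_mono fun _ => lintegral_mono_set hB).trans (lintegral_mono_set hA)

/-- The interactions between `A` and `B` are simply dropped. This superadditivity drives the
localization in the `BV` case. -/
theorem energy_add_le_energy_univ {p : ℝ} {k : ℝ → ℝ≥0∞} {A B : Set E} (u : E → ℝ)
    (hB : MeasurableSet B) (hAB : Disjoint A B) :
    energy p k A A u + energy p k B B u ≤ energy p k univ univ u := by
  calc energy p k A A u + energy p k B B u ≤ energy p k A univ u + energy p k B univ u :=
        add_le_add (energy_mono u le_rfl (subset_univ _)) (energy_mono u le_rfl (subset_univ _))
    _ = energy p k (A ∪ B) univ u := (lintegral_union hB hAB).symm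
    _ ≤ _ := energy_mono u (subset_univ _) le_rfl

theorem lintegral_translate (p : ℝ) (k : ℝ → ℝ≥0∞) (u : E → ℝ) (x : E) :
    ∫⁻ y, k ‖x - y‖ * ‖u x - u y‖ₑ ^ p = ∫⁻ h, k ‖h‖ * ‖u (x + h) - u x‖ₑ ^ p := by
  rw [← lintegral_add_left_eq_self _ x]
  refine lintegral_congr fun h => ?_
  rw [← enorm_neg (u (x + h) - u x)]
  simp

/-- With `y` running over the whole space, Tonelli expresses the energy through the `L^p` size of
the increments, which is what the upper bounds estimate. -/
theorem energy_univ_right {p : ℝ} {k : ℝ → ℝ≥0∞} (hk : Measurable k) (A : Set E) {u : E → ℝ}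
    (hu : Measurable u) :
    energy p k A univ u = ∫⁻ h, k ‖h‖ * ∫⁻ x in A, ‖u (x + h) - u x‖ₑ ^ p := by
  unfold energy
  simp only [Measure.restrict_univ, lintegral_translate]
  rw [lintegral_lintegral_swap (by fun_prop)]
  exact lintegral_congr fun h => lintegral_const_mul _ (by fun_prop)

variable [Nontrivial E] {p : ℝ} {k : ℕ → ℝ → ℝ≥0∞} {c : ℝ≥0∞}

theorem ConcentratingKernel.tendsto_near (hk : ConcentratingKernel (Module.finrank ℝ E - 1) p k c)
    {H : E → ℝ≥0∞} (hH : Measurable H)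
    (hom : ∀ (r : ℝ) (x : E), 0 < r → H (r • x) = ENNReal.ofReal r ^ p * H x) {δ : ℝ}
    (hδ : 0 < δ) :
    Tendsto (fun n => ∫⁻ h in Metric.ball (0 : E) δ, k n ‖h‖ * H h) atTop
      (𝓝 (c * ∫⁻ w : Metric.sphere (0 : E) 1, H w ∂(volume : Measure E).toSphere)) := by
  simp only [lintegral_ball_radial_mul (hk.measurable _) hH hom δ]
  exact ENNReal.Tendsto.mul_const (hk.near δ hδ) (Or.inl hk.ne_zero)

theorem ConcentratingKernel.tendsto_far (hk : ConcentratingKernel (Module.finrank ℝ E - 1) p k c)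
    {δ : ℝ} (hδ : 0 < δ) :
    Tendsto (fun n => ∫⁻ h in (Metric.ball (0 : E) δ)ᶜ, k n ‖h‖) atTop (𝓝 0) := by
  simp only [lintegral_radial_compl_ball (hk.measurable _) hδ]
  have := ENNReal.Tendsto.mul_const (b := (volume : Measure E).toSphere univ) (hk.far δ hδ)
    (Or.inr (measure_ne_top _ _))
  simpa using this

/-- Lower bound for the near part of the energy density at a point of differentiability. -/
theorem ConcentratingKernel.le_liminf_of_hasFDerivAt
    (hk : ConcentratingKernel (Module.finrank ℝ E - 1) p k c) (hp : 0 < p)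
    {f : E → ℝ} {x v : E} (hf : HasFDerivAt f (innerSL ℝ v) x) {δ : ℝ} (hδ : 0 < δ) :
    c * sphereMoment p v ≤
      liminf (fun n => ∫⁻ h in Metric.ball (0 : E) δ, k n ‖h‖ * ‖f (x + h) - f x‖ₑ ^ p)
        atTop := by
  -- A homogeneous minorant of the increment near `0`, allowing an error `τ ‖h‖` in the
  -- differentiability. The subtraction is truncated at `0`, so that `H` remains homogeneous and no
  -- sign is discussed.
  set H : ℝ≥0 → E → ℝ≥0∞ := fun τ h => (‖inner ℝ h v‖ₑ - τ * ‖h‖ₑ) ^ p with hHdef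
  have hHm (τ : ℝ≥0) : Measurable (H τ) := by
    have : Continuous fun x : E => inner ℝ x v := by fun_prop
    have := this.measurable
    fun_prop
  have hHhom (τ : ℝ≥0) (r : ℝ) (x : E) (hr : 0 < r) :
      H τ (r • x) = ENNReal.ofReal r ^ p * H τ x := by
    simp only [hHdef]
    rw [real_inner_smul_left, enorm_mul, enorm_smul, Real.enorm_of_nonneg hr.le,
      ← ENNReal.mul_rpow_of_nonneg _ _ hp.le, ENNReal.mul_sub (fun _ _ => ENNReal.ofReal_ne_top)]
    congr 2
    ring
  have key (τ : ℝ≥0) (hτ : 0 < τ) :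
      c * ∫⁻ w : Metric.sphere (0 : E) 1, H τ w ∂(volume : Measure E).toSphere ≤
      liminf (fun n => ∫⁻ h in Metric.ball (0 : E) δ, k n ‖h‖ * ‖f (x + h) - f x‖ₑ ^ p)
        atTop := by
    obtain ⟨ε, hε, hb⟩ : ∃ ε > 0, ∀ h : E, ‖h‖ < ε →
        ‖f (x + h) - f x - inner ℝ v h‖ ≤ τ * ‖h‖ := by
      have h1 := (hasFDerivAt_iff_isLittleO_nhds_zero.1 hf).def (c := (τ : ℝ)) (by exact_mod_cast hτ)
      obtain ⟨ε, hε, h2⟩ := Metric.eventually_nhds_iff.1 h1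
      exact ⟨ε, hε, fun h hh => by simpa using h2 (by simpa using hh)⟩
    -- The limit over a ball does not depend on its radius, hence the ball may be shrunk to one
    -- where the differentiability estimate holds.
    have h3 := hk.tendsto_near (hHm τ) (hHhom τ) (lt_min hε hδ)
    rw [← h3.liminf_eq]
    refine liminf_le_liminf (Eventually.of_forall fun n => ?_)
    calc ∫⁻ h in Metric.ball (0 : E) (min ε δ), k n ‖h‖ * H τ h
        ≤ ∫⁻ h in Metric.ball (0 : E) (min ε δ), k n ‖h‖ * ‖f (x + h) - f x‖ₑ ^ p := by
          refine setLIntegral_mono' Metric.isOpen_ball.measurableSet fun h hh => ?_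
          refine mul_le_mul_right (ENNReal.rpow_le_rpow ?_ hp.le) _
          rw [tsub_le_iff_right]
          have h4 := hb h (by simp at hh; exact hh.1)
          have h5 : ‖inner ℝ h v‖ ≤ ‖f (x + h) - f x‖ + τ * ‖h‖ := by
            rw [real_inner_comm]
            have : inner ℝ v h = (f (x + h) - f x) - (f (x + h) - f x - inner ℝ v h) := by ring
            rw [this]
            exact (norm_sub_le _ _).trans (by gcongr)
          have h6 := ENNReal.ofReal_le_ofReal h5
          rw [ENNReal.ofReal_add (by positivity) (by positivity),
            ENNReal.ofReal_mul (by positivity)] at h6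
          simpa only [ofReal_norm, ENNReal.ofReal_coe_nnreal] using h6
      _ ≤ _ := lintegral_mono_set (Metric.ball_subset_ball (min_le_right _ _))
  -- The error `τ = 1/(j+1)` is sent to `0`; the minorants increase, so monotone convergence
  -- applies.
  have hlim : Tendsto (fun j : ℕ => c * ∫⁻ w : Metric.sphere (0 : E) 1,
      H (1 / ((j : ℝ≥0) + 1)) w ∂(volume : Measure E).toSphere) atTop
      (𝓝 (c * sphereMoment p v)) := by
    refine ENNReal.Tendsto.const_mul ?_ (Or.inr hk.ne_top)
    refine lintegral_tendsto_of_tendsto_of_monotone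
      (fun j => ((hHm _).comp measurable_subtype_coe).aemeasurable) ?_ ?_
    · refine Eventually.of_forall fun w i j hij => ?_
      simp only [hHdef]
      gcongr
    · refine Eventually.of_forall fun w => ?_
      simp only [hHdef]
      refine (ENNReal.continuous_rpow_const.tendsto _).comp ?_
      have h1 : Tendsto (fun j : ℕ => (((1 / ((j : ℝ≥0) + 1) : ℝ≥0)) : ℝ≥0∞) * ‖(w : E)‖ₑ) atTop
          (𝓝 (((0 : ℝ≥0) : ℝ≥0∞) * ‖(w : E)‖ₑ)) :=
        ENNReal.Tendsto.mul_const (ENNReal.tendsto_coe.2 tendsto_one_div_add_atTop_nhds_zero_nat)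
          (Or.inr enorm_ne_top)
      have h2 := ENNReal.Tendsto.sub (tendsto_const_nhds (x := ‖inner ℝ (w : E) v‖ₑ)) h1
        (Or.inl enorm_ne_top)
      simpa using h2
  exact le_of_tendsto' hlim fun j => key _ (by positivity)

end Energy

/-! ### Jensen's inequality for powers. -/

section Jensen

theorem lintegral_rpow_le_lintegral_rpow {α : Type*} [MeasurableSpace α] {μ : Measure α}
    [IsProbabilityMeasure μ] {p : ℝ} (hp : 1 ≤ p) {f : α → ℝ≥0∞} (hf : AEMeasurable f μ) :
    (∫⁻ a, f a ∂μ) ^ p ≤ ∫⁻ a, f a ^ p ∂μ := by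
  have h := eLpNorm'_le_eLpNorm'_of_exponent_le (f := f) one_pos hp μ hf.aestronglyMeasurable
  have hp0 : 0 < p := by linarith
  simp only [eLpNorm', enorm_eq_self, ENNReal.rpow_one, div_one] at h
  calc (∫⁻ a, f a ∂μ) ^ p ≤ ((∫⁻ a, f a ^ p ∂μ) ^ (1 / p)) ^ p := by gcongr
    _ = _ := by rw [← ENNReal.rpow_mul, one_div_mul_cancel hp0.ne', ENNReal.rpow_one]

theorem enorm_integral_rpow_le {α F : Type*} [MeasurableSpace α] {μ : Measure α}
    [NormedAddCommGroup F] [NormedSpace ℝ F]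
    [IsProbabilityMeasure μ] {p : ℝ} (hp : 1 ≤ p) {f : α → F} (hf : AEStronglyMeasurable f μ) :
    ‖∫ a, f a ∂μ‖ₑ ^ p ≤ ∫⁻ a, ‖f a‖ₑ ^ p ∂μ :=
  (ENNReal.rpow_le_rpow (enorm_integral_le_lintegral_enorm f) (by linarith)).trans
    (lintegral_rpow_le_lintegral_rpow hp hf.enorm)

end Jensen

/-! ### Mollification as an average of translates, and its effect on the energy. -/

section Mollify

variable {E : Type*} [NormedAddCommGroup E] [InnerProductSpace ℝ E] [FiniteDimensional ℝ E]
  [MeasurableSpace E] [BorelSpace E] {F : Type*} [NormedAddCommGroup F] [NormedSpace ℝ F]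

/-- The mollification of `u` by a normalized bump function. -/
noncomputable def mollify (φ : ContDiffBump (0 : E)) (u : E → F) (x : E) : F :=
  ∫ w, φ.normed volume w • u (x - w)

theorem mollify_eq_convolution (φ : ContDiffBump (0 : E)) (u : E → F) :
    mollify φ u = convolution (φ.normed volume) u (ContinuousLinearMap.lsmul ℝ ℝ) volume := rfl

/-- The probability measure with density a normalized bump function. -/
noncomputable def bumpMeasure (φ : ContDiffBump (0 : E)) : Measure E :=
  volume.withDensity fun w => ENNReal.ofReal (φ.normed volume w)

instance (φ : ContDiffBump (0 : E)) : IsProbabilityMeasure (bumpMeasure φ) := by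
  constructor
  rw [bumpMeasure, withDensity_apply _ MeasurableSet.univ, Measure.restrict_univ,
    ← ofReal_integral_eq_lintegral_ofReal φ.integrable_normed
      (Eventually.of_forall φ.nonneg_normed), φ.integral_normed, ENNReal.ofReal_one]

theorem integral_bumpMeasure (φ : ContDiffBump (0 : E)) (f : E → F) :
    ∫ w, f w ∂(bumpMeasure φ) = ∫ w, φ.normed volume w • f w := by
  rw [bumpMeasure, integral_withDensity_eq_integral_toReal_smul
    (φ.continuous_normed.measurable.ennreal_ofReal) (by simp)]
  simp [ENNReal.toReal_ofReal, φ.nonneg_normed]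

theorem mollify_eq_integral (φ : ContDiffBump (0 : E)) (u : E → F) (x : E) :
    mollify φ u x = ∫ w, u (x - w) ∂(bumpMeasure φ) :=
  (integral_bumpMeasure φ fun w => u (x - w)).symm

theorem ae_bumpMeasure (φ : ContDiffBump (0 : E)) : ∀ᵐ w ∂(bumpMeasure φ), ‖w‖ < φ.rOut := by
  rw [bumpMeasure, ae_withDensity_iff (φ.continuous_normed.measurable.ennreal_ofReal)]
  refine Eventually.of_forall fun w hw => ?_
  have : w ∈ Function.support (φ.normed volume) := by
    intro h
    exact hw (by simp [h])
  rw [φ.support_normed_eq] at this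
  simpa using this

theorem integrable_bumpMeasure_iff (φ : ContDiffBump (0 : E)) (f : E → F) :
    Integrable f (bumpMeasure φ) ↔ Integrable fun w => φ.normed volume w • f w := by
  rw [bumpMeasure, integrable_withDensity_iff_integrable_smul'
    (φ.continuous_normed.measurable.ennreal_ofReal) (by simp)]
  simp [ENNReal.toReal_ofReal, φ.nonneg_normed]

theorem LocallyIntegrable.integrable_bumpMeasure (φ : ContDiffBump (0 : E)) {u : E → F}
    (hu : LocallyIntegrable u) (x : E) : Integrable (fun w => u (x - w)) (bumpMeasure φ) := by
  rw [integrable_bumpMeasure_iff]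
  exact φ.hasCompactSupport_normed.convolutionExists_left (ContinuousLinearMap.lsmul ℝ ℝ)
    φ.continuous_normed hu x

theorem contDiff_mollify (φ : ContDiffBump (0 : E)) {u : E → F} [CompleteSpace F]
    (hu : LocallyIntegrable u) : ContDiff ℝ ∞ (mollify φ u) :=
  φ.hasCompactSupport_normed.contDiff_convolution_left (n := ⊤) (ContinuousLinearMap.lsmul ℝ ℝ)
    φ.contDiff_normed hu

/-- The derivative falls on the bump. For fixed `x` the function `y ↦ φ(x - y)` is the test function
through which a weak gradient of `u` will enter. -/
theorem fderiv_mollify (φ : ContDiffBump (0 : E)) {u : E → ℝ}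
    (hu : LocallyIntegrable u) (x h : E) :
    fderiv ℝ (mollify φ u) x h = ∫ y, u y * fderiv ℝ (φ.normed volume) (x - y) h := by
  have hd := (φ.hasCompactSupport_normed (μ := volume)).hasFDerivAt_convolution_left
    (ContinuousLinearMap.lsmul ℝ ℝ) (φ.contDiff_normed (n := 1)) hu x
  rw [mollify_eq_convolution, hd.fderiv, convolution_def, ContinuousLinearMap.integral_apply]
  · rw [← integral_sub_left_eq_self _ _ x]
    refine integral_congr_ae (Eventually.of_forall fun y => ?_)
    simp [mul_comm]
  · exact ((φ.hasCompactSupport_normed (μ := volume)).fderiv ℝ).convolutionExists_left _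
      ((φ.contDiff_normed (n := 1)).continuous_fderiv one_ne_zero) hu x

theorem ae_tendsto_mollify [CompleteSpace F] {φ : ℕ → ContDiffBump (0 : E)}
    (hφ : Tendsto (fun i => (φ i).rOut) atTop (𝓝 0)) (hφ' : ∀ i, (φ i).rOut ≤ 2 * (φ i).rIn)
    {u : E → F} (hu : LocallyIntegrable u) :
    ∀ᵐ x, Tendsto (fun i => mollify (φ i) u x) atTop (𝓝 (u x)) :=
  ContDiffBump.ae_convolution_tendsto_right_of_locallyIntegrable hφ
    (Eventually.of_forall hφ') hu

theorem enorm_mollify_sub_rpow_le (φ : ContDiffBump (0 : E)) {u : E → ℝ} {p : ℝ} (hp : 1 ≤ p)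
    (hu : LocallyIntegrable u) (x y : E) :
    ‖mollify φ u x - mollify φ u y‖ₑ ^ p ≤
      ∫⁻ w, ‖u (x - w) - u (y - w)‖ₑ ^ p ∂(bumpMeasure φ) := by
  have hx := LocallyIntegrable.integrable_bumpMeasure φ hu x
  have hy := LocallyIntegrable.integrable_bumpMeasure φ hu y
  rw [mollify_eq_integral, mollify_eq_integral, ← integral_sub hx hy]
  exact enorm_integral_rpow_le hp (hx.sub hy).aestronglyMeasurable

/-- The energy is convex and translation invariant, so averaging translates cannot increase it. The
only loss is in the domain: `x - w` and `x + h - w` must lie in `Ω`, and they are within `r + r` of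
`x`, one `r` for the bump and one for the increment. -/
theorem lintegral_mollify_le_energy (φ : ContDiffBump (0 : E)) {u : E → ℝ} {p : ℝ} (hp : 1 ≤ p)
    (hu : LocallyIntegrable u) (hum : Measurable u) {k : ℝ → ℝ≥0∞} (hk : Measurable k)
    {K Ω : Set E} (hΩ : MeasurableSet Ω) {r δ : ℝ} (hφ : φ.rOut ≤ r)
    (hδ : δ ≤ r) (hK : ∀ x ∈ K, Metric.ball x (r + r) ⊆ Ω) (hKm : MeasurableSet K) :
    ∫⁻ x in K, ∫⁻ h in Metric.ball (0 : E) δ,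
      k ‖h‖ * ‖mollify φ u (x + h) - mollify φ u x‖ₑ ^ p ≤ energy p k Ω Ω u := by
  calc ∫⁻ x in K, ∫⁻ h in Metric.ball (0 : E) δ,
        k ‖h‖ * ‖mollify φ u (x + h) - mollify φ u x‖ₑ ^ p
      ≤ ∫⁻ x in K, ∫⁻ h in Metric.ball (0 : E) δ, ∫⁻ w,
          k ‖h‖ * ‖u (x + h - w) - u (x - w)‖ₑ ^ p ∂(bumpMeasure φ) := by
        refine lintegral_mono fun x => lintegral_mono fun h => ?_
        rw [lintegral_const_mul _ (by fun_prop)]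
        gcongr
        exact enorm_mollify_sub_rpow_le φ hp hu _ _
    _ = ∫⁻ w, (∫⁻ x in K, ∫⁻ h in Metric.ball (0 : E) δ,
          k ‖h‖ * ‖u (x + h - w) - u (x - w)‖ₑ ^ p) ∂(bumpMeasure φ) := by
        have hm : Measurable fun z : (E × E) × E =>
            k ‖z.2‖ * ‖u (z.1.1 + z.2 - z.1.2) - u (z.1.1 - z.1.2)‖ₑ ^ p := by fun_prop
        exact (lintegral_congr fun x => lintegral_lintegral_swap (by fun_prop)).trans
          (lintegral_lintegral_swap hm.lintegral_prod_right'.aemeasurable)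
    _ ≤ ∫⁻ w, energy p k Ω Ω u ∂(bumpMeasure φ) := by
        refine lintegral_mono_ae ?_
        filter_upwards [ae_bumpMeasure φ] with w hw
        -- For a fixed shift `w`, the outer integral is translated by `w`; the inner one is
        -- recentred at `x - w` below.
        have e1 : energy p k Ω Ω u =
            ∫⁻ x, Ω.indicator (fun x => ∫⁻ y in Ω, k ‖x - y‖ * ‖u x - u y‖ₑ ^ p) (x - w) := by
          rw [lintegral_sub_right_eq_self, lintegral_indicator hΩ, energy]
        rw [e1, ← lintegral_indicator hKm]
        refine lintegral_mono fun x => ?_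
        by_cases hx : x ∈ K
        · have hxw : x - w ∈ Ω := hK x hx (by simp; linarith [norm_nonneg w])
          rw [indicator_of_mem hx, indicator_of_mem hxw, ← lintegral_indicator hΩ,
            ← lintegral_indicator Metric.isOpen_ball.measurableSet,
            ← lintegral_add_left_eq_self (fun a => Ω.indicator _ a) (x - w)]
          refine lintegral_mono fun h => ?_
          by_cases hh : h ∈ Metric.ball (0 : E) δ
          · have hxh : x - w + h ∈ Ω := by
              refine hK x hx ?_
              have h1 : ‖h‖ < δ := by simpa using hh
              rw [mem_ball_iff_norm, show x - w + h - x = h - w by abel]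
              linarith [norm_sub_le h w]
            rw [indicator_of_mem hh, indicator_of_mem hxh, ← enorm_neg (u (x + h - w) - u (x - w))]
            simp [show x - w + h = x + h - w by abel]
          · simp [indicator_of_notMem hh]
        · simp [indicator_of_notMem hx]
    _ = _ := by simp

variable [Nontrivial E] {p : ℝ} {k : ℕ → ℝ → ℝ≥0∞} {c : ℝ≥0∞}

/-- The lower bound for the energies in terms of mollifications. -/
theorem ConcentratingKernel.lintegral_gradient_mollify_le
    (hk : ConcentratingKernel (Module.finrank ℝ E - 1) p k c) (hp : 1 ≤ p)
    (φ : ContDiffBump (0 : E)) {u : E → ℝ} (hu : LocallyIntegrable u) (hum : Measurable u)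
    {K Ω : Set E} (hΩ : MeasurableSet Ω) {r : ℝ} (hφ : φ.rOut ≤ r)
    (hK : ∀ x ∈ K, Metric.ball x (r + r) ⊆ Ω) (hKm : MeasurableSet K) {e : E} (he : ‖e‖ = 1) :
    c * sphereMoment p e * ∫⁻ x in K, ‖gradient (mollify φ u) x‖ₑ ^ p ≤
      liminf (fun n => energy p (k n) Ω Ω u) atTop := by
  have hp0 : 0 < p := by linarith
  have hr : 0 < r := φ.rOut_pos.trans_le hφ
  have hsm := contDiff_mollify φ hu
  have hcont : Continuous (mollify φ u) := hsm.continuous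
  have hgrad : Continuous (gradient (mollify φ u)) :=
    (InnerProductSpace.toDual ℝ E).symm.continuous.comp (hsm.continuous_fderiv (by simp))
  have hd (x : E) : HasFDerivAt (mollify φ u) (innerSL ℝ (gradient (mollify φ u) x)) x :=
    ((hsm.differentiable (by simp)) x).hasGradientAt.hasFDerivAt
  calc c * sphereMoment p e * ∫⁻ x in K, ‖gradient (mollify φ u) x‖ₑ ^ p
      = ∫⁻ x in K, c * sphereMoment p (gradient (mollify φ u) x) := by
        rw [← lintegral_const_mul _ (hgrad.measurable.enorm.pow_const p)]
        refine lintegral_congr fun x => ?_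
        rw [sphereMoment_eq hp0 he (gradient (mollify φ u) x)]
        ring
    _ ≤ ∫⁻ x in K, liminf (fun n => ∫⁻ h in Metric.ball (0 : E) r,
          k n ‖h‖ * ‖mollify φ u (x + h) - mollify φ u x‖ₑ ^ p) atTop :=
        lintegral_mono fun x => hk.le_liminf_of_hasFDerivAt hp0 (hd x) hr
    _ ≤ liminf (fun n => ∫⁻ x in K, ∫⁻ h in Metric.ball (0 : E) r,
          k n ‖h‖ * ‖mollify φ u (x + h) - mollify φ u x‖ₑ ^ p) atTop := by
        refine lintegral_liminf_le fun n => ?_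
        have hkn := hk.measurable n
        have hcm := hcont.measurable
        have : Measurable fun z : E × E =>
            k n ‖z.2‖ * ‖mollify φ u (z.1 + z.2) - mollify φ u z.1‖ₑ ^ p := by fun_prop
        exact this.lintegral_prod_right'
    _ ≤ _ := liminf_le_liminf (Eventually.of_forall fun n =>
        lintegral_mollify_le_energy φ hp hu hum (hk.measurable n) hΩ hφ le_rfl hK hKm)

end Mollify

/-! ### Pairing mollifications with continuous compactly supported functions. -/

section MollifyDuality

variable {E : Type*} [NormedAddCommGroup E] [InnerProductSpace ℝ E] [FiniteDimensional ℝ E]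
  [MeasurableSpace E] [BorelSpace E]

/-- A sequence of bump functions shrinking to the origin. -/
noncomputable def bumpSeq (E : Type*) [NormedAddCommGroup E] (i : ℕ) : ContDiffBump (0 : E) where
  rIn := 1 / ((i : ℝ) + 1) / 2
  rOut := 1 / ((i : ℝ) + 1)
  rIn_pos := by positivity
  rIn_lt_rOut := half_lt_self (by positivity)

theorem tendsto_bumpSeq_rOut : Tendsto (fun i => (bumpSeq E i).rOut) atTop (𝓝 0) :=
  tendsto_one_div_add_atTop_nhds_zero_nat

theorem ae_tendsto_mollify_bumpSeq {F : Type*} [NormedAddCommGroup F] [NormedSpace ℝ F]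
    [CompleteSpace F] {u : E → F} (hu : LocallyIntegrable u) :
    ∀ᵐ x, Tendsto (fun i => mollify (bumpSeq E i) u x) atTop (𝓝 (u x)) :=
  ae_tendsto_mollify tendsto_bumpSeq_rOut (fun i => by simp [bumpSeq]; field_simp; rfl) hu

theorem integral_mollify_mul_of_integrable (φ : ContDiffBump (0 : E)) {u D : E → ℝ}
    (hu : Integrable u) (hD : Continuous D) (hDc : HasCompactSupport D) :
    ∫ x, mollify φ u x * D x = ∫ w, ∫ y, u y * D (y + w) ∂volume ∂(bumpMeasure φ) := by
  have hint : Integrable (fun z : E × E => φ.normed volume z.2 * u (z.1 - z.2) * D z.1)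
      (volume.prod volume) := by
    have h1 := Integrable.convolution_integrand (ContinuousLinearMap.lsmul ℝ ℝ)
      (φ.integrable_normed (μ := (volume : Measure E))) hu
    obtain ⟨C, hC⟩ := hDc.exists_bound_of_continuous hD
    refine h1.mul_bdd (c := C) (by fun_prop) (Eventually.of_forall fun z => hC z.1)
  calc ∫ x, mollify φ u x * D x
      = ∫ x, ∫ w, φ.normed volume w * u (x - w) * D x := by
        refine integral_congr_ae (Eventually.of_forall fun x => ?_)
        simp only [mollify, smul_eq_mul]
        rw [integral_mul_const]
    _ = ∫ w, ∫ x, φ.normed volume w * u (x - w) * D x := integral_integral_swap hint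
    _ = ∫ w, φ.normed volume w • ∫ y, u y * D (y + w) := by
        refine integral_congr_ae (Eventually.of_forall fun w => ?_)
        simp only [smul_eq_mul]
        rw [← integral_const_mul,
          ← integral_sub_right_eq_self (fun y => φ.normed volume w * (u y * D (y + w))) w]
        refine integral_congr_ae (Eventually.of_forall fun x => ?_)
        simp [mul_assoc]
    _ = _ := (integral_bumpMeasure φ _).symm

/-- Only the values of `u` within `φ.rOut` of the support of `D` contribute, so `u` may be cut off
to a ball and the integrable case applies. -/
theorem integral_mollify_mul (φ : ContDiffBump (0 : E)) {u D : E → ℝ}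
    (hu : LocallyIntegrable u) (hD : Continuous D) (hDc : HasCompactSupport D) :
    ∫ x, mollify φ u x * D x = ∫ w, ∫ y, u y * D (y + w) ∂volume ∂(bumpMeasure φ) := by
  obtain ⟨R, hR⟩ := hDc.isCompact.isBounded.subset_closedBall (0 : E)
  set B := Metric.closedBall (0 : E) (R + φ.rOut)
  have hB : Integrable (B.indicator u) := by
    rw [integrable_indicator_iff Metric.isClosed_closedBall.measurableSet]
    exact hu.integrableOn_isCompact (isCompact_closedBall _ _)
  have hmem (x w : E) (hx : D x ≠ 0) (hw : ‖w‖ < φ.rOut) : x - w ∈ B := by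
    have h1 : ‖x‖ ≤ R := by simpa using hR (subset_tsupport D hx)
    simp only [B, mem_closedBall_zero_iff]
    linarith [norm_sub_le x w]
  have h := integral_mollify_mul_of_integrable φ hB hD hDc
  calc ∫ x, mollify φ u x * D x = ∫ x, mollify φ (B.indicator u) x * D x := by
        refine integral_congr_ae (Eventually.of_forall fun x => ?_)
        by_cases hx : D x = 0
        · simp [hx]
        · simp only [mollify_eq_integral]
          congr 1
          refine integral_congr_ae ?_
          filter_upwards [ae_bumpMeasure φ] with w hw
          rw [indicator_of_mem (hmem x w hx hw)]
    _ = _ := h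
    _ = _ := by
        refine integral_congr_ae ?_
        filter_upwards [ae_bumpMeasure φ] with w hw
        refine integral_congr_ae (Eventually.of_forall fun y => ?_)
        by_cases hy : D (y + w) = 0
        · simp [hy]
        · have := hmem _ w hy hw
          rw [add_sub_cancel_right] at this
          simp only [indicator_of_mem this]

/-- The mollification is moved onto the pairing: the left side is the mollification at `0` of `w ↦ ∫
u(y) D(y - w) dy`, which is continuous because it is a convolution with a continuous compactly
supported function. -/
theorem tendsto_integral_mollify_mul {u D : E → ℝ}
    (hu : LocallyIntegrable u) (hD : Continuous D) (hDc : HasCompactSupport D) :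
    Tendsto (fun i => ∫ x, mollify (bumpSeq E i) u x * D x) atTop (𝓝 (∫ x, u x * D x)) := by
  have hcont : Continuous (fun w : E => ∫ y, u y * D (y - w)) := by
    have hD' : HasCompactSupport fun x => D (-x) := hDc.comp_homeomorph (Homeomorph.neg E)
    have h1 := hD'.continuous_convolution_right (ContinuousLinearMap.lsmul ℝ ℝ) hu
      (hD.comp continuous_neg)
    refine h1.congr fun w => ?_
    simp [convolution]
  have h := ContDiffBump.convolution_tendsto_right_of_continuous (μ := (volume : Measure E))
    (tendsto_bumpSeq_rOut (E := E)) hcont 0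
  simp only [sub_zero] at h
  refine h.congr fun i => ?_
  rw [integral_mollify_mul _ hu hD hDc, integral_bumpMeasure]
  simp [convolution]

end MollifyDuality

/-! ### Integration by parts, and the lower bound by the variation. -/

section Euclidean

variable {d : ℕ}

local notation "Eu" => EuclideanSpace ℝ (Fin d)

theorem gradient_apply (f : Eu → ℝ) (x : Eu) (i : Fin d) :
    (gradient f x) i = fderiv ℝ f x (EuclideanSpace.single i 1) := by
  rw [← toDual_gradient, InnerProductSpace.toDual_apply_apply,
    EuclideanSpace.inner_single_right]
  simp

theorem IsTestFunction.apply {Ω : Set Eu} {ψ : Eu → Eu} (hψ : IsTestFunction Ω ψ) (i : Fin d) :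
    IsTestFunction Ω fun x => ψ x i := by
  have h : tsupport (fun x => ψ x i) ⊆ tsupport ψ := by
    refine closure_mono fun x hx => ?_
    intro h0
    exact hx (by simp [h0])
  refine ⟨?_, hψ.2.1.mono' (subset_closure.trans h), h.trans hψ.2.2⟩
  exact (EuclideanSpace.proj (𝕜 := ℝ) i).contDiff.comp hψ.1

theorem divergence_eq_sum {ψ : Eu → Eu} (hψ : ContDiff ℝ ∞ ψ) (x : Eu) :
    divergence ψ x = ∑ i, fderiv ℝ (fun y => ψ y i) x (EuclideanSpace.single i 1) := by
  refine Finset.sum_congr rfl fun i _ => ?_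
  have h := ((EuclideanSpace.proj i : Eu →L[ℝ] ℝ).hasFDerivAt.comp x
    ((hψ.differentiable (by simp)) x).hasFDerivAt).fderiv
  have h2 : fderiv ℝ (fun y => ψ y i) x = _ := h
  rw [h2]
  rfl

theorem integral_mul_fderiv_eq_neg {Ω : Set Eu} {f g : Eu → ℝ} (hf : ContDiff ℝ ∞ f)
    (hg : IsTestFunction Ω g) (v : Eu) :
    ∫ x, f x * fderiv ℝ g x v = -∫ x, fderiv ℝ f x v * g x := by
  have hgf : Continuous fun x => fderiv ℝ g x v :=
    (hg.1.continuous_fderiv (by simp)).clm_apply continuous_const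
  have hff : Continuous fun x => fderiv ℝ f x v :=
    (hf.continuous_fderiv (by simp)).clm_apply continuous_const
  have hgs : HasCompactSupport fun x => fderiv ℝ g x v :=
    (hg.2.1.fderiv ℝ).comp_left (g := fun L : Eu →L[ℝ] ℝ => L v) (by simp)
  refine integral_mul_fderiv_eq_neg_fderiv_mul_of_integrable ?_ ?_ ?_
    (fun x _ => hf.differentiable (by simp) x) (fun x _ => hg.1.differentiable (by simp) x)
  · exact (hff.mul hg.1.continuous).integrable_of_hasCompactSupport hg.2.1.mul_left
  · exact (hf.continuous.mul hgf).integrable_of_hasCompactSupport hgs.mul_left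
  · exact (hf.continuous.mul hg.1.continuous).integrable_of_hasCompactSupport hg.2.1.mul_left

theorem IsTestFunction.continuous_divergence {Ω : Set Eu} {ψ : Eu → Eu}
    (h : IsTestFunction Ω ψ) : Continuous (divergence ψ) :=
  continuous_finsetSum _ fun i _ =>
    (EuclideanSpace.proj (𝕜 := ℝ) i).continuous.comp (h.continuous_partialDeriv i)

theorem support_divergence {ψ : Eu → Eu} : Function.support (divergence ψ) ⊆ tsupport ψ := by
  intro x hx
  by_contra h0
  refine hx (Finset.sum_eq_zero fun i _ => ?_)
  have : partialDeriv i ψ x = 0 := by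
    by_contra h2
    exact h0 (support_partialDeriv i h2)
  simp [this]

theorem IsTestFunction.hasCompactSupport_divergence {Ω : Set Eu} {ψ : Eu → Eu}
    (h : IsTestFunction Ω ψ) : HasCompactSupport (divergence ψ) :=
  h.2.1.mono' support_divergence

theorem setIntegral_mul_of_support_subset {X : Type*} [MeasurableSpace X] {μ : Measure X}
    {Ω : Set X} (u : X → ℝ) {D : X → ℝ}
    (h : Function.support D ⊆ Ω) : ∫ x in Ω, u x * D x ∂μ = ∫ x, u x * D x ∂μ :=
  setIntegral_eq_integral_of_forall_compl_eq_zero fun x hx => by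
    have : D x = 0 := by
      by_contra h0
      exact hx (h h0)
    simp [this]

theorem integral_mul_divergence_eq_neg {Ω : Set Eu} {f : Eu → ℝ} {ψ : Eu → Eu}
    (hf : ContDiff ℝ ∞ f) (hψ : IsTestFunction Ω ψ) :
    ∫ x, f x * divergence ψ x = -∫ x, inner ℝ (gradient f x) (ψ x) := by
  have hgf (i : Fin d) : Continuous fun x => fderiv ℝ (fun y => ψ y i) x
      (EuclideanSpace.single i 1) :=
    ((hψ.apply i).1.continuous_fderiv (by simp)).clm_apply continuous_const
  have hff (i : Fin d) : Continuous fun x => fderiv ℝ f x (EuclideanSpace.single i 1) :=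
    (hf.continuous_fderiv (by simp)).clm_apply continuous_const
  have hgs (i : Fin d) : HasCompactSupport fun x => fderiv ℝ (fun y => ψ y i) x
      (EuclideanSpace.single i 1) :=
    ((hψ.apply i).2.1.fderiv ℝ).comp_left (g := fun L : Eu →L[ℝ] ℝ => L _) (by simp)
  have e1 : (fun x => f x * divergence ψ x) = fun x => ∑ i, f x *
      fderiv ℝ (fun y => ψ y i) x (EuclideanSpace.single i 1) := by
    funext x
    rw [divergence_eq_sum hψ.1, Finset.mul_sum]
  have e2 : (fun x => inner ℝ (gradient f x) (ψ x)) = fun x => ∑ i,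
      fderiv ℝ f x (EuclideanSpace.single i 1) * ψ x i := by
    funext x
    rw [PiLp.inner_apply]
    refine Finset.sum_congr rfl fun i _ => ?_
    rw [gradient_apply]
    simp [mul_comm]
  rw [e1, e2, integral_finsetSum, integral_finsetSum, ← Finset.sum_neg_distrib]
  · exact Finset.sum_congr rfl fun i _ => integral_mul_fderiv_eq_neg hf (hψ.apply i) _
  · exact fun i _ => ((hff i).mul (hψ.apply i).1.continuous).integrable_of_hasCompactSupport
      (hψ.apply i).2.1.mul_left
  · exact fun i _ => (hf.continuous.mul (hgf i)).integrable_of_hasCompactSupport (hgs i).mul_left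

theorem continuous_gradient {f : Eu → ℝ} (hf : ContDiff ℝ ∞ f) : Continuous (gradient f) :=
  (InnerProductSpace.toDual ℝ Eu).symm.continuous.comp (hf.continuous_fderiv (by simp))

variable {p : ℝ} {k : ℕ → ℝ → ℝ≥0∞} {c : ℝ≥0∞}

theorem finrank_ne_zero_nontrivial (hd : 1 ≤ d) : Nontrivial Eu :=
  Module.nontrivial_of_finrank_pos (R := ℝ) (by simpa using Nat.pos_of_ne_zero (by omega))

/-- The lower bound by the variation when `p = 1`. -/
theorem ConcentratingKernel.variation_le_liminf_energy (hd : 1 ≤ d)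
    (hk : ConcentratingKernel (d - 1) 1 k c) {u : Eu → ℝ} (hu : LocallyIntegrable u)
    (hum : Measurable u) {Ω : Set Eu} (hΩ : IsOpen Ω) {e : Eu} (he : ‖e‖ = 1) :
    c * sphereMoment 1 e * variation Ω u ≤
      liminf (fun n => energy 1 (k n) Ω Ω u) atTop := by
  have := finrank_ne_zero_nontrivial hd
  have hk' : ConcentratingKernel (Module.finrank ℝ Eu - 1) 1 k c := by simpa using hk
  simp only [variation, ENNReal.mul_iSup]
  refine iSup₂_le fun ψ hψ => ?_
  -- The support of `ψ` keeps a distance `δ` from the complement of `Ω`; half of it is spent on the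
  -- bump and half on the increment.
  obtain ⟨δ, hδ, hδΩ⟩ := IsCompact.exists_thickening_subset_open hψ.1.2.1 hΩ hψ.1.2.2
  have hlim := tendsto_integral_mollify_mul hu hψ.1.continuous_divergence
    hψ.1.hasCompactSupport_divergence
  rw [setIntegral_mul_of_support_subset u (support_divergence.trans hψ.1.2.2)]
  have hlim2 : Tendsto (fun i => c * sphereMoment 1 e * ENNReal.ofReal
      (∫ x, mollify (bumpSeq Eu i) u x * divergence ψ x)) atTop
      (𝓝 (c * sphereMoment 1 e * ENNReal.ofReal (∫ x, u x * divergence ψ x))) :=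
    ENNReal.Tendsto.const_mul (ENNReal.tendsto_ofReal hlim) (Or.inr
      (ENNReal.mul_ne_top hk.ne_top (sphereMoment_lt_top zero_le_one e).ne))
  -- It suffices to bound the pairing with each fine mollification. After integration by parts it is
  -- at most the integral of the mollified gradient over the support of `ψ`, because `|ψ| ≤ 1`.
  refine le_of_tendsto hlim2 ?_
  have hsmall := (tendsto_bumpSeq_rOut (E := Eu)).eventually (gt_mem_nhds (half_pos hδ))
  filter_upwards [hsmall] with i hi
  refine le_trans ?_ (hk'.lintegral_gradient_mollify_le le_rfl (bumpSeq Eu i) hu hum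
    hΩ.measurableSet hi.le (K := tsupport ψ) (fun x hx => ?_)
    (isClosed_tsupport ψ).measurableSet he)
  · gcongr
    rw [integral_mul_divergence_eq_neg (contDiff_mollify _ hu) hψ.1, ← integral_neg]
    refine (ENNReal.ofReal_le_ofReal (le_abs_self _)).trans ?_
    rw [← Real.norm_eq_abs, ofReal_norm]
    refine (enorm_integral_le_lintegral_enorm _).trans ?_
    rw [← lintegral_indicator (isClosed_tsupport ψ).measurableSet]
    refine lintegral_mono fun x => ?_
    by_cases hx : x ∈ tsupport ψ
    · rw [indicator_of_mem hx, ENNReal.rpow_one, enorm_neg]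
      refine enorm_le_iff_norm_le.2 ((norm_inner_le_norm _ _).trans ?_)
      exact mul_le_of_le_one_right (norm_nonneg _) (hψ.2 x)
    · simp [image_eq_zero_of_notMem_tsupport hx]
  · rw [add_halves]
    exact (Metric.ball_subset_thickening hx δ).trans hδΩ

end Euclidean

/-! ### Mollified weak gradients, and the lower bound by the weak gradient. -/

section SobolevLower

variable {d : ℕ}

local notation "Eu" => EuclideanSpace ℝ (Fin d)

theorem isTestFunction_bump_comp_sub {Ω : Set Eu} (φ : ContDiffBump (0 : Eu)) {x : Eu}
    (hx : Metric.closedBall x φ.rOut ⊆ Ω) :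
    IsTestFunction Ω fun y => φ.normed volume (x - y) := by
  have hs : Function.support (fun y => φ.normed volume (x - y)) ⊆ Metric.closedBall x φ.rOut := by
    intro y hy
    have : x - y ∈ Function.support (φ.normed volume) := hy
    rw [φ.support_normed_eq, mem_ball_zero_iff] at this
    rw [Metric.mem_closedBall, dist_comm, dist_eq_norm]
    exact this.le
  refine ⟨φ.contDiff_normed.comp (contDiff_const.sub contDiff_id),
    HasCompactSupport.of_support_subset_isCompact (isCompact_closedBall _ _) hs,
    (closure_minimal hs Metric.isClosed_closedBall).trans hx⟩

theorem partialDeriv_bump_comp_sub (φ : ContDiffBump (0 : Eu)) (x y : Eu) (i : Fin d) :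
    partialDeriv i (fun y => φ.normed volume (x - y)) y =
      -fderiv ℝ (φ.normed volume) (x - y) (EuclideanSpace.single i 1) := by
  have h1 : HasFDerivAt (φ.normed volume) (fderiv ℝ (φ.normed volume) (x - y)) (x - y) :=
    ((φ.contDiff_normed (n := 1) (μ := volume)).differentiable (by simp) _).hasFDerivAt
  have h2 := h1.comp y ((hasFDerivAt_id y).const_sub x)
  rw [partialDeriv, show (fun y => φ.normed volume (x - y)) =
    (φ.normed volume) ∘ (HSub.hSub x) from rfl, h2.fderiv]
  simp

/-- A weak gradient on `Ω` is arbitrary outside `Ω`. Allowing any `g'` that agrees with `g` on the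
ball seen by the bump makes it possible to mollify a truncation of `g`. -/
theorem integrable_bump_smul {Ω : Set Eu} {g g' : Eu → Eu} (hg : LocallyIntegrableOn g Ω)
    {φ : ContDiffBump (0 : Eu)} {x : Eu} (hx : Metric.closedBall x φ.rOut ⊆ Ω)
    (hg' : ∀ y ∈ Metric.closedBall x φ.rOut, g' y = g y) :
    Integrable fun w => φ.normed volume w • g' (x - w) := by
  have ht := isTestFunction_bump_comp_sub φ le_rfl (x := x)
  have h1 : IntegrableOn (fun y => φ.normed volume (x - y) • g' y)
      (Metric.closedBall x φ.rOut) := by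
    refine IntegrableOn.continuousOn_smul ?_ ht.1.continuous.continuousOn (isCompact_closedBall _ _)
    exact (hg.integrableOn_compact_subset hx (isCompact_closedBall _ _)).congr_fun
      (fun y hy => (hg' y hy).symm) Metric.isClosed_closedBall.measurableSet
  have h2 : Integrable fun y => φ.normed volume (x - y) • g' y := by
    refine (integrableOn_iff_integrable_of_support_subset fun y hy => ?_).1 h1
    exact ht.2.2 (subset_tsupport _ fun h0 => hy (by simp only [h0, zero_smul]))
  simpa using h2.comp_sub_left x

/-- The gradient of a mollification is the mollification of the weak gradient. -/
theorem HasWeakGradient.gradient_mollify {Ω : Set Eu} {u : Eu → ℝ} {g g' : Eu → Eu}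
    (h : HasWeakGradient Ω u g) (hu : LocallyIntegrable u) {φ : ContDiffBump (0 : Eu)} {x : Eu}
    (hx : Metric.closedBall x φ.rOut ⊆ Ω)
    (hg' : ∀ y ∈ Metric.closedBall x φ.rOut, g' y = g y) :
    gradient (mollify φ u) x = mollify φ g' x := by
  have ht := isTestFunction_bump_comp_sub φ le_rfl (x := x)
  have hts := ht.2.2
  set ψ : Eu → ℝ := fun y => φ.normed volume (x - y) with hψ
  have htΩ : IsTestFunction Ω ψ := isTestFunction_bump_comp_sub φ hx
  ext i
  have e1 : (mollify φ g' x) i = ∫ y, g' y i * ψ y := by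
    have := (EuclideanSpace.proj i : Eu →L[ℝ] ℝ).integral_comp_comm
      (integrable_bump_smul h.2.1 hx hg')
    change (EuclideanSpace.proj i : Eu →L[ℝ] ℝ) (∫ w, φ.normed volume w • g' (x - w)) = _
    rw [← this, ← integral_sub_left_eq_self _ _ x]
    refine integral_congr_ae (Eventually.of_forall fun y => ?_)
    simp [hψ, mul_comm]
  have e2 : ∫ y, g' y i * ψ y = ∫ y, g y i * ψ y := by
    refine integral_congr_ae (Eventually.of_forall fun y => ?_)
    by_cases hy : ψ y = 0
    · simp [hy]
    · simp only [hg' y (hts (subset_tsupport ψ hy))]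
  have hw := h.2.2 ψ htΩ i
  rw [setIntegral_mul_of_support_subset (fun y => g y i) ((subset_tsupport ψ).trans htΩ.2.2),
    setIntegral_mul_of_support_subset u ((support_partialDeriv i).trans htΩ.2.2)] at hw
  rw [gradient_apply, fderiv_mollify φ hu, e1, e2, ← neg_inj, ← hw, ← integral_neg]
  refine integral_congr_ae (Eventually.of_forall fun y => ?_)
  simp only [hψ, partialDeriv_bump_comp_sub, mul_neg]

theorem exists_monotone_compact_exhaustion {Ω : Set Eu} (hΩ : IsOpen Ω) :
    ∃ K : ℕ → Set Eu, (∀ n, IsCompact (K n)) ∧ Monotone K ∧ ⋃ n, K n = Ω ∧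
      ∀ S ⊆ Ω, IsCompact S → ∃ n, S ⊆ K n := by
  have : LocallyCompactSpace Ω := hΩ.locallyCompactSpace
  let C := CompactExhaustion.choice Ω
  refine ⟨fun n => Subtype.val '' C n, fun n => (C.isCompact n).image continuous_subtype_val,
    fun m n hmn => image_mono (C.subset hmn), ?_, fun S hS hSc => ?_⟩
  · rw [← image_iUnion, C.iUnion_eq, image_univ, Subtype.range_coe]
  · have h1 : IsCompact (Subtype.val ⁻¹' S : Set Ω) := by
      rw [Subtype.isCompact_iff, Subtype.image_preimage_coe, inter_eq_right.2 hS]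
      exact hSc
    obtain ⟨n, hn⟩ := C.exists_superset_of_isCompact h1
    refine ⟨n, fun x hx => ⟨⟨x, hS hx⟩, hn hx, rfl⟩⟩

variable {p : ℝ} {k : ℕ → ℝ → ℝ≥0∞} {c : ℝ≥0∞}

/-- On compact subsets, the gradients of fine mollifications are controlled by the energies. -/
theorem ConcentratingKernel.eventually_lintegral_gradient_mollify_le (hd : 1 ≤ d) (hp : 1 ≤ p)
    (hk : ConcentratingKernel (d - 1) p k c) {u : Eu → ℝ} (hu : LocallyIntegrable u)
    (hum : Measurable u) {Ω K : Set Eu} (hΩ : IsOpen Ω) (hK : IsCompact K) (hKΩ : K ⊆ Ω) {e : Eu}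
    (he : ‖e‖ = 1) :
    ∀ᶠ i in atTop, c * sphereMoment p e *
      ∫⁻ x in K, ‖gradient (mollify (bumpSeq Eu i) u) x‖ₑ ^ p ≤
        liminf (fun n => energy p (k n) Ω Ω u) atTop := by
  have := finrank_ne_zero_nontrivial hd
  have hk' : ConcentratingKernel (Module.finrank ℝ Eu - 1) p k c := by simpa using hk
  obtain ⟨δ, hδ, hδΩ⟩ := IsCompact.exists_thickening_subset_open hK hΩ hKΩ
  have hsmall := (tendsto_bumpSeq_rOut (E := Eu)).eventually (gt_mem_nhds (half_pos hδ))
  filter_upwards [hsmall] with i hi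
  refine hk'.lintegral_gradient_mollify_le hp (bumpSeq Eu i) hu hum
    hΩ.measurableSet hi.le (fun x hx => ?_) hK.measurableSet he
  rw [add_halves]
  exact (Metric.ball_subset_thickening hx δ).trans hδΩ

/-- The lower bound by the weak gradient. -/
theorem ConcentratingKernel.lintegral_weakGradient_le_liminf_energy (hd : 1 ≤ d) (hp : 1 ≤ p)
    (hk : ConcentratingKernel (d - 1) p k c) {u : Eu → ℝ} (hu : LocallyIntegrable u)
    (hum : Measurable u) {Ω : Set Eu} (hΩ : IsOpen Ω) {g : Eu → Eu} (hg : HasWeakGradient Ω u g)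
    {e : Eu} (he : ‖e‖ = 1) :
    c * sphereMoment p e * ∫⁻ x in Ω, ‖g x‖ₑ ^ p ≤
      liminf (fun n => energy p (k n) Ω Ω u) atTop := by
  have hp0 : 0 ≤ p := by linarith
  have hctop : c * sphereMoment p e ≠ ⊤ :=
    ENNReal.mul_ne_top hk.ne_top (sphereMoment_lt_top hp0 e).ne
  obtain ⟨K, hKc, hKm, hKU, -⟩ := exists_monotone_compact_exhaustion hΩ
  have hKΩ (n : ℕ) : K n ⊆ Ω := hKU ▸ subset_iUnion K n
  have key (n : ℕ) : c * sphereMoment p e * ∫⁻ x in K n, ‖g x‖ₑ ^ p ≤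
      liminf (fun n => energy p (k n) Ω Ω u) atTop := by
    obtain ⟨δ, hδ, hδΩ⟩ := (hKc n).exists_cthickening_subset_open hΩ (hKΩ n)
    -- This truncation is integrable on the whole space, so its mollifications converge almost
    -- everywhere; on `K n`, for small bumps, they are the gradients of the mollifications of `u`.
    set g' : Eu → Eu := (Metric.cthickening δ (K n)).indicator g with hg'
    have hKδ : IsCompact (Metric.cthickening δ (K n)) := (hKc n).cthickening
    have hg'i : LocallyIntegrable g' := by
      refine Integrable.locallyIntegrable ?_
      rw [integrable_indicator_iff hKδ.measurableSet]
      exact hg.2.1.integrableOn_compact_subset hδΩ hKδ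
    have hae := ae_tendsto_mollify_bumpSeq hg'i
    rw [← lintegral_const_mul' _ _ hctop]
    calc ∫⁻ x in K n, c * sphereMoment p e * ‖g x‖ₑ ^ p
        = ∫⁻ x in K n, liminf (fun i => c * sphereMoment p e *
            ‖mollify (bumpSeq Eu i) g' x‖ₑ ^ p) atTop := by
          refine lintegral_congr_ae ?_
          filter_upwards [ae_restrict_of_ae hae, ae_restrict_mem (hKc n).measurableSet] with x hx hxK
          have h1 : g' x = g x := indicator_of_mem (Metric.self_subset_cthickening _ hxK) g
          rw [← h1]
          refine (Tendsto.liminf_eq ?_).symm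
          exact ENNReal.Tendsto.const_mul ((ENNReal.continuous_rpow_const.tendsto _).comp
            hx.enorm) (Or.inr hctop)
      _ ≤ liminf (fun i => ∫⁻ x in K n, c * sphereMoment p e *
            ‖mollify (bumpSeq Eu i) g' x‖ₑ ^ p) atTop := by
          refine lintegral_liminf_le fun i => ?_
          exact ((contDiff_mollify _ hg'i).continuous.measurable.enorm.pow_const p).const_mul _
      _ ≤ liminf (fun _ : ℕ => liminf (fun n => energy p (k n) Ω Ω u) atTop) atTop := by
          refine liminf_le_liminf ?_
          have hsmall := (tendsto_bumpSeq_rOut (E := Eu)).eventually (gt_mem_nhds hδ)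
          filter_upwards [hsmall, hk.eventually_lintegral_gradient_mollify_le hd hp hu hum hΩ
            (hKc n) (hKΩ n) he] with i hi hi2
          rw [lintegral_const_mul' _ _ hctop]
          refine le_trans (le_of_eq ?_) hi2
          congr 1
          refine setLIntegral_congr_fun (hKc n).measurableSet fun x hx => ?_
          have hball : Metric.closedBall x (bumpSeq Eu i).rOut ⊆ Metric.cthickening δ (K n) :=
            (Metric.closedBall_subset_closedBall hi.le).trans
              (Metric.closedBall_subset_cthickening hx δ)
          rw [hg.gradient_mollify hu (hball.trans hδΩ)
            (fun y hy => indicator_of_mem (hball hy) g)]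
      _ = _ := liminf_const _
  have hmono : Monotone fun n => ∫⁻ x in K n, ‖g x‖ₑ ^ p :=
    fun m n hmn => lintegral_mono_set (hKm hmn)
  have hU : ∫⁻ x in Ω, ‖g x‖ₑ ^ p = ⨆ n, ∫⁻ x in K n, ‖g x‖ₑ ^ p := by
    rw [← hKU]
    exact setLIntegral_iUnion_of_directed _ hKm.directed_le
  rw [hU, ENNReal.mul_iSup]
  exact iSup_le key

end SobolevLower

/-! ### Weak compactness in `L^p` for `p > 1`, along an ultrafilter. -/

section WeakCompactness

/-- An interchange of limits: `a' j` approximates `a` from below with an error `ε j` uniform in the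
index. It serves both for countable additivity and for the passage to monotone limits of test
functions. -/
theorem tendsto_of_tendsto_of_le_add {ι : Type*} {l : Filter ι} [l.NeBot] {a : ι → ℝ≥0∞}
    {a' : ℕ → ι → ℝ≥0∞} {b ε : ℕ → ℝ≥0∞} {B : ℝ≥0∞}
    (ha' : ∀ j, Tendsto (a' j) l (𝓝 (b j))) (hb : Tendsto b atTop (𝓝 B))
    (hε : Tendsto ε atTop (𝓝 0)) (h1 : ∀ j n, a' j n ≤ a n) (h2 : ∀ j n, a n ≤ a' j n + ε j) :
    Tendsto a l (𝓝 B) := by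
  refine tendsto_of_le_liminf_of_limsup_le ?_ ?_
  · refine le_of_tendsto' hb fun j => ?_
    rw [← (ha' j).liminf_eq]
    exact liminf_le_liminf (Eventually.of_forall (h1 j))
  · have hbe : Tendsto (fun j => b j + ε j) atTop (𝓝 B) := by simpa using hb.add hε
    refine ge_of_tendsto' hbe fun j => ?_
    rw [← ((ha' j).add (tendsto_const_nhds (x := ε j))).limsup_eq]
    exact limsup_le_limsup (Eventually.of_forall (h2 j))

theorem Ultrafilter.exists_tendsto_ennreal (U : Ultrafilter ℕ) (a : ℕ → ℝ≥0∞) :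
    ∃ b, Tendsto a U (𝓝 b) := by
  obtain ⟨b, -, hb⟩ := isCompact_univ.ultrafilter_le_nhds (U.map a) (by simp)
  exact ⟨b, hb⟩

variable {α : Type*} [MeasurableSpace α] {μ : Measure α} [IsFiniteMeasure μ]

/-- Weak sequential compactness of bounded sets of nonnegative functions in `L^p`, `p > 1`, along
an ultrafilter. -/
theorem exists_weak_limit_ennreal (U : Ultrafilter ℕ) {p : ℝ} (hp : 1 < p) {f : ℕ → α → ℝ≥0∞}
    (hf : ∀ n, Measurable (f n)) {M : ℝ≥0∞} (hM : M ≠ ⊤) (hfM : ∀ n, ∫⁻ x, f n x ^ p ∂μ ≤ M) :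
    ∃ g : α → ℝ≥0∞, Measurable g ∧ ∫⁻ x, g x ∂μ ≠ ⊤ ∧ ∀ φ : α → ℝ≥0∞, Measurable φ →
      ∀ C : ℝ≥0, (∀ x, φ x ≤ C) →
        Tendsto (fun n => ∫⁻ x, φ x * f n x ∂μ) U (𝓝 (∫⁻ x, φ x * g x ∂μ)) := by
  obtain ⟨q, hpq⟩ : ∃ q, p.HolderConjugate q := ⟨_, Real.HolderConjugate.conjExponent hp⟩
  have hq0 : 0 < q := hpq.symm.pos
  have holder (φ : α → ℝ≥0∞) (hφ : Measurable φ) (n : ℕ) :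
      ∫⁻ x, φ x * f n x ∂μ ≤ (∫⁻ x, φ x ^ q ∂μ) ^ (1 / q) * M ^ (1 / p) := by
    refine (ENNReal.lintegral_mul_le_Lp_mul_Lq μ hpq.symm hφ.aemeasurable
      (hf n).aemeasurable).trans ?_
    gcongr
    exact hfM n
  have hMp : M ^ (1 / p) ≠ ⊤ := ENNReal.rpow_ne_top_of_nonneg (one_div_nonneg.2 hpq.nonneg) hM
  have hmul0 {ψ : ℕ → ℝ≥0∞} (h : Tendsto ψ atTop (𝓝 0)) :
      Tendsto (fun j => ψ j ^ (1 / q) * M ^ (1 / p)) atTop (𝓝 0) := by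
    have h1 := (ENNReal.continuous_rpow_const (y := 1 / q)).tendsto 0 |>.comp h
    rw [ENNReal.zero_rpow_of_pos (one_div_pos.2 hq0)] at h1
    simpa using ENNReal.Tendsto.mul_const h1 (Or.inr hMp)
  have hmul {a h : α → ℝ≥0∞} (ha : Measurable a) (hh : Measurable h) :
      Measurable fun x => a x * h x := ha.mul hh
  -- Since `[0, ∞]` is compact, the ultrafilter gives a limit for every set at once, with no
  -- extraction of subsequences. The limit `ℓ` will be a measure, and its density is the weak limit.
  choose ℓ hℓ using fun A : Set α =>
    Ultrafilter.exists_tendsto_ennreal U (fun n => ∫⁻ x in A, f n x ∂μ)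
  -- Uniform integrability from Hölder's inequality. It yields the countable additivity, finiteness
  -- and absolute continuity of the limit measure; `p > 1` enters through the positive power `1/q`
  -- of `μ A`.
  have hset (A : Set α) (hA : MeasurableSet A) (n : ℕ) :
      ∫⁻ x in A, f n x ∂μ ≤ μ A ^ (1 / q) * M ^ (1 / p) := by
    have h := holder (A.indicator 1) (measurable_one.indicator hA) n
    have e1 : ∫⁻ x, A.indicator 1 x * f n x ∂μ = ∫⁻ x in A, f n x ∂μ := by
      rw [← lintegral_indicator hA]
      exact lintegral_congr fun x => by by_cases hx : x ∈ A <;> simp [hx]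
    have e2 : ∫⁻ x, A.indicator (1 : α → ℝ≥0∞) x ^ q ∂μ = μ A := by
      rw [← lintegral_indicator_one hA]
      refine lintegral_congr fun x => ?_
      by_cases hx : x ∈ A <;> simp [hx, hq0]
    rwa [e1, e2] at h
  have hℓ0 : ℓ ∅ = 0 := by
    have := hℓ ∅
    simp only [Measure.restrict_empty, lintegral_zero_measure] at this
    exact tendsto_nhds_unique this tendsto_const_nhds
  -- Countable additivity survives the limit because the tails of a disjoint union are small
  -- uniformly in `n`.
  let ν : Measure α := Measure.ofMeasurable (fun A _ => ℓ A) hℓ0 (by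
    intro A hA hd
    refine tendsto_nhds_unique (hℓ _) ?_
    have hmU (j : ℕ) : MeasurableSet (⋃ i, A (i + j)) := .iUnion fun i => hA _
    refine tendsto_of_tendsto_of_le_add
      (a' := fun j n => ∑ i ∈ Finset.range j, ∫⁻ x in A i, f n x ∂μ)
      (ε := fun j => μ (⋃ i, A (i + j)) ^ (1 / q) * M ^ (1 / p))
      (fun j => tendsto_finsetSum _ fun i _ => hℓ (A i)) (ENNReal.tendsto_nat_tsum _)
      (hmul0 ?_) ?_ ?_
    · have hsum : ∑' i, μ (A i) ≠ ⊤ := by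
        rw [← measure_iUnion hd hA]
        exact measure_ne_top _ _
      refine tendsto_of_tendsto_of_tendsto_of_le_of_le tendsto_const_nhds
        (ENNReal.tendsto_sum_nat_add _ hsum) (fun j => zero_le) (fun j => ?_)
      exact measure_iUnion_le _
    · intro j n
      rw [lintegral_iUnion hA hd]
      exact ENNReal.sum_le_tsum _
    · intro j n
      have htail : ∑ i ∈ Finset.range j, ∫⁻ x in A i, f n x ∂μ +
          ∑' i, ∫⁻ x in A (i + j), f n x ∂μ = ∑' i, ∫⁻ x in A i, f n x ∂μ :=
        ENNReal.summable.sum_add_tsum_nat_add' (f := fun i => ∫⁻ x in A i, f n x ∂μ)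
      rw [lintegral_iUnion hA hd, ← htail]
      gcongr
      have hdj : Pairwise (Function.onFun Disjoint fun i => A (i + j)) :=
        hd.comp_of_injective (add_left_injective j)
      rw [← lintegral_iUnion (fun i => hA (i + j)) hdj]
      exact hset _ (hmU j) n)
  have hν (A : Set α) (hA : MeasurableSet A) : ν A = ℓ A := Measure.ofMeasurable_apply A hA
  have hνle (A : Set α) (hA : MeasurableSet A) : ν A ≤ μ A ^ (1 / q) * M ^ (1 / p) := by
    rw [hν A hA]
    exact le_of_tendsto' (hℓ A) (hset A hA)
  have hνfin : IsFiniteMeasure ν := ⟨(hνle univ .univ).trans_lt (ENNReal.mul_lt_top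
    (ENNReal.rpow_lt_top_of_nonneg (one_div_nonneg.2 hq0.le) (measure_ne_top _ _)) hMp.lt_top)⟩
  have hac : ν ≪ μ := by
    refine Measure.AbsolutelyContinuous.mk fun A hA h0 => ?_
    have := hνle A hA
    rw [h0, ENNReal.zero_rpow_of_pos (one_div_pos.2 hq0), zero_mul] at this
    exact nonpos_iff_eq_zero.1 this
  have hg : μ.withDensity (ν.rnDeriv μ) = ν := Measure.withDensity_rnDeriv_eq _ _ hac
  refine ⟨ν.rnDeriv μ, Measure.measurable_rnDeriv _ _, ?_, ?_⟩
  · rw [← setLIntegral_univ, ← withDensity_apply _ MeasurableSet.univ, hg]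
    exact measure_ne_top _ _
  · intro φ hφ
    -- From sets to bounded functions. At a monotone limit the remainder tends to `0` in `L^q` by
    -- dominated convergence, and Hölder makes the resulting error uniform in `n`.
    refine Measurable.ennreal_induction (motive := fun φ => ∀ C : ℝ≥0, (∀ x, φ x ≤ C) →
      Tendsto (fun n => ∫⁻ x, φ x * f n x ∂μ) U (𝓝 (∫⁻ x, φ x * ν.rnDeriv μ x ∂μ))) ?_ ?_ ?_ hφ
    · intro a A hA C hC
      have e (h : α → ℝ≥0∞) : ∫⁻ x, A.indicator (fun _ => a) x * h x ∂μ =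
          ∫⁻ x in A, a * h x ∂μ := by
        rw [← lintegral_indicator hA]
        exact lintegral_congr fun x => by by_cases hx : x ∈ A <;> simp [hx]
      simp only [e]
      rcases A.eq_empty_or_nonempty with rfl | ⟨x, hx⟩
      · simp
      · have ha : a ≠ ⊤ := by
          have := hC x
          rw [indicator_of_mem hx] at this
          exact (this.trans_lt ENNReal.coe_lt_top).ne
        simp only [lintegral_const_mul' _ _ ha]
        refine ENNReal.Tendsto.const_mul ?_ (Or.inr ha)
        rw [← withDensity_apply _ hA, hg, hν A hA]
        exact hℓ A
    · intro φ ψ _ hφ hψ h1 h2 C hC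
      have hCφ (x : α) : φ x ≤ C := le_self_add.trans (hC x)
      have hCψ (x : α) : ψ x ≤ C := le_add_self.trans (hC x)
      simp only [Pi.add_apply, add_mul]
      rw [lintegral_add_left (hmul hφ (Measure.measurable_rnDeriv _ _))]
      simp only [lintegral_add_left (hmul hφ (hf _))]
      exact (h1 C hCφ).add (h2 C hCψ)
    · intro φ hφ hmono ih C hC
      have hφC (j : ℕ) (x : α) : φ j x ≤ C := (le_iSup (fun j => φ j x) j).trans (by simpa using hC x)
      have hsup : Measurable fun x => ⨆ j, φ j x := Measurable.iSup hφ
      refine tendsto_of_tendsto_of_le_add (fun j => ih j C (hφC j)) ?_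
        (hmul0 (ψ := fun j => ∫⁻ x, ((⨆ j, φ j x) - φ j x) ^ q ∂μ) ?_) ?_ ?_
      · refine lintegral_tendsto_of_tendsto_of_monotone
          (fun j => ((hφ j).mul (Measure.measurable_rnDeriv _ _)).aemeasurable) ?_ ?_
        · exact Eventually.of_forall fun x i j hij => mul_le_mul_left (hmono hij x) _
        · filter_upwards [Measure.rnDeriv_lt_top ν μ] with x hx
          exact ENNReal.Tendsto.mul_const (tendsto_atTop_iSup fun i j hij => hmono hij x)
            (Or.inr hx.ne)
      · have hz : ∫⁻ _, (0 : ℝ≥0∞) ∂μ = 0 := by simp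
        rw [← hz]
        refine tendsto_lintegral_of_dominated_convergence (fun _ => (C : ℝ≥0∞) ^ q)
          (fun j => (hsup.sub (hφ j)).pow_const q) ?_ ?_ ?_
        · refine fun j => Eventually.of_forall fun x => ENNReal.rpow_le_rpow ?_ hq0.le
          exact tsub_le_self.trans (by simpa using hC x)
        · rw [lintegral_const]
          exact ENNReal.mul_ne_top (ENNReal.rpow_ne_top_of_nonneg hq0.le ENNReal.coe_ne_top)
            (measure_ne_top _ _)
        · refine Eventually.of_forall fun x => ?_
          have hxtop : (⨆ j, φ j x) ≠ ⊤ := by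
            have : (⨆ j, φ j x) ≤ C := by simpa using hC x
            exact (this.trans_lt ENNReal.coe_lt_top).ne
          have h1 : Tendsto (fun j => φ j x) atTop (𝓝 (⨆ j, φ j x)) :=
            tendsto_atTop_iSup fun i j hij => hmono hij x
          have h2 := ENNReal.Tendsto.sub (tendsto_const_nhds (x := ⨆ j, φ j x)) h1 (Or.inl hxtop)
          have h3 := (ENNReal.continuous_rpow_const (y := q)).tendsto _ |>.comp h2
          simpa [hq0, Function.comp_def] using h3
      · intro j n
        refine lintegral_mono fun x => mul_le_mul_left ?_ _
        exact le_iSup (fun j => φ j x) j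
      · intro j n
        refine le_trans ?_ (add_le_add_right (holder _ (hsup.sub (hφ j)) n) _)
        rw [← lintegral_add_left (hmul (hφ j) (hf n))]
        refine lintegral_mono fun x => ?_
        rw [← add_mul]
        refine mul_le_mul_left ?_ _
        exact le_add_tsub

/-- Weak sequential compactness of bounded sets in `L^p`, `p > 1`, along an ultrafilter. -/
theorem exists_weak_limit (U : Ultrafilter ℕ) {p : ℝ} (hp : 1 < p) {f : ℕ → α → ℝ}
    (hf : ∀ n, Measurable (f n)) {M : ℝ≥0∞} (hM : M ≠ ⊤)
    (hfM : ∀ n, ∫⁻ x, ‖f n x‖ₑ ^ p ∂μ ≤ M) :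
    ∃ g : α → ℝ, Measurable g ∧ Integrable g μ ∧ ∀ φ : α → ℝ, Measurable φ →
      ∀ C : ℝ, (∀ x, ‖φ x‖ ≤ C) →
        Tendsto (fun n => ∫ x, φ x * f n x ∂μ) U (𝓝 (∫ x, φ x * g x ∂μ)) := by
  have hle (x : ℝ) : ENNReal.ofReal x ≤ ‖x‖ₑ := by
    rw [← ofReal_norm]
    exact ENNReal.ofReal_le_ofReal (le_abs_self x)
  -- Positive and negative parts have separate weak limits, whose difference is the limit sought.
  obtain ⟨gp, hgp, hgpi, hgpt⟩ := exists_weak_limit_ennreal (μ := μ) U hp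
    (f := fun n x => ENNReal.ofReal (f n x)) (fun n => (hf n).ennreal_ofReal) hM
    (fun n => (lintegral_mono fun x => ENNReal.rpow_le_rpow (hle _) (by linarith)).trans (hfM n))
  obtain ⟨gm, hgm, hgmi, hgmt⟩ := exists_weak_limit_ennreal (μ := μ) U hp
    (f := fun n x => ENNReal.ofReal (-f n x)) (fun n => (hf n).neg.ennreal_ofReal) hM
    (fun n => (lintegral_mono fun x => ENNReal.rpow_le_rpow ((hle _).trans_eq (enorm_neg _))
      (by linarith)).trans (hfM n))
  have hfi (n : ℕ) : ∫⁻ x, ‖f n x‖ₑ ∂μ ≠ ⊤ := by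
    have h1 : ∫⁻ x, ‖f n x‖ₑ ∂μ ≤ ∫⁻ x, 1 + ‖f n x‖ₑ ^ p ∂μ := by
      refine lintegral_mono fun x => ?_
      rcases le_total ‖f n x‖ₑ 1 with h | h
      · exact h.trans le_self_add
      · refine le_add_left ?_
        simpa using ENNReal.rpow_le_rpow_of_exponent_le h hp.le
    rw [lintegral_add_left measurable_const] at h1
    refine (h1.trans_lt (ENNReal.add_lt_top.2 ⟨?_, (hfM n).trans_lt hM.lt_top⟩)).ne
    simp
  have hfint (n : ℕ) : Integrable (f n) μ := ⟨(hf n).aestronglyMeasurable, (hfi n).lt_top⟩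
  have hgint : Integrable (fun x => (gp x).toReal - (gm x).toReal) μ :=
    (integrable_toReal_of_lintegral_ne_top hgp.aemeasurable hgpi).sub
      (integrable_toReal_of_lintegral_ne_top hgm.aemeasurable hgmi)
  have split {hp hm : α → ℝ≥0∞} (hpm : Measurable hp) (hmm : Measurable hm)
      (hpi : ∫⁻ x, hp x ∂μ ≠ ⊤) (hmi : ∫⁻ x, hm x ∂μ ≠ ⊤) {φ : α → ℝ} (hφ : Measurable φ)
      (h0 : ∀ x, 0 ≤ φ x) {C : ℝ} (hC : ∀ x, ‖φ x‖ ≤ C) :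
      ∫⁻ x, ENNReal.ofReal (φ x) * hp x ∂μ ≠ ⊤ ∧
      ∫ x, φ x * ((hp x).toReal - (hm x).toReal) ∂μ =
        (∫⁻ x, ENNReal.ofReal (φ x) * hp x ∂μ).toReal -
          (∫⁻ x, ENNReal.ofReal (φ x) * hm x ∂μ).toReal := by
    have one {h : α → ℝ≥0∞} (hh : Measurable h) (hi : ∫⁻ x, h x ∂μ ≠ ⊤) :
        ∫⁻ x, ENNReal.ofReal (φ x) * h x ∂μ ≠ ⊤ ∧ ∫ x, φ x * (h x).toReal ∂μ =
          (∫⁻ x, ENNReal.ofReal (φ x) * h x ∂μ).toReal := by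
      constructor
      · have : ∫⁻ x, ENNReal.ofReal (φ x) * h x ∂μ ≤ ∫⁻ x, ENNReal.ofReal C * h x ∂μ := by
          refine lintegral_mono fun x => ?_
          gcongr
          exact (le_abs_self _).trans (hC x)
        rw [lintegral_const_mul' _ _ ENNReal.ofReal_ne_top] at this
        exact (this.trans_lt (ENNReal.mul_lt_top ENNReal.ofReal_lt_top hi.lt_top)).ne
      · have hm : AEMeasurable (fun x => ENNReal.ofReal (φ x) * h x) μ :=
          (hφ.ennreal_ofReal.mul hh).aemeasurable
        rw [← integral_toReal hm]
        · refine integral_congr_ae (Eventually.of_forall fun x => ?_)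
          simp [ENNReal.toReal_mul, ENNReal.toReal_ofReal (h0 x)]
        · filter_upwards [ae_lt_top hh hi] with x hx
          exact ENNReal.mul_lt_top ENNReal.ofReal_lt_top hx
    have hint {h : α → ℝ≥0∞} (hh : Measurable h) (hi : ∫⁻ x, h x ∂μ ≠ ⊤) :
        Integrable (fun x => φ x * (h x).toReal) μ :=
      (integrable_toReal_of_lintegral_ne_top hh.aemeasurable hi).bdd_mul
        hφ.aestronglyMeasurable (Eventually.of_forall hC)
    refine ⟨(one hpm hpi).1, ?_⟩
    rw [← (one hpm hpi).2, ← (one hmm hmi).2, ← integral_sub (hint hpm hpi) (hint hmm hmi)]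
    simp only [mul_sub]
  have hfsplit (n : ℕ) : f n = fun x => (ENNReal.ofReal (f n x)).toReal -
      (ENNReal.ofReal (-f n x)).toReal := by
    funext x
    rcases le_total 0 (f n x) with h | h
    · rw [ENNReal.toReal_ofReal h, ENNReal.ofReal_of_nonpos (by linarith)]
      simp
    · rw [ENNReal.ofReal_of_nonpos h, ENNReal.toReal_ofReal (by linarith)]
      simp
  have hfp (n : ℕ) : ∫⁻ x, ENNReal.ofReal (f n x) ∂μ ≠ ⊤ :=
    ((lintegral_mono fun x => hle _).trans_lt (hfi n).lt_top).ne
  have hfm (n : ℕ) : ∫⁻ x, ENNReal.ofReal (-f n x) ∂μ ≠ ⊤ :=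
    ((lintegral_mono fun x => (hle _).trans_eq (enorm_neg _)).trans_lt (hfi n).lt_top).ne
  have hpos (φ : α → ℝ) (hφ : Measurable φ) (h0 : ∀ x, 0 ≤ φ x) (C : ℝ) (hC : ∀ x, ‖φ x‖ ≤ C) :
      Tendsto (fun n => ∫ x, φ x * f n x ∂μ) U
        (𝓝 (∫ x, φ x * ((gp x).toReal - (gm x).toReal) ∂μ)) := by
    have hC' (x : α) : ENNReal.ofReal (φ x) ≤ C.toNNReal :=
      ENNReal.ofReal_le_ofReal ((le_abs_self _).trans (hC x))
    have h1 := hgpt _ hφ.ennreal_ofReal _ hC'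
    have h2 := hgmt _ hφ.ennreal_ofReal _ hC'
    have h3 := ((ENNReal.tendsto_toReal (split hgp hgm hgpi hgmi hφ h0 hC).1).comp h1).sub
      ((ENNReal.tendsto_toReal (split hgm hgp hgmi hgpi hφ h0 hC).1).comp h2)
    rw [← (split hgp hgm hgpi hgmi hφ h0 hC).2] at h3
    refine h3.congr fun n => ?_
    have h4 := (split (hf n).ennreal_ofReal (hf n).neg.ennreal_ofReal (hfp n) (hfm n) hφ h0 hC).2
    simp only [Pi.neg_apply] at h4
    simp only [Function.comp]
    rw [← h4]
    conv_rhs => rw [hfsplit n]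
  refine ⟨fun x => (gp x).toReal - (gm x).toReal, hgp.ennreal_toReal.sub hgm.ennreal_toReal,
    hgint, fun φ hφ C hC => ?_⟩
  have hCpos (x : α) : 0 ≤ C := (norm_nonneg _).trans (hC x)
  -- A signed test function is the difference of the nonnegative ones `φ + C` and `|C|`. The
  -- absolute value covers an empty `α`, where `C` may be negative.
  have h1 := hpos (fun x => φ x + C) (hφ.add_const C)
    (fun x => by have := abs_le.1 (hC x); linarith) (C + C)
    (fun x => (norm_add_le _ _).trans (add_le_add (hC x) (by
      rw [Real.norm_of_nonneg (hCpos x)])))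
  have h2 := hpos (fun _ => |C|) measurable_const (fun _ => abs_nonneg C) |C| (fun _ => by simp)
  have e (h : α → ℝ) (hh : Integrable h μ) : ∫ x, φ x * h x ∂μ =
      ∫ x, (φ x + C) * h x ∂μ - ∫ x, |C| * h x ∂μ := by
    have hb : Integrable (fun x => φ x * h x) μ :=
      hh.bdd_mul hφ.aestronglyMeasurable (Eventually.of_forall hC)
    have hb2 : Integrable (fun x => (φ x + C) * h x) μ := by
      simp only [add_mul]
      exact hb.add (hh.const_mul C)
    rw [← integral_sub hb2 (hh.const_mul |C|)]
    refine integral_congr_ae (Eventually.of_forall fun x => ?_)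
    simp only [abs_of_nonneg (hCpos x)]
    ring
  rw [e _ hgint]
  exact (h1.sub h2).congr fun n => (e _ (hfint n)).symm

end WeakCompactness

/-! ### Existence of a weak gradient when `p > 1` and the energies stay bounded along a subsequence.
-/

section WeakGradient

variable {d : ℕ}

local notation "Eu" => EuclideanSpace ℝ (Fin d)

/-- Lebesgue measure is made finite by the weight `θ = (1 + |x|)^(-(d+1))`, which is integrable and
at most `1`, so the `L^p` bound persists. The weight is undone by testing with `φ / θ`, which is
bounded because `φ` has compact support. -/
theorem exists_weak_limit_volume (U : Ultrafilter ℕ) {p : ℝ} (hp : 1 < p) {f : ℕ → Eu → ℝ}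
    (hf : ∀ n, Measurable (f n)) {M : ℝ≥0∞} (hM : M ≠ ⊤)
    (hfM : ∀ n, ∫⁻ x, ‖f n x‖ₑ ^ p ≤ M) :
    ∃ g : Eu → ℝ, LocallyIntegrable g ∧ ∀ φ : Eu → ℝ, Continuous φ → HasCompactSupport φ →
      Tendsto (fun n => ∫ x, φ x * f n x) U (𝓝 (∫ x, φ x * g x)) := by
  set θ : Eu → ℝ := fun x => (1 + ‖x‖) ^ (-((d : ℝ) + 1)) with hθdef
  have hbase (x : Eu) : 1 ≤ 1 + ‖x‖ := by linarith [norm_nonneg x]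
  have hθpos (x : Eu) : 0 < θ x := Real.rpow_pos_of_pos (by linarith [hbase x]) _
  have hθle (x : Eu) : θ x ≤ 1 := Real.rpow_le_one_of_one_le_of_nonpos (hbase x)
    (by have : (0 : ℝ) ≤ d := Nat.cast_nonneg d; linarith)
  have hθc : Continuous θ := by
    refine Continuous.rpow_const (by fun_prop) fun x => Or.inl ?_
    linarith [hbase x]
  have hθi : Integrable θ := integrable_one_add_norm (by simp)
  have hθm : Measurable fun x => ENNReal.ofReal (θ x) := hθc.measurable.ennreal_ofReal
  set μ : Measure Eu := volume.withDensity fun x => ENNReal.ofReal (θ x)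
  have hμ : IsFiniteMeasure μ := isFiniteMeasure_withDensity_ofReal hθi.2
  have hint (h : Eu → ℝ) : ∫ x, h x ∂μ = ∫ x, θ x * h x := by
    rw [integral_withDensity_eq_integral_toReal_smul hθm (by simp)]
    refine integral_congr_ae (Eventually.of_forall fun x => ?_)
    simp [ENNReal.toReal_ofReal (hθpos x).le]
  obtain ⟨g, -, hgi, hgt⟩ := exists_weak_limit (μ := μ) U hp hf hM (fun n => by
    refine le_trans ?_ (hfM n)
    rw [lintegral_withDensity_eq_lintegral_mul _ hθm ((hf n).enorm.pow_const p)]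
    refine lintegral_mono fun x => ?_
    exact mul_le_of_le_one_left' (ENNReal.ofReal_le_one.2 (hθle x)))
  refine ⟨g, ?_, fun φ hφ hφc => ?_⟩
  · have h1 : Integrable fun x => θ x * g x := by
      have := (integrable_withDensity_iff_integrable_smul' hθm (by simp)).1 hgi
      simpa [ENNReal.toReal_ofReal (hθpos _).le] using this
    rw [locallyIntegrable_iff]
    intro K hK
    have h2 : IntegrableOn (fun x => (θ x)⁻¹ • (θ x * g x)) K :=
      (h1.integrableOn (s := K)).continuousOn_smul
        (hθc.inv₀ fun x => (hθpos x).ne').continuousOn hK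
    refine h2.congr_fun (fun x _ => ?_) hK.measurableSet
    simp [(hθpos x).ne']
  · have hψc : Continuous fun x => φ x * (θ x)⁻¹ := hφ.mul (hθc.inv₀ fun x => (hθpos x).ne')
    obtain ⟨C, hC⟩ := hφc.mul_right.exists_bound_of_continuous (f := fun x => φ x * (θ x)⁻¹) hψc
    have h1 := hgt _ hψc.measurable C hC
    have e (h : Eu → ℝ) : ∫ x, φ x * (θ x)⁻¹ * h x ∂μ = ∫ x, φ x * h x := by
      rw [hint]
      refine integral_congr_ae (Eventually.of_forall fun x => ?_)
      have := (hθpos x).ne'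
      field_simp
    simpa only [e] using h1

variable {p : ℝ} {k : ℕ → ℝ → ℝ≥0∞} {c : ℝ≥0∞}

/-- If `p > 1` and the energies do not tend to infinity, then there is a weak gradient. -/
theorem ConcentratingKernel.exists_hasWeakGradient (hd : 1 ≤ d) (hp : 1 < p)
    (hk : ConcentratingKernel (d - 1) p k c) {u : Eu → ℝ} (hu : LocallyIntegrable u)
    (hum : Measurable u) {Ω : Set Eu} (hΩ : IsOpen Ω)
    (hfin : liminf (fun n => energy p (k n) Ω Ω u) atTop ≠ ⊤) :
    ∃ g, HasWeakGradient Ω u g := by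
  have := finrank_ne_zero_nontrivial hd
  obtain ⟨e, he⟩ := exists_norm_eq Eu zero_le_one
  have hp0 : 0 ≤ p := by linarith
  have hC0 : c * sphereMoment p e ≠ 0 := mul_ne_zero hk.ne_zero (sphereMoment_ne_zero hp0 he)
  have hCtop : c * sphereMoment p e ≠ ⊤ :=
    ENNReal.mul_ne_top hk.ne_top (sphereMoment_lt_top hp0 e).ne
  set M := liminf (fun n => energy p (k n) Ω Ω u) atTop / (c * sphereMoment p e)
  have hM : M ≠ ⊤ := ENNReal.div_ne_top hfin hC0
  obtain ⟨K, hKc, hKm, hKU, hKex⟩ := exists_monotone_compact_exhaustion hΩ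
  have hKΩ (n : ℕ) : K n ⊆ Ω := hKU ▸ subset_iUnion K n
  -- A diagonal choice: the bump index for `K j` is taken so large that the gradient bound holds on
  -- `K j`, and at least `j` so that the bumps still shrink.
  have hex (j : ℕ) : ∃ i, j ≤ i ∧
      ∫⁻ x in K j, ‖gradient (mollify (bumpSeq Eu i) u) x‖ₑ ^ p ≤ M := by
    obtain ⟨i, hi1, hi2⟩ := ((hk.eventually_lintegral_gradient_mollify_le hd hp.le hu hum hΩ
      (hKc j) (hKΩ j) he).and (eventually_ge_atTop j)).exists
    refine ⟨i, hi2, ?_⟩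
    rw [ENNReal.le_div_iff_mul_le (Or.inl hC0) (Or.inl hCtop), mul_comm]
    exact hi1
  choose i hij hiM using hex
  have hitop : Tendsto i atTop atTop := tendsto_atTop_mono hij tendsto_id
  have hgc (j : ℕ) : Continuous (gradient (mollify (bumpSeq Eu (i j)) u)) :=
    continuous_gradient (contDiff_mollify _ hu)
  set f : Fin d → ℕ → Eu → ℝ := fun a j =>
    (K j).indicator fun x => (gradient (mollify (bumpSeq Eu (i j)) u) x) a with hf
  have hfm (a : Fin d) (j : ℕ) : Measurable (f a j) :=
    ((EuclideanSpace.proj (𝕜 := ℝ) a).continuous.comp (hgc j)).measurable.indicator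
      (hKc j).measurableSet
  have hfM (a : Fin d) (j : ℕ) : ∫⁻ x, ‖f a j x‖ₑ ^ p ≤ M := by
    refine le_trans ?_ (hiM j)
    rw [← lintegral_indicator (hKc j).measurableSet]
    refine lintegral_mono fun x => ?_
    by_cases hx : x ∈ K j
    · simp only [hf, indicator_of_mem hx]
      refine ENNReal.rpow_le_rpow (enorm_le_iff_norm_le.2 ?_) hp0
      exact PiLp.norm_apply_le _ a
    · have : 0 < p := by linarith
      simp [hf, indicator_of_notMem hx, this]
  let U : Ultrafilter ℕ := Ultrafilter.of atTop
  have hU : (U : Filter ℕ) ≤ atTop := Ultrafilter.of_le atTop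
  choose g hgl hgt using fun a => exists_weak_limit_volume U hp (hfm a) hM (hfM a)
  refine ⟨fun x => WithLp.toLp 2 fun a => g a x, hu.locallyIntegrableOn Ω, ?_, fun φ hφ a => ?_⟩
  · refine LocallyIntegrable.locallyIntegrableOn ?_ Ω
    rw [locallyIntegrable_iff]
    intro S hS
    exact integrable_piLp_iff.2 fun a => (hgl a).integrableOn_isCompact hS
  · rw [setIntegral_mul_of_support_subset u ((support_partialDeriv a).trans hφ.2.2),
      setIntegral_mul_of_support_subset _ ((subset_tsupport φ).trans hφ.2.2)]
    have hdc : HasCompactSupport (partialDeriv a φ) := hφ.2.1.mono' (support_partialDeriv a)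
    have h1 := (tendsto_integral_mollify_mul hu (hφ.continuous_partialDeriv a) hdc).comp
      (hitop.mono_left hU)
    refine tendsto_nhds_unique h1 ?_
    have h2 := (hgt a φ hφ.1.continuous hφ.2.1).neg
    simp only [mul_comm (φ _)] at h2
    refine h2.congr' ?_
    -- Once `K j` contains the support of `φ`, truncating the gradient to `K j` does not affect the
    -- pairing, and integration by parts is exact.
    obtain ⟨j0, hj0⟩ := hKex _ hφ.2.2 hφ.2.1
    filter_upwards [hU (eventually_ge_atTop j0)] with j hj
    have h3 := integral_mul_fderiv_eq_neg (contDiff_mollify (bumpSeq Eu (i j)) hu) hφ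
      (EuclideanSpace.single a 1)
    refine Eq.trans ?_ h3.symm
    congr 1
    refine integral_congr_ae (Eventually.of_forall fun x => ?_)
    by_cases hx : x ∈ tsupport φ
    · simp only [hf, indicator_of_mem (hKm hj (hj0 hx)), gradient_apply]
    · simp [image_eq_zero_of_notMem_tsupport hx]

end WeakGradient

/-! ### Increments in `L^p` and the general upper bound. -/

section Upper

variable {E : Type*} [NormedAddCommGroup E] [InnerProductSpace ℝ E] [FiniteDimensional ℝ E]
  [MeasurableSpace E] [BorelSpace E]

/-- A crude bound independent of `h`. It is used for long increments, where the kernels carry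
vanishing mass. -/
theorem lintegral_translate_sub_rpow_le {p : ℝ} (hp : 1 ≤ p) {v : E → ℝ} (hvm : Measurable v)
    (A : Set E) (h : E) :
    ∫⁻ x in A, ‖v (x + h) - v x‖ₑ ^ p ≤ 2 ^ (p - 1) * (2 * ∫⁻ x, ‖v x‖ₑ ^ p) := by
  have hp0 : 0 ≤ p := by linarith
  calc ∫⁻ x in A, ‖v (x + h) - v x‖ₑ ^ p ≤ ∫⁻ x, ‖v (x + h) - v x‖ₑ ^ p :=
        setLIntegral_le_lintegral _ _
    _ ≤ ∫⁻ x, 2 ^ (p - 1) * (‖v (x + h)‖ₑ ^ p + ‖v x‖ₑ ^ p) := by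
        refine lintegral_mono fun x => ?_
        exact (ENNReal.rpow_le_rpow (enorm_sub_le) hp0).trans
          (ENNReal.rpow_add_le_mul_rpow_add_rpow _ _ hp)
    _ = _ := by
        rw [lintegral_const_mul _ (by fun_prop), lintegral_add_left (by fun_prop),
          lintegral_add_right_eq_self (fun x => ‖v x‖ₑ ^ p), two_mul]

/-- The upper bound for the energies, given a homogeneous bound for the increments. -/
theorem ConcentratingKernel.limsup_energy_le [Nontrivial E] {p : ℝ} {k : ℕ → ℝ → ℝ≥0∞} {c : ℝ≥0∞}
    (hk : ConcentratingKernel (Module.finrank ℝ E - 1) p k c) (hp : 1 ≤ p) {v : E → ℝ}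
    (hvm : Measurable v) (hv : ∫⁻ x, ‖v x‖ₑ ^ p ≠ ⊤) {A : Set E} {H : E → ℝ≥0∞}
    (hH : Measurable H) (hom : ∀ (r : ℝ) (x : E), 0 < r → H (r • x) = ENNReal.ofReal r ^ p * H x)
    {δ : ℝ} (hδ : 0 < δ) (hle : ∀ h : E, ‖h‖ < δ → ∫⁻ x in A, ‖v (x + h) - v x‖ₑ ^ p ≤ H h) :
    limsup (fun n => energy p (k n) A univ v) atTop ≤
      c * ∫⁻ w : Metric.sphere (0 : E) 1, H w ∂(volume : Measure E).toSphere := by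
  set B : ℝ≥0∞ := 2 ^ (p - 1) * (2 * ∫⁻ x, ‖v x‖ₑ ^ p)
  have hB : B ≠ ⊤ := ENNReal.mul_ne_top (ENNReal.rpow_ne_top_of_nonneg (by linarith) (by simp))
    (ENNReal.mul_ne_top (by simp) hv)
  have hlim := (hk.tendsto_near hH hom hδ).add
    (ENNReal.Tendsto.mul_const (b := B) (hk.tendsto_far (E := E) hδ) (Or.inr hB))
  rw [zero_mul, add_zero] at hlim
  rw [← hlim.limsup_eq]
  refine limsup_le_limsup (Eventually.of_forall fun n => ?_)
  beta_reduce
  rw [energy_univ_right (hk.measurable n) A hvm,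
    ← lintegral_add_compl _ (Metric.isOpen_ball (x := (0 : E)) (ε := δ)).measurableSet]
  have hkm : Measurable fun h : E => k n ‖h‖ := (hk.measurable n).comp measurable_norm
  rw [← lintegral_mul_const _ hkm]
  refine add_le_add (setLIntegral_mono' Metric.isOpen_ball.measurableSet fun h hh => ?_)
    (lintegral_mono fun h => ?_)
  · exact mul_le_mul_right (hle h (by simpa using hh)) _
  · exact mul_le_mul_right (lintegral_translate_sub_rpow_le hp hvm A h) _

theorem sub_eq_integral_inner_gradient {f : E → ℝ} (hf : ContDiff ℝ ∞ f) (x h : E) :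
    f (x + h) - f x = ∫ t in Ioc (0 : ℝ) 1, inner ℝ (gradient f (x + t • h)) h := by
  have hgrad : Continuous (gradient f) :=
    (InnerProductSpace.toDual ℝ E).symm.continuous.comp (hf.continuous_fderiv (by simp))
  have hd (t : ℝ) : HasDerivAt (fun t : ℝ => f (x + t • h))
      (inner ℝ (gradient f (x + t • h)) h) t := by
    have h1 := ((hf.differentiable (by simp)) (x + t • h)).hasGradientAt.hasFDerivAt
    have h2 : HasDerivAt (fun t : ℝ => x + t • h) h t := by
      simpa using ((hasDerivAt_id t).smul_const h).const_add x
    have h3 := h1.comp_hasDerivAt t h2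
    rw [InnerProductSpace.toDual_apply_apply] at h3
    exact h3
  have hc : Continuous fun t : ℝ => inner ℝ (gradient f (x + t • h)) h := by fun_prop
  have := intervalIntegral.integral_eq_sub_of_hasDerivAt (fun t _ => hd t)
    (hc.intervalIntegrable 0 1)
  rw [intervalIntegral.integral_of_le zero_le_one] at this
  simpa using this.symm

instance : IsProbabilityMeasure (volume.restrict (Ioc (0 : ℝ) 1)) := ⟨by simp⟩

/-- The increment is the integral of the gradient along the segment, so Jensen in the segment
parameter and Tonelli reduce the error to translates of `∇f` compared with `g`. Here `g` need not be
`∇f`: it will be the weak gradient of a function of which `f` is a mollification. -/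
theorem lintegral_sub_sub_inner_rpow_le_of_smooth {p : ℝ} (hp : 1 ≤ p) {f : E → ℝ}
    (hf : ContDiff ℝ ∞ f) {g : E → E} (hg : Measurable g) (h : E) {η : ℝ≥0∞}
    (hη : ∀ z, ‖z‖ ≤ ‖h‖ → ∫⁻ x, ‖gradient f (x + z) - g x‖ₑ ^ p ≤ η) :
    ∫⁻ x, ‖f (x + h) - f x - inner ℝ (g x) h‖ₑ ^ p ≤ ‖h‖ₑ ^ p * η := by
  have hp0 : 0 ≤ p := by linarith
  have hgrad : Continuous (gradient f) :=
    (InnerProductSpace.toDual ℝ E).symm.continuous.comp (hf.continuous_fderiv (by simp))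
  have hgm := hgrad.measurable
  have hpt (x : E) : ‖f (x + h) - f x - inner ℝ (g x) h‖ₑ ^ p ≤
      ∫⁻ t in Ioc (0 : ℝ) 1, ‖h‖ₑ ^ p * ‖gradient f (x + t • h) - g x‖ₑ ^ p := by
    have hc : Continuous fun t : ℝ => inner ℝ (gradient f (x + t • h)) h := by fun_prop
    have hi : Integrable (fun t : ℝ => inner ℝ (gradient f (x + t • h)) h)
        (volume.restrict (Ioc (0 : ℝ) 1)) :=
      (hc.integrableOn_Icc (a := 0) (b := 1)).mono_set Ioc_subset_Icc_self
    have e1 : f (x + h) - f x - inner ℝ (g x) h =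
        ∫ t in Ioc (0 : ℝ) 1, (inner ℝ (gradient f (x + t • h)) h - inner ℝ (g x) h) := by
      rw [integral_sub hi (integrable_const _), ← sub_eq_integral_inner_gradient hf]
      simp
    rw [e1]
    refine (enorm_integral_rpow_le hp (hi.sub (integrable_const _)).aestronglyMeasurable).trans ?_
    refine lintegral_mono fun t => ?_
    simp only [Pi.sub_apply]
    rw [← inner_sub_left, ← ENNReal.mul_rpow_of_nonneg _ _ hp0, mul_comm]
    refine ENNReal.rpow_le_rpow ?_ hp0
    rw [← enorm_norm h, ← enorm_norm (gradient f (x + t • h) - g x), ← enorm_mul]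
    refine enorm_le_iff_norm_le.2 ?_
    simpa using norm_inner_le_norm (𝕜 := ℝ) (gradient f (x + t • h) - g x) h
  calc ∫⁻ x, ‖f (x + h) - f x - inner ℝ (g x) h‖ₑ ^ p
      ≤ ∫⁻ x, ∫⁻ t in Ioc (0 : ℝ) 1, ‖h‖ₑ ^ p * ‖gradient f (x + t • h) - g x‖ₑ ^ p :=
        lintegral_mono hpt
    _ = ∫⁻ t in Ioc (0 : ℝ) 1, ∫⁻ x, ‖h‖ₑ ^ p * ‖gradient f (x + t • h) - g x‖ₑ ^ p :=
        lintegral_lintegral_swap (by fun_prop)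
    _ ≤ ∫⁻ t in Ioc (0 : ℝ) 1, ‖h‖ₑ ^ p * η := by
        refine setLIntegral_mono' measurableSet_Ioc fun t ht => ?_
        rw [lintegral_const_mul _ (by fun_prop)]
        gcongr
        refine hη _ ?_
        rw [norm_smul, Real.norm_of_nonneg ht.1.le]
        exact mul_le_of_le_one_left (norm_nonneg _) ht.2
    _ = _ := by simp

theorem LocallyIntegrable.of_lintegral_rpow {F : Type*} [NormedAddCommGroup F] {p : ℝ}
    (hp : 1 ≤ p) {v : E → F} (hvm : AEStronglyMeasurable v) (hv : ∫⁻ x, ‖v x‖ₑ ^ p ≠ ⊤) :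
    LocallyIntegrable v := by
  have hp0 : 0 < p := by linarith
  have h : MemLp v (ENNReal.ofReal p) := by
    refine ⟨hvm, ?_⟩
    rw [eLpNorm_lt_top_iff_lintegral_rpow_enorm_lt_top (by simpa using hp0) (by simp),
      ENNReal.toReal_ofReal hp0.le]
    exact hv.lt_top
  exact h.locallyIntegrable (by simpa using hp)

/-- Mollifications inherit the `L^p` modulus of continuity. -/
theorem lintegral_mollify_sub_rpow_le {F : Type*} [NormedAddCommGroup F] [NormedSpace ℝ F]
    [CompleteSpace F] [MeasurableSpace F] [BorelSpace F] [SecondCountableTopology F]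
    (φ : ContDiffBump (0 : E)) {p : ℝ}
    (hp : 1 ≤ p) {g : E → F} (hgm : Measurable g) (hg : LocallyIntegrable g) {δ : ℝ}
    {η : ℝ≥0∞} (hη : ∀ z, ‖z‖ ≤ δ + φ.rOut → ∫⁻ x, ‖g (x + z) - g x‖ₑ ^ p ≤ η) {z : E}
    (hz : ‖z‖ ≤ δ) : ∫⁻ x, ‖mollify φ g (x + z) - g x‖ₑ ^ p ≤ η := by
  calc ∫⁻ x, ‖mollify φ g (x + z) - g x‖ₑ ^ p
      ≤ ∫⁻ x, ∫⁻ w, ‖g (x + z - w) - g x‖ₑ ^ p ∂(bumpMeasure φ) := by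
        refine lintegral_mono fun x => ?_
        have hi := LocallyIntegrable.integrable_bumpMeasure φ hg (x + z)
        have e1 : mollify φ g (x + z) - g x = ∫ w, (g (x + z - w) - g x) ∂(bumpMeasure φ) := by
          rw [integral_sub hi (integrable_const _), mollify_eq_integral]
          simp
        rw [e1]
        exact enorm_integral_rpow_le hp (hi.sub (integrable_const _)).aestronglyMeasurable
    _ = ∫⁻ w, (∫⁻ x, ‖g (x + z - w) - g x‖ₑ ^ p) ∂(bumpMeasure φ) :=
        lintegral_lintegral_swap (by fun_prop)
    _ ≤ ∫⁻ _, η ∂(bumpMeasure φ) := by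
        refine lintegral_mono_ae ?_
        filter_upwards [ae_bumpMeasure φ] with w hw
        simp only [add_sub_assoc]
        exact hη _ ((norm_sub_le _ _).trans (add_le_add hz hw.le))
    _ = η := by simp

/-- Continuity of translations in `L^p`. -/
theorem exists_lintegral_translate_sub_rpow_le {F : Type*} [NormedAddCommGroup F]
    {p : ℝ} (hp : 1 ≤ p) {g : E → F} (hgm : AEStronglyMeasurable g)
    (hg : ∫⁻ x, ‖g x‖ₑ ^ p ≠ ⊤) {η : ℝ≥0∞} (hη : η ≠ 0) :
    ∃ δ > 0, ∀ z, ‖z‖ ≤ δ → ∫⁻ x, ‖g (x + z) - g x‖ₑ ^ p ≤ η := by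
  have hp0 : 0 < p := by linarith
  have hpE : ENNReal.ofReal p ≠ 0 := by simpa using hp0
  have hfact : Fact (1 ≤ ENNReal.ofReal p) := ⟨by simpa using hp⟩
  have hmem : MemLp g (ENNReal.ofReal p) := by
    refine ⟨hgm, ?_⟩
    rw [eLpNorm_lt_top_iff_lintegral_rpow_enorm_lt_top hpE (by simp),
      ENNReal.toReal_ofReal hp0.le]
    exact hg.lt_top
  let T : E → C(E, E) := fun z => ⟨fun x => x + z, by fun_prop⟩
  have hT : Continuous T := by
    refine ContinuousMap.continuous_of_continuous_uncurry _ ?_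
    simp only [T, Function.uncurry_def, ContinuousMap.coe_mk]
    fun_prop
  have hTm (z : E) : MeasurePreserving (T z) volume volume := measurePreserving_add_right volume z
  have hcont := Continuous.compMeasurePreservingLp (continuous_const (y := hmem.toLp g)) hT hTm
    ENNReal.ofReal_ne_top
  have h0 := hcont.tendsto 0
  have hr' : 0 < η ^ (1 / p) :=
    ENNReal.rpow_pos_of_nonneg (pos_iff_ne_zero.2 hη) (by positivity)
  have h1 := EMetric.tendsto_nhds.1 h0 _ hr'
  obtain ⟨δ, hδ, h2⟩ := Metric.eventually_nhds_iff.1 h1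
  refine ⟨δ / 2, half_pos hδ, fun z hz => ?_⟩
  have h3 : edist ((hmem.comp_measurePreserving (hTm z)).toLp _)
      ((hmem.comp_measurePreserving (hTm 0)).toLp _) ≤ η ^ (1 / p) :=
    (h2 (by rw [dist_zero_right]; linarith)).le
  rw [Lp.edist_toLp_toLp, eLpNorm_eq_lintegral_rpow_enorm_toReal hpE (by simp),
    ENNReal.toReal_ofReal hp0.le, ENNReal.rpow_le_rpow_iff (by positivity)] at h3
  simpa [T] using h3

end Upper

/-! ### The upper bound by the weak gradient. -/

section SobolevUpper

variable {d : ℕ}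

local notation "Eu" => EuclideanSpace ℝ (Fin d)

/-- Weak gradients are unique up to null sets. -/
theorem HasWeakGradient.ae_eq {Ω : Set Eu} (hΩ : IsOpen Ω) {u : Eu → ℝ} {g g' : Eu → Eu}
    (h : HasWeakGradient Ω u g) (h' : HasWeakGradient Ω u g') :
    g =ᵐ[volume.restrict Ω] g' := by
  have key (i : Fin d) : ∀ᵐ x, x ∈ Ω → g x i - g' x i = 0 := by
    have hl := locallyIntegrableOn_apply h.2.1 i
    have hl' := locallyIntegrableOn_apply h'.2.1 i
    refine hΩ.ae_eq_zero_of_integral_contDiff_smul_eq_zero (hl.sub hl') fun φ hφ hφc hφs => ?_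
    have ht : IsTestFunction Ω φ := ⟨hφ, hφc, hφs⟩
    have h1 := (h.2.2 φ ht i).symm.trans (h'.2.2 φ ht i)
    rw [neg_inj] at h1
    have h2 := integral_sub (ht.integrableOn_apply h.2.1 i) (ht.integrableOn_apply h'.2.1 i)
    rw [h1, sub_self] at h2
    have h3 := setIntegral_mul_of_support_subset (μ := volume) (fun x => g x i - g' x i)
      ((subset_tsupport φ).trans hφs)
    simp only [smul_eq_mul, mul_comm (φ _)]
    rw [← h3, ← h2]
    simp only [sub_mul]
  rw [Filter.EventuallyEq, ae_restrict_iff' hΩ.measurableSet]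
  filter_upwards [ae_all_iff.2 key] with x hx hxΩ
  ext i
  exact sub_eq_zero.1 (hx i hxΩ)

/-- A function with a weak gradient in `L^p(ℝ^d)` is differentiable in the mean of order `p`. -/
theorem HasWeakGradient.exists_lintegral_sub_sub_inner_rpow_le {p : ℝ} (hp : 1 ≤ p) {v : Eu → ℝ}
    (hvl : LocallyIntegrable v) {g : Eu → Eu} (hgm : Measurable g)
    (hg : ∫⁻ x, ‖g x‖ₑ ^ p ≠ ⊤) (hw : HasWeakGradient univ v g) {η : ℝ≥0∞} (hη : η ≠ 0) :
    ∃ δ > 0, ∀ h, ‖h‖ < δ →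
      ∫⁻ x, ‖v (x + h) - v x - inner ℝ (g x) h‖ₑ ^ p ≤ ‖h‖ₑ ^ p * η := by
  have hp0 : 0 ≤ p := by linarith
  obtain ⟨δ, hδ, hδη⟩ := exists_lintegral_translate_sub_rpow_le hp hgm.aestronglyMeasurable hg hη
  have hgl : LocallyIntegrable g :=
    LocallyIntegrable.of_lintegral_rpow hp hgm.aestronglyMeasurable hg
  -- Half of `δ` bounds the increment, the other half the bump radius. The estimate for
  -- mollifications is uniform in the bump and passes to `v` by Fatou.
  refine ⟨δ / 2, half_pos hδ, fun h hh => ?_⟩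
  have hae := ae_tendsto_mollify_bumpSeq hvl
  have hae2 : ∀ᵐ x, Tendsto (fun i => mollify (bumpSeq Eu i) v (x + h)) atTop (𝓝 (v (x + h))) :=
    (measurePreserving_add_right volume h).quasiMeasurePreserving.ae hae
  calc ∫⁻ x, ‖v (x + h) - v x - inner ℝ (g x) h‖ₑ ^ p
      = ∫⁻ x, liminf (fun i => ‖mollify (bumpSeq Eu i) v (x + h) - mollify (bumpSeq Eu i) v x -
          inner ℝ (g x) h‖ₑ ^ p) atTop := by
        refine lintegral_congr_ae ?_
        filter_upwards [hae, hae2] with x h1 h2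
        refine (Tendsto.liminf_eq ?_).symm
        exact (ENNReal.continuous_rpow_const.tendsto _).comp
          ((h2.sub h1).sub tendsto_const_nhds).enorm
    _ ≤ liminf (fun i => ∫⁻ x, ‖mollify (bumpSeq Eu i) v (x + h) - mollify (bumpSeq Eu i) v x -
          inner ℝ (g x) h‖ₑ ^ p) atTop := by
        refine lintegral_liminf_le fun i => ?_
        have := (contDiff_mollify (bumpSeq Eu i) hvl).continuous.measurable
        fun_prop
    _ ≤ liminf (fun _ : ℕ => ‖h‖ₑ ^ p * η) atTop := by
        refine liminf_le_liminf ?_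
        have hsmall := (tendsto_bumpSeq_rOut (E := Eu)).eventually (gt_mem_nhds (half_pos hδ))
        filter_upwards [hsmall] with i hi
        refine lintegral_sub_sub_inner_rpow_le_of_smooth hp (contDiff_mollify _ hvl) hgm h
          fun z hz => ?_
        have e (x : Eu) : gradient (mollify (bumpSeq Eu i) v) x = mollify (bumpSeq Eu i) g x :=
          hw.gradient_mollify hvl (subset_univ _) fun _ _ => rfl
        simp only [e]
        exact lintegral_mollify_sub_rpow_le _ hp hgm hgl
          (fun z hz => hδη z (by linarith)) hz
    _ = _ := liminf_const _

variable {p : ℝ} {k : ℕ → ℝ → ℝ≥0∞} {c : ℝ≥0∞}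

/-- The upper bound by the weak gradient. -/
theorem ConcentratingKernel.limsup_energy_le_of_hasWeakGradient (hd : 1 ≤ d) (hp : 1 ≤ p)
    (hk : ConcentratingKernel (d - 1) p k c) {v : Eu → ℝ} (hvm : Measurable v)
    (hv : ∫⁻ x, ‖v x‖ₑ ^ p ≠ ⊤) {g : Eu → Eu} (hgm : Measurable g)
    (hg : ∫⁻ x, ‖g x‖ₑ ^ p ≠ ⊤) (hw : HasWeakGradient univ v g) (A : Set Eu) {e : Eu}
    (he : ‖e‖ = 1) :
    limsup (fun n => energy p (k n) A univ v) atTop ≤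
      c * sphereMoment p e * ∫⁻ x in A, ‖g x‖ₑ ^ p := by
  have := finrank_ne_zero_nontrivial hd
  have hk' : ConcentratingKernel (Module.finrank ℝ Eu - 1) p k c := by simpa using hk
  have hp0 : 0 < p := by linarith
  have hvl := LocallyIntegrable.of_lintegral_rpow hp hvm.aestronglyMeasurable hv
  set D : Eu → ℝ≥0∞ := fun h => ∫⁻ x in A, ‖inner ℝ (g x) h‖ₑ ^ p with hD
  have hDm : Measurable D := by
    have : Measurable fun z : Eu × Eu => ‖inner ℝ (g z.2) z.1‖ₑ ^ p := by fun_prop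
    exact this.lintegral_prod_right'
  have hDhom (r : ℝ) (x : Eu) (hr : 0 < r) : D (r • x) = ENNReal.ofReal r ^ p * D x := by
    simp only [hD]
    rw [← lintegral_const_mul _ (by fun_prop)]
    refine lintegral_congr fun y => ?_
    rw [real_inner_smul_right, enorm_mul, ENNReal.mul_rpow_of_nonneg _ _ hp0.le,
      Real.enorm_of_nonneg hr.le]
  have hDle (w : Eu) (hw : ‖w‖ = 1) : D w ≤ ∫⁻ x, ‖g x‖ₑ ^ p := by
    refine (setLIntegral_le_lintegral _ _).trans (lintegral_mono fun x => ?_)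
    refine ENNReal.rpow_le_rpow (enorm_le_iff_norm_le.2 ?_) hp0.le
    simpa [hw] using norm_inner_le_norm (𝕜 := ℝ) (g x) w
  -- Minkowski's inequality for the linear part plus the error; both terms scale alike, so the sum
  -- is homogeneous of degree `p`.
  set H : ℝ≥0∞ → Eu → ℝ≥0∞ := fun η h => (D h ^ (1 / p) + ‖h‖ₑ * η ^ (1 / p)) ^ p with hH
  have hHm (η : ℝ≥0∞) : Measurable (H η) := by fun_prop
  have hHhom (η : ℝ≥0∞) (r : ℝ) (x : Eu) (hr : 0 < r) :
      H η (r • x) = ENNReal.ofReal r ^ p * H η x := by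
    simp only [hH]
    rw [hDhom r x hr, ENNReal.mul_rpow_of_nonneg _ _ (by positivity), ← ENNReal.rpow_mul,
      mul_one_div_cancel hp0.ne', ENNReal.rpow_one, enorm_smul, Real.enorm_of_nonneg hr.le,
      mul_assoc, ← mul_add, ENNReal.mul_rpow_of_nonneg _ _ hp0.le]
  have key (η : ℝ≥0∞) (hη : η ≠ 0) : limsup (fun n => energy p (k n) A univ v) atTop ≤
      c * ∫⁻ w : Metric.sphere (0 : Eu) 1, H η w ∂(volume : Measure Eu).toSphere := by
    obtain ⟨δ, hδ, hle⟩ := hw.exists_lintegral_sub_sub_inner_rpow_le hp hvl hgm hg hη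
    refine hk'.limsup_energy_le hp hvm hv (hHm η) (hHhom η) hδ fun h hh => ?_
    have h1 := ENNReal.lintegral_Lp_add_le (μ := volume.restrict A) (p := p)
      (f := fun x => ‖inner ℝ (g x) h‖ₑ) (g := fun x => ‖v (x + h) - v x - inner ℝ (g x) h‖ₑ)
      (by fun_prop) (by fun_prop) hp
    have h2 : (∫⁻ x in A, ‖v (x + h) - v x - inner ℝ (g x) h‖ₑ ^ p) ^ (1 / p) ≤
        ‖h‖ₑ * η ^ (1 / p) := by
      have := ENNReal.rpow_le_rpow ((setLIntegral_le_lintegral A _).trans (hle h hh))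
        (one_div_nonneg.2 hp0.le)
      rwa [ENNReal.mul_rpow_of_nonneg _ _ (by positivity), ← ENNReal.rpow_mul,
        mul_one_div_cancel hp0.ne', ENNReal.rpow_one] at this
    calc ∫⁻ x in A, ‖v (x + h) - v x‖ₑ ^ p
        = ((∫⁻ x in A, ‖v (x + h) - v x‖ₑ ^ p) ^ (1 / p)) ^ p := by
          rw [← ENNReal.rpow_mul, one_div_mul_cancel hp0.ne', ENNReal.rpow_one]
      _ ≤ H η h := by
          refine ENNReal.rpow_le_rpow (le_trans ?_ (h1.trans (add_le_add le_rfl h2))) hp0.le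
          refine ENNReal.rpow_le_rpow (lintegral_mono fun x => ?_) (by positivity)
          refine ENNReal.rpow_le_rpow ?_ hp0.le
          have : v (x + h) - v x = inner ℝ (g x) h + (v (x + h) - v x - inner ℝ (g x) h) := by ring
          conv_lhs => rw [this]
          exact enorm_add_le _ _
  -- The error parameter `η = 1/(j+1)` is at most `1`, which accounts for the `+ 1` in the
  -- dominating constant.
  have hlim : Tendsto (fun j : ℕ => c * ∫⁻ w : Metric.sphere (0 : Eu) 1,
      H (((j : ℝ≥0∞) + 1)⁻¹) w ∂(volume : Measure Eu).toSphere) atTop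
      (𝓝 (c * ∫⁻ w : Metric.sphere (0 : Eu) 1, D w ∂(volume : Measure Eu).toSphere)) := by
    refine ENNReal.Tendsto.const_mul ?_ (Or.inr hk.ne_top)
    refine tendsto_lintegral_of_dominated_convergence
      (fun _ => ((∫⁻ x, ‖g x‖ₑ ^ p) ^ (1 / p) + 1) ^ p)
      (fun j => (hHm _).comp measurable_subtype_coe) ?_ ?_ ?_
    · refine fun j => Eventually.of_forall fun w => ?_
      have hw1 : ‖(w : Eu)‖ = 1 := by simp
      have hw2 : ‖(w : Eu)‖ₑ = 1 := by rw [← ofReal_norm, hw1, ENNReal.ofReal_one]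
      refine ENNReal.rpow_le_rpow (add_le_add ?_ ?_) hp0.le
      · exact ENNReal.rpow_le_rpow (hDle w hw1) (by positivity)
      · rw [hw2, one_mul]
        refine ENNReal.rpow_le_one ?_ (by positivity)
        exact ENNReal.inv_le_one.2 le_add_self
    · rw [lintegral_const]
      refine ENNReal.mul_ne_top (ENNReal.rpow_ne_top_of_nonneg hp0.le ?_) (measure_ne_top _ _)
      exact ENNReal.add_ne_top.2 ⟨ENNReal.rpow_ne_top_of_nonneg (by positivity) hg, by simp⟩
    · refine Eventually.of_forall fun w => ?_
      have h0 : Tendsto (fun j : ℕ => ((j : ℝ≥0∞) + 1)⁻¹) atTop (𝓝 0) := by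
        have := (tendsto_add_atTop_iff_nat 1).2 ENNReal.tendsto_inv_nat_nhds_zero
        simpa using this
      have h1 := (ENNReal.continuous_rpow_const (y := 1 / p)).tendsto 0 |>.comp h0
      rw [ENNReal.zero_rpow_of_pos (by positivity)] at h1
      have h2 := ENNReal.Tendsto.const_mul (a := ‖(w : Eu)‖ₑ) h1 (Or.inr enorm_ne_top)
      rw [mul_zero] at h2
      have h3 := (ENNReal.continuous_rpow_const (y := p)).tendsto _ |>.comp
        (h2.const_add (D w ^ (1 / p)))
      rw [add_zero, ← ENNReal.rpow_mul, one_div_mul_cancel hp0.ne', ENNReal.rpow_one] at h3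
      exact h3
  -- Integrating over directions first makes `sphereMoment_eq` available at each `x`.
  have hS : ∫⁻ w : Metric.sphere (0 : Eu) 1, D w ∂(volume : Measure Eu).toSphere =
      sphereMoment p e * ∫⁻ x in A, ‖g x‖ₑ ^ p := by
    simp only [hD]
    rw [lintegral_lintegral_swap, ← lintegral_const_mul _ (by fun_prop)]
    · refine lintegral_congr fun x => ?_
      rw [mul_comm, ← sphereMoment_eq hp0 he]
      simp only [sphereMoment, real_inner_comm]
    · have : Measurable fun z : Eu × Eu => ‖inner ℝ (g z.2) z.1‖ₑ ^ p := by fun_prop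
      exact (this.comp (measurable_subtype_coe.prodMap measurable_id)).aemeasurable
  rw [hS, ← mul_assoc] at hlim
  exact ge_of_tendsto' hlim fun j => key _ (by simp)

end SobolevUpper

/-! ### The upper bound by the variation on the whole space. -/

section BVUpper

variable {d : ℕ}

local notation "Eu" => EuclideanSpace ℝ (Fin d)

theorem contDiff_gradient {f : Eu → ℝ} (hf : ContDiff ℝ ∞ f) : ContDiff ℝ ∞ (gradient f) := by
  rw [contDiff_euclidean]
  intro i
  simp only [gradient_apply]
  exact (hf.fderiv_right (m := ∞) (by simp)).clm_apply contDiff_const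

theorem divergence_comp_add (ψ : Eu → Eu) (w y : Eu) :
    divergence (fun y => ψ (y + w)) y = divergence ψ (y + w) := by
  simp only [divergence, partialDeriv, fderiv_comp_add_right]

theorem IsTestFunction.comp_add {ψ : Eu → Eu} (hψ : IsTestFunction univ ψ) (w : Eu) :
    IsTestFunction univ fun y => ψ (y + w) :=
  ⟨hψ.1.comp (contDiff_id.add contDiff_const),
    hψ.2.1.comp_homeomorph (Homeomorph.addRight w), subset_univ _⟩

/-- Mollification does not increase the variation. -/
theorem ofReal_integral_mollify_mul_divergence_le (φ : ContDiffBump (0 : Eu)) {v : Eu → ℝ}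
    (hv : LocallyIntegrable v) {ψ : Eu → Eu} (hψ : IsTestFunction univ ψ)
    (hψ1 : ∀ x, ‖ψ x‖ ≤ 1) :
    ENNReal.ofReal (∫ x, mollify φ v x * divergence ψ x) ≤ variation univ v := by
  rcases eq_or_ne (variation univ v) ⊤ with hV | hV
  · simp [hV]
  rw [integral_mollify_mul φ hv hψ.continuous_divergence hψ.hasCompactSupport_divergence]
  refine ENNReal.ofReal_le_of_le_toReal ?_
  have hle (w : Eu) : ∫ y, v y * divergence ψ (y + w) ≤ (variation univ v).toReal := by
    refine (ENNReal.ofReal_le_iff_le_toReal hV).1 ?_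
    refine le_iSup₂_of_le (fun y => ψ (y + w)) ⟨hψ.comp_add w, fun x => hψ1 _⟩ (le_of_eq ?_)
    simp only [Measure.restrict_univ, divergence_comp_add]
  -- If integrability failed, the integral would be `0` by convention and the bound trivial, so
  -- integrability need not be established.
  by_cases hi : Integrable (fun w => ∫ y, v y * divergence ψ (y + w)) (bumpMeasure φ)
  · refine (integral_mono hi (integrable_const _) hle).trans ?_
    simp
  · rw [integral_undef hi]
    exact ENNReal.toReal_nonneg

/-- The bound for the gradient of a mollification by the variation. -/
theorem lintegral_gradient_mollify_le_variation (φ : ContDiffBump (0 : Eu)) {v : Eu → ℝ}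
    (hv : LocallyIntegrable v) :
    ∫⁻ x, ‖gradient (mollify φ v) x‖ₑ ≤ variation univ v := by
  have hf := contDiff_mollify φ hv
  set f := mollify φ v
  have hG := contDiff_gradient hf
  set G := gradient f with hGdef
  let χ : ℕ → ContDiffBump (0 : Eu) := fun j =>
    ⟨(j : ℝ) + 1, (j : ℝ) + 2, by positivity, by linarith⟩
  -- The extremal field would be `-G / |G|`. Regularizing the norm keeps it smooth at the zeros of
  -- `G`, and the cutoff `χ j` makes its support compact.
  set q : ℕ → Eu → ℝ := fun j x => χ j x * (√((1 / ((j : ℝ) + 1)) ^ 2 + ‖G x‖ ^ 2))⁻¹ with hq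
  have hpos (j : ℕ) (x : Eu) : 0 < (1 / ((j : ℝ) + 1)) ^ 2 + ‖G x‖ ^ 2 := by positivity
  have hqs (j : ℕ) : ContDiff ℝ ∞ (q j) := by
    refine (χ j).contDiff.mul (ContDiff.inv (ContDiff.sqrt ?_ fun x => (hpos j x).ne')
      fun x => (Real.sqrt_pos.2 (hpos j x)).ne')
    exact contDiff_const.add (hG.norm_sq ℝ)
  have hq0 (j : ℕ) (x : Eu) : 0 ≤ q j x :=
    mul_nonneg (χ j).nonneg (inv_nonneg.2 (Real.sqrt_nonneg _))
  have hqc (j : ℕ) : HasCompactSupport (q j) := (χ j).hasCompactSupport.mul_right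
  have hψ (j : ℕ) : IsTestFunction univ fun x => (-q j x) • G x :=
    ⟨(hqs j).neg.smul hG, (hqc j).neg.smul_right, subset_univ _⟩
  have hψ1 (j : ℕ) (x : Eu) : ‖(-q j x) • G x‖ ≤ 1 := by
    rw [norm_smul, norm_neg, Real.norm_of_nonneg (hq0 j x)]
    have h1 : ‖G x‖ ≤ √((1 / ((j : ℝ) + 1)) ^ 2 + ‖G x‖ ^ 2) :=
      Real.le_sqrt_of_sq_le (by have := sq_nonneg (1 / ((j : ℝ) + 1)); linarith)
    have h2 := Real.sqrt_pos.2 (hpos j x)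
    calc χ j x * (√((1 / ((j : ℝ) + 1)) ^ 2 + ‖G x‖ ^ 2))⁻¹ * ‖G x‖
        ≤ 1 * (√((1 / ((j : ℝ) + 1)) ^ 2 + ‖G x‖ ^ 2))⁻¹ * ‖G x‖ := by
          gcongr
          exact (χ j).le_one
      _ ≤ 1 := by
          rw [one_mul, inv_mul_le_iff₀ h2, mul_one]
          exact h1
  have hint (j : ℕ) : ∫⁻ x, ENNReal.ofReal (q j x * ‖G x‖ ^ 2) ≤ variation univ v := by
    have h1 := ofReal_integral_mollify_mul_divergence_le φ hv (hψ j) (hψ1 j)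
    rw [integral_mul_divergence_eq_neg hf (hψ j), ← integral_neg] at h1
    refine le_trans (le_of_eq ?_) h1
    rw [← ofReal_integral_eq_lintegral_ofReal]
    · congr 1
      refine integral_congr_ae (Eventually.of_forall fun x => ?_)
      simp only [← hGdef, real_inner_smul_right, real_inner_self_eq_norm_sq]
      ring
    · exact ((hqs j).continuous.mul (hG.continuous.norm.pow 2)).integrable_of_hasCompactSupport
        (hqc j).mul_right
    · exact Eventually.of_forall fun x => mul_nonneg (hq0 j x) (sq_nonneg _)
  have hlim (x : Eu) : Tendsto (fun j => ENNReal.ofReal (q j x * ‖G x‖ ^ 2)) atTop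
      (𝓝 ‖G x‖ₑ) := by
    rw [← ofReal_norm]
    refine ENNReal.tendsto_ofReal ?_
    rcases eq_or_ne (G x) 0 with h0 | h0
    · simp [h0]
    have hn : 0 < ‖G x‖ := norm_pos_iff.2 h0
    have h1 : Tendsto (fun j : ℕ => (√((1 / ((j : ℝ) + 1)) ^ 2 + ‖G x‖ ^ 2))⁻¹ * ‖G x‖ ^ 2) atTop
        (𝓝 ((√(0 ^ 2 + ‖G x‖ ^ 2))⁻¹ * ‖G x‖ ^ 2)) := by
      refine Tendsto.mul_const _ (Tendsto.inv₀ ?_ ?_)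
      · exact ((tendsto_one_div_add_atTop_nhds_zero_nat.pow 2).add_const _).sqrt
      · simp [h0]
    have e1 : (√(0 ^ 2 + ‖G x‖ ^ 2))⁻¹ * ‖G x‖ ^ 2 = ‖G x‖ := by
      rw [zero_pow two_ne_zero, zero_add, Real.sqrt_sq hn.le]
      field_simp
    rw [e1] at h1
    refine h1.congr' ?_
    obtain ⟨j0, hj0⟩ := exists_nat_ge ‖x‖
    filter_upwards [eventually_ge_atTop j0] with j hj
    have hχ : χ j x = 1 := (χ j).one_of_mem_closedBall (by
      have : (j0 : ℝ) ≤ j := by exact_mod_cast hj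
      rw [mem_closedBall_zero_iff]
      change ‖x‖ ≤ (j : ℝ) + 1
      linarith)
    simp [hq, hχ]
  calc ∫⁻ x, ‖G x‖ₑ
      = ∫⁻ x, liminf (fun j => ENNReal.ofReal (q j x * ‖G x‖ ^ 2)) atTop :=
        lintegral_congr fun x => (hlim x).liminf_eq.symm
    _ ≤ liminf (fun j => ∫⁻ x, ENNReal.ofReal (q j x * ‖G x‖ ^ 2)) atTop := by
        refine lintegral_liminf_le fun j => ?_
        exact ((hqs j).continuous.mul (hG.continuous.norm.pow 2)).measurable.ennreal_ofReal
    _ ≤ liminf (fun _ : ℕ => variation univ v) atTop :=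
        liminf_le_liminf (Eventually.of_forall hint)
    _ = _ := liminf_const _

theorem lintegral_translate_sub_le_of_smooth {f : Eu → ℝ} (hf : ContDiff ℝ ∞ f) (h : Eu) :
    ∫⁻ x, ‖f (x + h) - f x‖ₑ ≤ ∫⁻ x, ‖inner ℝ (gradient f x) h‖ₑ := by
  have hgm := (continuous_gradient hf).measurable
  calc ∫⁻ x, ‖f (x + h) - f x‖ₑ
      ≤ ∫⁻ x, ∫⁻ t in Ioc (0 : ℝ) 1, ‖inner ℝ (gradient f (x + t • h)) h‖ₑ := by
        refine lintegral_mono fun x => ?_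
        rw [sub_eq_integral_inner_gradient hf]
        exact enorm_integral_le_lintegral_enorm _
    _ = ∫⁻ t in Ioc (0 : ℝ) 1, ∫⁻ x, ‖inner ℝ (gradient f (x + t • h)) h‖ₑ :=
        lintegral_lintegral_swap (by fun_prop)
    _ = ∫⁻ t in Ioc (0 : ℝ) 1, ∫⁻ x, ‖inner ℝ (gradient f x) h‖ₑ := by
        refine lintegral_congr fun t => ?_
        exact lintegral_add_right_eq_self (fun x => ‖inner ℝ (gradient f x) h‖ₑ) (t • h)
    _ = _ := by simp

variable {k : ℕ → ℝ → ℝ≥0∞} {c : ℝ≥0∞}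

/-- The upper bound by the variation on the whole space. -/
theorem ConcentratingKernel.limsup_energy_le_variation (hd : 1 ≤ d)
    (hk : ConcentratingKernel (d - 1) 1 k c) {v : Eu → ℝ} (hvm : Measurable v)
    (hv : ∫⁻ x, ‖v x‖ₑ ≠ ⊤) {e : Eu} (he : ‖e‖ = 1) :
    limsup (fun n => energy 1 (k n) univ univ v) atTop ≤
      c * sphereMoment 1 e * variation univ v := by
  have := finrank_ne_zero_nontrivial hd
  have hk' : ConcentratingKernel (Module.finrank ℝ Eu - 1) 1 k c := by simpa using hk
  have hv1 : ∫⁻ x, ‖v x‖ₑ ^ (1 : ℝ) ≠ ⊤ := by simpa using hv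
  have hvl := LocallyIntegrable.of_lintegral_rpow le_rfl hvm.aestronglyMeasurable hv1
  have hgm (i : ℕ) := (continuous_gradient (contDiff_mollify (bumpSeq Eu i) hvl)).measurable
  set D : ℕ → Eu → ℝ≥0∞ := fun i h =>
    ∫⁻ x, ‖inner ℝ (gradient (mollify (bumpSeq Eu i) v) x) h‖ₑ with hD
  have hDm (i : ℕ) : Measurable (D i) := by
    have hgi := hgm i
    have : Measurable fun z : Eu × Eu =>
      ‖inner ℝ (gradient (mollify (bumpSeq Eu i) v) z.2) z.1‖ₑ := by fun_prop
    exact this.lintegral_prod_right'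
  -- There is no gradient function in the limit, so the homogeneous majorant is a liminf over
  -- mollifications. Fatou is used twice: in `x` to bound the increments by `H`, and on the sphere
  -- to bound the integral of `H`.
  set H : Eu → ℝ≥0∞ := fun h => liminf (fun i => D i h) atTop with hH
  have hHm : Measurable H := Measurable.liminf hDm
  have hHhom (r : ℝ) (x : Eu) (hr : 0 < r) :
      H (r • x) = ENNReal.ofReal r ^ (1 : ℝ) * H x := by
    have e1 (i : ℕ) : D i (r • x) = ENNReal.ofReal r * D i x := by
      simp only [hD]
      rw [← lintegral_const_mul' _ _ ENNReal.ofReal_ne_top]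
      refine lintegral_congr fun y => ?_
      rw [real_inner_smul_right, enorm_mul, Real.enorm_of_nonneg hr.le]
    simp only [hH, e1, ENNReal.rpow_one]
    exact ENNReal.liminf_const_mul_of_ne_top ENNReal.ofReal_ne_top
  have hae := ae_tendsto_mollify_bumpSeq hvl
  have hle (h : Eu) : ∫⁻ x, ‖v (x + h) - v x‖ₑ ≤ H h := by
    have hae2 : ∀ᵐ x, Tendsto (fun i => mollify (bumpSeq Eu i) v (x + h)) atTop
        (𝓝 (v (x + h))) :=
      (measurePreserving_add_right volume h).quasiMeasurePreserving.ae hae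
    calc ∫⁻ x, ‖v (x + h) - v x‖ₑ
        = ∫⁻ x, liminf (fun i => ‖mollify (bumpSeq Eu i) v (x + h) -
            mollify (bumpSeq Eu i) v x‖ₑ) atTop := by
          refine lintegral_congr_ae ?_
          filter_upwards [hae, hae2] with x h1 h2
          exact (h2.sub h1).enorm.liminf_eq.symm
      _ ≤ liminf (fun i => ∫⁻ x, ‖mollify (bumpSeq Eu i) v (x + h) -
            mollify (bumpSeq Eu i) v x‖ₑ) atTop := by
          refine lintegral_liminf_le fun i => ?_
          have := (contDiff_mollify (bumpSeq Eu i) hvl).continuous.measurable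
          fun_prop
      _ ≤ H h := liminf_le_liminf (Eventually.of_forall fun i =>
          lintegral_translate_sub_le_of_smooth (contDiff_mollify _ hvl) h)
  refine (hk'.limsup_energy_le le_rfl hvm hv1 hHm hHhom one_pos (A := univ) fun h _ => by
    simpa using hle h).trans ?_
  rw [mul_assoc]
  refine mul_le_mul_right ?_ _
  have hDi (i : ℕ) : ∫⁻ w : Metric.sphere (0 : Eu) 1, D i w ∂(volume : Measure Eu).toSphere ≤
      sphereMoment 1 e * variation univ v := by
    have hgi := hgm i
    have hm : Measurable fun z : Eu × Eu =>
      ‖inner ℝ (gradient (mollify (bumpSeq Eu i) v) z.2) z.1‖ₑ := by fun_prop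
    calc ∫⁻ w : Metric.sphere (0 : Eu) 1, D i w ∂(volume : Measure Eu).toSphere
        = ∫⁻ x, sphereMoment 1 (gradient (mollify (bumpSeq Eu i) v) x) := by
          simp only [hD]
          rw [lintegral_lintegral_swap]
          · simp only [sphereMoment, real_inner_comm, ENNReal.rpow_one]
          · exact (hm.comp (measurable_subtype_coe.prodMap measurable_id)).aemeasurable
      _ = ∫⁻ x, sphereMoment 1 e * ‖gradient (mollify (bumpSeq Eu i) v) x‖ₑ := by
          refine lintegral_congr fun x => ?_
          rw [sphereMoment_eq one_pos he (gradient _ x), ENNReal.rpow_one, mul_comm]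
      _ = sphereMoment 1 e * ∫⁻ x, ‖gradient (mollify (bumpSeq Eu i) v) x‖ₑ :=
          lintegral_const_mul _ hgi.enorm
      _ ≤ _ := mul_le_mul_right (lintegral_gradient_mollify_le_variation _ hvl) _
  calc ∫⁻ w : Metric.sphere (0 : Eu) 1, H w ∂(volume : Measure Eu).toSphere
      ≤ liminf (fun i => ∫⁻ w : Metric.sphere (0 : Eu) 1, D i w
          ∂(volume : Measure Eu).toSphere) atTop :=
        lintegral_liminf_le fun i => (hDm i).comp measurable_subtype_coe
    _ ≤ liminf (fun _ : ℕ => sphereMoment 1 e * variation univ v) atTop :=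
        liminf_le_liminf (Eventually.of_forall hDi)
    _ = _ := liminf_const _

end BVUpper

/-! ### Subadditivity of the variation on open sets. -/

section Subadditivity

open scoped Manifold

variable {d : ℕ}

local notation "Eu" => EuclideanSpace ℝ (Fin d)

theorem IsTestFunction.mono {F : Type*} [NormedAddCommGroup F] [NormedSpace ℝ F] {A B : Set Eu}
    {φ : Eu → F} (h : IsTestFunction A φ) (hAB : A ⊆ B) : IsTestFunction B φ :=
  ⟨h.1, h.2.1, h.2.2.trans hAB⟩

theorem IsTestFunction.setIntegral_mul_divergence {A : Set Eu} {φ : Eu → Eu}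
    (h : IsTestFunction A φ) (v : Eu → ℝ) :
    ∫ x in A, v x * divergence φ x = ∫ x, v x * divergence φ x :=
  setIntegral_mul_of_support_subset v (support_divergence.trans h.2.2)

theorem variation_mono {A B : Set Eu} (hAB : A ⊆ B) (v : Eu → ℝ) :
    variation A v ≤ variation B v := by
  refine iSup₂_le fun φ hφ => ?_
  rw [hφ.1.setIntegral_mul_divergence, ← (hφ.1.mono hAB).setIntegral_mul_divergence]
  exact le_iSup₂_of_le φ ⟨hφ.1.mono hAB, hφ.2⟩ le_rfl

theorem IsTestFunction.smul_of_eventually_eq_zero {A B : Set Eu} {φ : Eu → Eu} {ζ : Eu → ℝ}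
    (hφ : IsTestFunction B φ) (hζ : ContDiff ℝ ∞ ζ)
    (h0 : ∀ᶠ x in 𝓝ˢ (tsupport φ \ A), ζ x = 0) : IsTestFunction A fun x => ζ x • φ x := by
  have hs : tsupport (fun x => ζ x • φ x) ⊆ tsupport φ := tsupport_smul_subset_right ζ φ
  refine ⟨hζ.smul hφ.1, hφ.2.1.of_isClosed_subset (isClosed_tsupport _) hs, fun x hx => ?_⟩
  by_contra hxA
  have h1 : ∀ᶠ y in 𝓝 x, ζ y = 0 := eventually_nhdsSet_iff_forall.1 h0 x ⟨hs hx, hxA⟩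
  refine notMem_tsupport_iff_eventuallyEq.2 ?_ hx
  filter_upwards [h1] with y hy
  simp [hy]

/-- A smooth partition of unity splits the field: `f` vanishes near the part of the support outside
`A` and equals `1` near the part outside `B`. Since `0 ≤ f ≤ 1`, both pieces are still admissible.
-/
theorem variation_union_le {A B : Set Eu} (hA : IsOpen A) (hB : IsOpen B) {v : Eu → ℝ}
    (hv : LocallyIntegrable v) : variation (A ∪ B) v ≤ variation A v + variation B v := by
  refine iSup₂_le fun φ hφ => ?_
  have hd : Disjoint (tsupport φ \ A) (tsupport φ \ B) := by
    rw [Set.disjoint_left]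
    rintro x ⟨hx, hxA⟩ ⟨-, hxB⟩
    exact (hφ.1.2.2 hx).elim hxA hxB
  obtain ⟨f, hf0, hf1, hf⟩ := exists_contMDiffMap_zero_one_nhds_of_isClosed (n := (⊤ : ℕ∞)) 𝓘(ℝ, Eu)
    ((isClosed_tsupport φ).sdiff hA) ((isClosed_tsupport φ).sdiff hB) hd
  have hfs : ContDiff ℝ ∞ f := f.contMDiff.contDiff
  have h1 : IsTestFunction A fun x => f x • φ x := hφ.1.smul_of_eventually_eq_zero hfs hf0
  have h2 : IsTestFunction B fun x => (1 - f x) • φ x := by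
    refine hφ.1.smul_of_eventually_eq_zero (contDiff_const.sub hfs) ?_
    filter_upwards [hf1] with x hx
    rw [hx, sub_self]
  have hdiv (x : Eu) : divergence φ x =
      divergence (fun x => f x • φ x) x + divergence (fun x => (1 - f x) • φ x) x := by
    simp only [divergence, ← Finset.sum_add_distrib, partialDeriv]
    refine Finset.sum_congr rfl fun i _ => ?_
    have e : φ = fun x => f x • φ x + (1 - f x) • φ x := by
      funext y
      rw [← add_smul, add_sub_cancel, one_smul]
    conv_lhs => rw [e]
    rw [fderiv_fun_add (h1.1.differentiable (by simp) x) (h2.1.differentiable (by simp) x)]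
    rfl
  have hint {C : Set Eu} {ψ : Eu → Eu} (hψ : IsTestFunction C ψ) :
      Integrable fun x => v x * divergence ψ x := by
    rw [← integrableOn_univ]
    exact (hψ.mono (subset_univ _)).integrableOn_divergence (hv.locallyIntegrableOn _)
  rw [hφ.1.setIntegral_mul_divergence]
  simp only [hdiv, mul_add]
  rw [integral_add (hint h1) (hint h2), ← h1.setIntegral_mul_divergence,
    ← h2.setIntegral_mul_divergence]
  have hn {a : ℝ} (ha : a ∈ Icc (0 : ℝ) 1) (x : Eu) : ‖a • φ x‖ ≤ 1 := by
    rw [norm_smul, Real.norm_of_nonneg ha.1]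
    exact mul_le_one₀ ha.2 (norm_nonneg _) (hφ.2 x)
  refine ENNReal.ofReal_add_le.trans (add_le_add ?_ ?_)
  · exact le_iSup₂_of_le (fun x => f x • φ x) ⟨h1, fun x => hn (hf x) x⟩ le_rfl
  · exact le_iSup₂_of_le (fun x => (1 - f x) • φ x)
      ⟨h2, fun x => hn ⟨sub_nonneg.2 (hf x).2, sub_le_self _ (hf x).1⟩ x⟩ le_rfl

/-- If the total variation measure does not charge `∂Ω`, the variation on the whole space splits
into the variations on the interior and the exterior. -/
theorem variation_univ_le_of_variationMeasure_frontier {Ω : Set Eu} (hΩ : IsOpen Ω) {v : Eu → ℝ}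
    (hv : LocallyIntegrable v) (h0 : variationMeasure v (frontier Ω) = 0) :
    variation univ v ≤ variation Ω v + variation (closure Ω)ᶜ v := by
  refine ENNReal.le_of_forall_pos_le_add fun ε hε _ => ?_
  have hlt : variationMeasure v (frontier Ω) < ε := by
    rw [h0]
    exact_mod_cast hε
  -- A null frontier has an open neighbourhood `U` of variation less than `ε`; together with `Ω` and
  -- its exterior it covers the space.
  simp only [variationMeasure, iInf_lt_iff] at hlt
  obtain ⟨U, ⟨hU, hfU⟩, hlt⟩ := hlt
  have hW : IsOpen (closure Ω)ᶜ := isClosed_closure.isOpen_compl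
  have hcov : (univ : Set Eu) ⊆ (Ω ∪ (closure Ω)ᶜ) ∪ U := by
    intro x _
    by_cases h1 : x ∈ Ω
    · exact Or.inl (Or.inl h1)
    by_cases h2 : x ∈ closure Ω
    · exact Or.inr (hfU (by rw [hΩ.frontier_eq]; exact ⟨h2, h1⟩))
    · exact Or.inl (Or.inr h2)
  calc variation univ v ≤ variation ((Ω ∪ (closure Ω)ᶜ) ∪ U) v := variation_mono hcov v
    _ ≤ variation (Ω ∪ (closure Ω)ᶜ) v + variation U v := variation_union_le (hΩ.union hW) hU hv
    _ ≤ variation Ω v + variation (closure Ω)ᶜ v + ε :=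
        add_le_add (variation_union_le hΩ hW hv) hlt.le

end Subadditivity

/-! ### Extension, localization to `Ω` and the convergence theorem. -/

section Limit

variable {d : ℕ}

local notation "Eu" => EuclideanSpace ℝ (Fin d)

/-- Below its limsup `a` is exceeded frequently, below its liminf `b` is exceeded eventually, and
the two occur together frequently. The zero cases are separate because there is no number strictly
below `0`. -/
theorem limsup_add_liminf_le (a b : ℕ → ℝ≥0∞) :
    limsup a atTop + liminf b atTop ≤ limsup (fun n => a n + b n) atTop := by
  rcases eq_or_ne (limsup a atTop) 0 with ha | ha
  · rw [ha, zero_add]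
    exact (liminf_le_limsup).trans (limsup_le_limsup (Eventually.of_forall fun n => le_add_self))
  rcases eq_or_ne (liminf b atTop) 0 with hb | hb
  · rw [hb, add_zero]
    exact limsup_le_limsup (Eventually.of_forall fun n => le_self_add)
  refine le_of_forall_lt fun t ht => ?_
  obtain ⟨r, hr, q, hq, hrq⟩ := ENNReal.exists_lt_add_of_lt_add ht ha hb
  refine hrq.trans_le (le_limsup_of_frequently_le ?_)
  exact ((frequently_lt_of_lt_limsup (by isBoundedDefault) hr).and_eventually
    (eventually_lt_of_lt_liminf hq)).mono fun n hn => add_le_add hn.1.le hn.2.le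

theorem HasWeakGradient.mono {A B : Set Eu} (hAB : A ⊆ B) {u : Eu → ℝ} {g : Eu → Eu}
    (h : HasWeakGradient B u g) : HasWeakGradient A u g := by
  refine ⟨h.1.mono_set hAB, h.2.1.mono_set hAB, fun φ hφ i => ?_⟩
  have h1 := h.2.2 φ ⟨hφ.1, hφ.2.1, hφ.2.2.trans hAB⟩ i
  have h2 : Function.support (partialDeriv i φ) ⊆ A := (support_partialDeriv i).trans hφ.2.2
  have h3 : Function.support φ ⊆ A := (subset_tsupport φ).trans hφ.2.2
  rwa [setIntegral_mul_of_support_subset _ (h2.trans hAB),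
    setIntegral_mul_of_support_subset _ (h3.trans hAB),
    ← setIntegral_mul_of_support_subset _ h2, ← setIntegral_mul_of_support_subset _ h3] at h1

theorem HasWeakGradient.congr_gradient {A : Set Eu} {u : Eu → ℝ} {g g' : Eu → Eu}
    (h : HasWeakGradient A u g) (hg : g =ᵐ[volume.restrict A] g') : HasWeakGradient A u g' := by
  refine ⟨h.1, h.2.1.congr hg, fun φ hφ i => ?_⟩
  rw [h.2.2 φ hφ i]
  congr 1
  refine integral_congr_ae ?_
  filter_upwards [hg] with x hx
  rw [hx]

theorem gradNormPow_eq {Ω : Set Eu} (hΩ : IsOpen Ω) (p : ℝ) {u : Eu → ℝ} {g : Eu → Eu}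
    (h : HasWeakGradient Ω u g) : gradNormPow Ω p u = ∫⁻ x in Ω, ‖g x‖ₑ ^ p := by
  refine le_antisymm (iInf₂_le g h) (le_iInf₂ fun g' h' => le_of_eq ?_)
  refine lintegral_congr_ae ?_
  filter_upwards [h.ae_eq hΩ h'] with x hx
  rw [hx]

theorem gradNormPow_congr {Ω : Set Eu} (p : ℝ) {u v : Eu → ℝ} (h : u =ᵐ[volume.restrict Ω] v) :
    gradNormPow Ω p u = gradNormPow Ω p v := by
  unfold gradNormPow
  refine iInf_congr fun g => ?_
  have : HasWeakGradient Ω u g ↔ HasWeakGradient Ω v g :=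
    ⟨fun k => k.congr h, fun k => k.congr h.symm⟩
  simp only [this]

theorem lintegral_rpow_ne_top_of_memLp {X F : Type*} [MeasurableSpace X] {μ : Measure X}
    [NormedAddCommGroup F] {p : ℝ} (hp : 1 ≤ p) {f : X → F} (hf : MemLp f (ENNReal.ofReal p) μ) :
    ∫⁻ x, ‖f x‖ₑ ^ p ∂μ ≠ ⊤ := by
  have hp0 : 0 < p := by linarith
  have := lintegral_rpow_enorm_lt_top_of_eLpNorm_lt_top (by simpa using hp0)
    ENNReal.ofReal_ne_top hf.2
  rw [ENNReal.toReal_ofReal hp0.le] at this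
  exact this.ne

variable {p : ℝ} {k : ℕ → ℝ → ℝ≥0∞} {c : ℝ≥0∞}

/-- The energies of `Ω` and of its exterior together stay below that of the whole space, whose
limsup is at most the constant times the variations on the two sets. The exterior already uses up
its own share by the lower bound; this share is finite and cancels. -/
theorem ConcentratingKernel.limsup_energy_le_variation_of_frontier (hd : 1 ≤ d)
    (hk : ConcentratingKernel (d - 1) 1 k c) {Ω : Set Eu} (hΩ : IsOpen Ω) {v : Eu → ℝ}
    (hvm : Measurable v) (hv : ∫⁻ x, ‖v x‖ₑ ≠ ⊤) (hvar : variation univ v ≠ ⊤)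
    (h0 : variationMeasure v (frontier Ω) = 0) {e : Eu} (he : ‖e‖ = 1) :
    limsup (fun n => energy 1 (k n) Ω Ω v) atTop ≤ c * sphereMoment 1 e * variation Ω v := by
  have hvl : LocallyIntegrable v :=
    LocallyIntegrable.of_lintegral_rpow le_rfl hvm.aestronglyMeasurable (by simpa using hv)
  have hW : IsOpen (closure Ω)ᶜ := isClosed_closure.isOpen_compl
  set M := c * sphereMoment 1 e
  have hM : M ≠ ⊤ := ENNReal.mul_ne_top hk.ne_top (sphereMoment_lt_top zero_le_one e).ne
  have hfin : M * variation (closure Ω)ᶜ v ≠ ⊤ :=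
    ENNReal.mul_ne_top hM ((variation_mono (subset_univ _) v).trans_lt hvar.lt_top).ne
  refine (ENNReal.add_le_add_iff_right hfin).1 ?_
  calc limsup (fun n => energy 1 (k n) Ω Ω v) atTop + M * variation (closure Ω)ᶜ v
      ≤ limsup (fun n => energy 1 (k n) Ω Ω v) atTop +
          liminf (fun n => energy 1 (k n) (closure Ω)ᶜ (closure Ω)ᶜ v) atTop := by
        gcongr
        exact hk.variation_le_liminf_energy hd hvl hvm hW he
    _ ≤ limsup (fun n => energy 1 (k n) Ω Ω v +
          energy 1 (k n) (closure Ω)ᶜ (closure Ω)ᶜ v) atTop := limsup_add_liminf_le _ _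
    _ ≤ limsup (fun n => energy 1 (k n) univ univ v) atTop :=
        limsup_le_limsup (Eventually.of_forall fun n => energy_add_le_energy_univ v hW.measurableSet
          (disjoint_compl_right.mono_left subset_closure))
    _ ≤ M * variation univ v := hk.limsup_energy_le_variation hd hvm hv he
    _ ≤ M * (variation Ω v + variation (closure Ω)ᶜ v) := by
        gcongr
        exact variation_univ_le_of_variationMeasure_frontier hΩ hvl h0
    _ = _ := mul_add _ _ _

/-- Letting `y` run over the whole space only enlarges the energy, and the Sobolev upper bound sees
the gradient only where `x` ranges. Hence no condition on the frontier is needed. -/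
theorem ConcentratingKernel.limsup_energy_le_gradNormPow (hd : 1 ≤ d) (hp : 1 ≤ p)
    (hk : ConcentratingKernel (d - 1) p k c) {Ω : Set Eu} (hΩ : IsOpen Ω) {v : Eu → ℝ}
    (hvm : Measurable v) (hv : MemSobolev univ p v) {e : Eu} (he : ‖e‖ = 1) :
    limsup (fun n => energy p (k n) Ω Ω v) atTop ≤ c * sphereMoment p e * gradNormPow Ω p v := by
  obtain ⟨hvp, g, hg, hgp⟩ := hv
  rw [Measure.restrict_univ] at hvp hgp
  have hgm : g =ᵐ[volume.restrict univ] hgp.1.mk g := by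
    rw [Measure.restrict_univ]
    exact hgp.1.ae_eq_mk
  have hg' := hg.congr_gradient hgm
  have hgp' : ∫⁻ x, ‖hgp.1.mk g x‖ₑ ^ p ≠ ⊤ := by
    rw [Measure.restrict_univ] at hgm
    exact lintegral_rpow_ne_top_of_memLp hp (hgp.ae_eq hgm)
  rw [gradNormPow_eq hΩ p (hg'.mono (subset_univ Ω))]
  refine le_trans (limsup_le_limsup (Eventually.of_forall fun n => ?_))
    (hk.limsup_energy_le_of_hasWeakGradient hd hp hvm (lintegral_rpow_ne_top_of_memLp hp hvp)
      hgp.1.stronglyMeasurable_mk.measurable hgp' hg' Ω he)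
  exact energy_mono v le_rfl (subset_univ _)

theorem IsSobolevExtensionDomain.exists_extension {Ω : Set Eu}
    (hΩ : IsSobolevExtensionDomain Ω p) {u : Eu → ℝ} (hu : MemSobolev Ω p u) :
    ∃ v : Eu → ℝ, Measurable v ∧ MemSobolev univ p v ∧ v =ᵐ[volume.restrict Ω] u := by
  obtain ⟨-, E, C, hE⟩ := hΩ
  obtain ⟨hup, g, hg, hgp⟩ := hu
  have hU : MemSobolev Ω p (hup.toLp u) :=
    ⟨Lp.memLp _, g, hg.congr hup.coeFn_toLp.symm, hgp⟩
  exact ⟨(E ⟨hup.toLp u, hU⟩).1, (Lp.stronglyMeasurable _).measurable, (E ⟨hup.toLp u, hU⟩).2,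
    (hE ⟨hup.toLp u, hU⟩).1.trans hup.coeFn_toLp⟩

theorem IsBVExtensionDomain.exists_extension {Ω : Set Eu} (hΩ : IsBVExtensionDomain Ω)
    {u : Eu → ℝ} (hu : MemBV Ω u) :
    ∃ v : Eu → ℝ, Measurable v ∧ MemBV univ v ∧ v =ᵐ[volume.restrict Ω] u ∧
      variationMeasure v (frontier Ω) = 0 := by
  obtain ⟨-, E, C, hE⟩ := hΩ
  have hU : MemBV Ω (hu.1.toLp u) :=
    ⟨Lp.memLp _, (variation_congr hu.1.coeFn_toLp).trans_lt hu.2⟩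
  exact ⟨(E ⟨hu.1.toLp u, hU⟩).1, (Lp.stronglyMeasurable _).measurable, (E ⟨hu.1.toLp u, hU⟩).2,
    (hE ⟨hu.1.toLp u, hU⟩).1.trans hu.1.coeFn_toLp, (hE ⟨hu.1.toLp u, hU⟩).2.2⟩

/-- A function in `L^p(Ω)` agrees on `Ω` with a Borel function in `L^p(ℝ^d)`. -/
theorem exists_measurable_locallyIntegrable (hp : 1 ≤ p) {Ω : Set Eu} (hΩ : IsOpen Ω) {u : Eu → ℝ}
    (hu : MemLp u (ENNReal.ofReal p) (volume.restrict Ω)) :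
    ∃ v : Eu → ℝ, Measurable v ∧ LocallyIntegrable v ∧ v =ᵐ[volume.restrict Ω] u := by
  have hm : Measurable (hu.1.mk u) := hu.1.stronglyMeasurable_mk.measurable
  have hae : Ω.indicator (hu.1.mk u) =ᵐ[volume.restrict Ω] u :=
    (indicator_ae_eq_restrict hΩ.measurableSet).trans hu.1.ae_eq_mk.symm
  have hp0 : 0 < p := by linarith
  refine ⟨Ω.indicator (hu.1.mk u), hm.indicator hΩ.measurableSet, ?_, hae⟩
  refine LocallyIntegrable.of_lintegral_rpow hp
    (hm.indicator hΩ.measurableSet).aestronglyMeasurable ?_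
  have e1 : (fun x => ‖Ω.indicator (hu.1.mk u) x‖ₑ ^ p) =
      Ω.indicator fun x => ‖hu.1.mk u x‖ₑ ^ p := by
    funext x
    by_cases hx : x ∈ Ω <;> simp [hx, hp0]
  rw [e1, lintegral_indicator hΩ.measurableSet]
  exact lintegral_rpow_ne_top_of_memLp hp (hu.ae_eq hu.1.ae_eq_mk)

/-- The nonlocal energies with concentrating kernels converge to the local energy. -/
theorem ConcentratingKernel.tendsto_energy (hd : 1 ≤ d) (hp : 1 ≤ p)
    (hk : ConcentratingKernel (d - 1) p k c) {Ω : Set Eu} {u : Eu → ℝ}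
    (hu : MemLp u (ENNReal.ofReal p) (volume.restrict Ω)) {e : Eu} (he : ‖e‖ = 1) {G : ℝ≥0∞}
    (hG : (IsSobolevExtensionDomain Ω p ∧ (1 < p ∨ MemSobolev Ω p u) ∧ G = gradNormPow Ω p u) ∨
        (IsBVExtensionDomain Ω ∧ p = 1 ∧ G = variation Ω u)) :
    Tendsto (fun n => energy p (k n) Ω Ω u) atTop (𝓝 (c * sphereMoment p e * G)) := by
  have := finrank_ne_zero_nontrivial hd
  have hΩ : IsOpen Ω := hG.elim (fun h => h.1.1) fun h => h.1.1
  have hM : c * sphereMoment p e ≠ 0 :=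
    mul_ne_zero hk.ne_zero (sphereMoment_ne_zero (by linarith) he)
  obtain ⟨U, hUm, hUl, hUu⟩ := exists_measurable_locallyIntegrable hp hΩ hu
  have hen {v : Eu → ℝ} (hv : v =ᵐ[volume.restrict Ω] u) :
      (fun n => energy p (k n) Ω Ω u) = fun n => energy p (k n) Ω Ω v :=
    funext fun n => energy_congr hv.symm hv.symm
  refine tendsto_of_le_liminf_of_limsup_le ?_ ?_
  · rw [hen hUu]
    rcases hG with ⟨-, hpu, rfl⟩ | ⟨-, rfl, rfl⟩
    -- An infinite liminf leaves nothing to prove. Otherwise a weak gradient exists, by weak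
    -- compactness if `p > 1` and by assumption if not; it need not be known to lie in `L^p`.
    · rcases eq_or_ne (liminf (fun n => energy p (k n) Ω Ω U) atTop) ⊤ with htop | hfin
      · rw [htop]
        exact le_top
      obtain ⟨g, hg⟩ : ∃ g, HasWeakGradient Ω U g := by
        rcases hpu with h1 | ⟨-, g, hg, -⟩
        · exact hk.exists_hasWeakGradient hd h1 hUl hUm hΩ hfin
        · exact ⟨g, hg.congr hUu.symm⟩
      rw [← gradNormPow_congr p hUu, gradNormPow_eq hΩ p hg]
      exact hk.lintegral_weakGradient_le_liminf_energy hd hp hUl hUm hΩ hg he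
    · rw [← variation_congr hUu]
      exact hk.variation_le_liminf_energy hd hUl hUm hΩ he
  -- If `G = ∞` the upper bound is void because the constant is nonzero. If `G` is finite, then `u`
  -- lies in the space from which the extension operator acts.
  · rcases eq_or_ne G ⊤ with rfl | hGt
    · rw [ENNReal.mul_top hM]
      exact le_top
    rcases hG with ⟨hext, -, rfl⟩ | ⟨hext, rfl, rfl⟩
    · obtain ⟨g, hg, hgt⟩ : ∃ g, HasWeakGradient Ω u g ∧ ∫⁻ x in Ω, ‖g x‖ₑ ^ p < ⊤ := by
        simpa only [gradNormPow, iInf_lt_iff, exists_prop] using hGt.lt_top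
      have hp0 : 0 < p := by linarith
      have hgp : MemLp g (ENNReal.ofReal p) (volume.restrict Ω) := by
        refine ⟨hg.2.1.aestronglyMeasurable, ?_⟩
        rw [eLpNorm_lt_top_iff_lintegral_rpow_enorm_lt_top (by simpa using hp0)
          ENNReal.ofReal_ne_top, ENNReal.toReal_ofReal hp0.le]
        exact hgt
      obtain ⟨v, hvm, hv, hvu⟩ := hext.exists_extension ⟨hu, g, hg, hgp⟩
      rw [hen hvu, ← gradNormPow_congr p hvu]
      exact hk.limsup_energy_le_gradNormPow hd hp hΩ hvm hv he
    · rw [ENNReal.ofReal_one] at hu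
      obtain ⟨v, hvm, ⟨hv1, hv2⟩, hvu, hv0⟩ := hext.exists_extension ⟨hu, hGt.lt_top⟩
      rw [hen hvu, ← variation_congr hvu]
      rw [Measure.restrict_univ] at hv1
      have h1 := lintegral_rpow_ne_top_of_memLp le_rfl (p := 1) (by simpa using hv1)
      exact hk.limsup_energy_le_variation_of_frontier hd hΩ hvm (by simpa using h1) hv2.ne hv0 he

end Limit

/-! ### The three kernels of the theorem. -/

section Kernels

theorem setLIntegral_Ioo_zero_rpow {a δ : ℝ} (ha : 0 < a) (hδ : 0 < δ) :
    ∫⁻ r in Ioo 0 δ, ENNReal.ofReal (r ^ (a - 1)) = ENNReal.ofReal (δ ^ a / a) := by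
  have h1 : IntegrableOn (fun r : ℝ => r ^ (a - 1)) (Ioc 0 δ) :=
    (intervalIntegrable_iff_integrableOn_Ioc_of_le hδ.le).1
      (intervalIntegral.intervalIntegrable_rpow' (by linarith))
  rw [restrict_Ioo_eq_restrict_Ioc, ← ofReal_integral_eq_lintegral_ofReal h1]
  · rw [← intervalIntegral.integral_of_le hδ.le, integral_rpow (Or.inl (by linarith)),
      sub_add_cancel, Real.zero_rpow ha.ne', sub_zero]
  · filter_upwards [ae_restrict_mem measurableSet_Ioc] with r hr
    exact Real.rpow_nonneg hr.1.le _

theorem setLIntegral_Ici_rpow {a δ : ℝ} (ha : 0 < a) (hδ : 0 < δ) :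
    ∫⁻ r in Ici δ, ENNReal.ofReal (r ^ (-1 - a)) = ENNReal.ofReal (δ ^ (-a) / a) := by
  rw [← restrict_Ioi_eq_restrict_Ici, ← ofReal_integral_eq_lintegral_ofReal
    (integrableOn_Ioi_rpow_of_lt (by linarith) hδ)]
  · rw [integral_Ioi_rpow_of_lt (by linarith) hδ, show -1 - a + 1 = -a by ring, neg_div_neg_eq]
  · filter_upwards [ae_restrict_mem measurableSet_Ioi] with r hr
    exact Real.rpow_nonneg (hδ.trans hr).le _

theorem setLIntegral_Ioo_rpow_neg_one {ε δ : ℝ} (hε : 0 < ε) (h : ε ≤ δ) :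
    ∫⁻ r in Ioo ε δ, ENNReal.ofReal (r ^ (-1 : ℝ)) = ENNReal.ofReal (Real.log δ - Real.log ε) := by
  have h1 : IntegrableOn (fun r : ℝ => r ^ (-1 : ℝ)) (Ioc ε δ) :=
    (ContinuousOn.integrableOn_Icc fun r hr => (Real.continuousAt_rpow_const r _
      (Or.inl (hε.trans_le hr.1).ne')).continuousWithinAt).mono_set Ioc_subset_Icc_self
  rw [restrict_Ioo_eq_restrict_Ioc, ← ofReal_integral_eq_lintegral_ofReal h1]
  · rw [← intervalIntegral.integral_of_le h]
    simp only [Real.rpow_neg_one]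
    rw [integral_inv_of_pos hε (hε.trans_le h), Real.log_div (hε.trans_le h).ne' hε.ne']
  · filter_upwards [ae_restrict_mem measurableSet_Ioc] with r hr
    exact Real.rpow_nonneg (hε.trans hr.1).le _

/-- The kernel `C r^{-q}`, truncated to `r ∈ S`. -/
noncomputable def powerKernel (C : ℝ≥0∞) (S : Set ℝ) (q r : ℝ) : ℝ≥0∞ :=
  C * S.indicator (fun r => (ENNReal.ofReal r ^ q)⁻¹) r

theorem measurable_powerKernel (C : ℝ≥0∞) {S : Set ℝ} (hS : MeasurableSet S) (q : ℝ) :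
    Measurable (powerKernel C S q) :=
  (Measurable.indicator (by fun_prop) hS).const_mul C

theorem setLIntegral_powerKernel_mul_rpow {C : ℝ≥0∞} {S A : Set ℝ}
    (hS : MeasurableSet S) (hA : MeasurableSet A) (hA0 : A ⊆ Ioi 0) (m : ℕ) (q p : ℝ) :
    ∫⁻ r in A, ENNReal.ofReal (r ^ m) * (powerKernel C S q r * ENNReal.ofReal r ^ p) =
      C * ∫⁻ r in S ∩ A, ENNReal.ofReal (r ^ (m - q + p)) := by
  rw [← lintegral_const_mul _ (by fun_prop), ← Measure.restrict_restrict hS,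
    ← lintegral_indicator hS]
  refine setLIntegral_congr_fun hA fun r hr => ?_
  have hr0 : 0 < r := hA0 hr
  by_cases hrS : r ∈ S
  · have e : ENNReal.ofReal (r ^ (m - q + p)) =
        ENNReal.ofReal (r ^ m) * ((ENNReal.ofReal r ^ q)⁻¹ * ENNReal.ofReal r ^ p) := by
      rw [← ENNReal.rpow_neg, ENNReal.ofReal_rpow_of_pos hr0, ENNReal.ofReal_rpow_of_pos hr0,
        ← ENNReal.ofReal_mul (by positivity), ← ENNReal.ofReal_mul (by positivity),
        ← Real.rpow_add hr0, ← Real.rpow_natCast, ← Real.rpow_add hr0]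
      congr 2
      ring
    simp only [powerKernel, indicator_of_mem hrS, e]
    ring
  · simp [powerKernel, hrS]

theorem setLIntegral_powerKernel {C : ℝ≥0∞} {S A : Set ℝ}
    (hS : MeasurableSet S) (hA : MeasurableSet A) (hA0 : A ⊆ Ioi 0) (m : ℕ) (q : ℝ) :
    ∫⁻ r in A, ENNReal.ofReal (r ^ m) * powerKernel C S q r =
      C * ∫⁻ r in S ∩ A, ENNReal.ofReal (r ^ (m - q)) := by
  simpa using setLIntegral_powerKernel_mul_rpow (C := C) hS hA hA0 m q 0

theorem Ici_subset_Ioi_zero {δ : ℝ} (hδ : 0 < δ) : Ici δ ⊆ Ioi 0 := fun _ hr => hδ.trans_le hr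

variable {d : ℕ} {p : ℝ}

/-- Near the origin, `(1-s) ∫_0^δ r^(p(1-s)-1) dr = δ^(p(1-s)) / p → 1/p`. Away from it, the factor
`1-s` multiplies the bounded quantity `δ^(-sp) / (sp)`. -/
theorem concentratingKernel_fractional (hd : 1 ≤ d) (hp : 1 ≤ p) {s : ℕ → ℝ}
    (hs : Tendsto s atTop (𝓝[<] 1)) :
    ConcentratingKernel (d - 1) p
      (fun n => powerKernel (ENNReal.ofReal (1 - s n)) univ (d + s n * p))
      (ENNReal.ofReal p)⁻¹ := by
  have hp0 : 0 < p := by linarith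
  have hm : ((d - 1 : ℕ) : ℝ) = d - 1 := by push_cast [Nat.cast_sub hd]; ring
  have hs1 : Tendsto s atTop (𝓝 1) := hs.mono_right nhdsWithin_le_nhds
  have hlt : ∀ᶠ n in atTop, s n < 1 := hs self_mem_nhdsWithin
  have hgt : ∀ᶠ n in atTop, 0 < s n := hs1.eventually (lt_mem_nhds one_pos)
  refine ⟨fun n => measurable_powerKernel _ .univ _, fun δ hδ => ?_, fun δ hδ => ?_,
    by simp, by simpa using hp0⟩
  · have h : Tendsto (fun n => ENNReal.ofReal (δ ^ (p * (1 - s n)) / p)) atTop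
        (𝓝 (ENNReal.ofReal (δ ^ (p * (1 - 1)) / p))) := by
      refine ENNReal.tendsto_ofReal (Tendsto.div_const ?_ p)
      exact tendsto_const_nhds.rpow ((tendsto_const_nhds.sub hs1).const_mul p) (Or.inl hδ.ne')
    rw [sub_self, mul_zero, Real.rpow_zero, one_div, ENNReal.ofReal_inv_of_pos hp0] at h
    refine h.congr' ?_
    filter_upwards [hlt] with n hn
    have h1 : 0 < 1 - s n := by linarith
    rw [setLIntegral_powerKernel_mul_rpow .univ measurableSet_Ioo Ioo_subset_Ioi_self, univ_inter,
      hm, show (d : ℝ) - 1 - (d + s n * p) + p = p * (1 - s n) - 1 by ring,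
      setLIntegral_Ioo_zero_rpow (mul_pos hp0 h1) hδ, ← ENNReal.ofReal_mul h1.le]
    congr 1
    field_simp
  · have h : Tendsto (fun n => ENNReal.ofReal ((1 - s n) * (δ ^ (-(s n * p)) / (s n * p)))) atTop
        (𝓝 (ENNReal.ofReal ((1 - 1) * (δ ^ (-(1 * p)) / (1 * p))))) := by
      refine ENNReal.tendsto_ofReal ((tendsto_const_nhds.sub hs1).mul (Tendsto.div ?_
        (hs1.mul_const p) (by simpa using hp0.ne')))
      exact tendsto_const_nhds.rpow (hs1.mul_const p).neg (Or.inl hδ.ne')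
    rw [sub_self, zero_mul, ENNReal.ofReal_zero] at h
    refine h.congr' ?_
    filter_upwards [hlt, hgt] with n hn hn0
    rw [setLIntegral_powerKernel .univ measurableSet_Ici (Ici_subset_Ioi_zero hδ), univ_inter,
      hm, show (d : ℝ) - 1 - (d + s n * p) = -1 - s n * p by ring,
      setLIntegral_Ici_rpow (mul_pos hn0 hp0) hδ, ← ENNReal.ofReal_mul (by linarith)]

/-- Once `ε < δ`, the near mass is exactly `ε^(-d) ∫_0^ε r^(d-1) dr = 1/d` and the far mass is `0`.
-/
theorem concentratingKernel_ball (hd : 1 ≤ d) {ε : ℕ → ℝ} (hε : Tendsto ε atTop (𝓝[>] 0)) :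
    ConcentratingKernel (d - 1) p
      (fun n => powerKernel (ENNReal.ofReal (ε n) ^ d)⁻¹ (Iio (ε n)) p) (d : ℝ≥0∞)⁻¹ := by
  have hd0 : (0 : ℝ) < d := by exact_mod_cast hd
  have hm : ((d - 1 : ℕ) : ℝ) = d - 1 := by push_cast [Nat.cast_sub hd]; ring
  have hε0 : Tendsto ε atTop (𝓝 0) := hε.mono_right nhdsWithin_le_nhds
  have hgt : ∀ᶠ n in atTop, 0 < ε n := hε self_mem_nhdsWithin
  refine ⟨fun n => measurable_powerKernel _ measurableSet_Iio _, fun δ hδ => ?_, fun δ hδ => ?_,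
    by simp, by simpa using (by omega : d ≠ 0)⟩
  · refine tendsto_const_nhds.congr' ?_
    filter_upwards [hgt, hε0.eventually (gt_mem_nhds hδ)] with n hn hnδ
    have e : Iio (ε n) ∩ Ioo 0 δ = Ioo 0 (ε n) := by
      ext r
      simp only [mem_inter_iff, mem_Iio, mem_Ioo]
      exact ⟨fun h => ⟨h.2.1, h.1⟩, fun h => ⟨h.2, h.1, h.2.trans hnδ⟩⟩
    rw [setLIntegral_powerKernel_mul_rpow measurableSet_Iio measurableSet_Ioo Ioo_subset_Ioi_self,
      e, hm, show (d : ℝ) - 1 - p + p = d - 1 by ring, setLIntegral_Ioo_zero_rpow hd0 hn,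
      Real.rpow_natCast, ENNReal.ofReal_div_of_pos hd0, ENNReal.ofReal_pow hn.le,
      ENNReal.ofReal_natCast, div_eq_mul_inv, ← mul_assoc, ENNReal.inv_mul_cancel, one_mul]
    · simpa using fun h : ε n ≤ 0 => absurd h hn.not_ge
    · exact ENNReal.pow_ne_top ENNReal.ofReal_ne_top
  · refine tendsto_const_nhds.congr' ?_
    filter_upwards [hε0.eventually (gt_mem_nhds hδ)] with n hnδ
    have e : Iio (ε n) ∩ Ici δ = ∅ := by
      ext r
      simp only [mem_inter_iff, mem_Iio, mem_Ici, mem_empty_iff_false, iff_false, not_and, not_le]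
      exact fun h => h.trans hnδ
    rw [setLIntegral_powerKernel measurableSet_Iio measurableSet_Ici (Ici_subset_Ioi_zero hδ), e]
    simp

/-- The near mass is `(log δ - log ε) / |log ε| → 1`. The far mass is at most the fixed number
`δ^(-p) / p` divided by `|log ε|`. -/
theorem concentratingKernel_log (hd : 1 ≤ d) (hp : 1 ≤ p) {ε : ℕ → ℝ}
    (hε : Tendsto ε atTop (𝓝[>] 0)) :
    ConcentratingKernel (d - 1) p
      (fun n => powerKernel (ENNReal.ofReal |Real.log (ε n)|)⁻¹ (Ioi (ε n)) (d + p)) 1 := by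
  have hp0 : 0 < p := by linarith
  have hm : ((d - 1 : ℕ) : ℝ) = d - 1 := by push_cast [Nat.cast_sub hd]; ring
  have hε0 : Tendsto ε atTop (𝓝 0) := hε.mono_right nhdsWithin_le_nhds
  have hgt : ∀ᶠ n in atTop, 0 < ε n := hε self_mem_nhdsWithin
  have hlog : Tendsto (fun n => Real.log (ε n)) atTop atBot :=
    Real.tendsto_log_nhdsGT_zero.comp hε
  refine ⟨fun n => measurable_powerKernel _ measurableSet_Ioi _, fun δ hδ => ?_, fun δ hδ => ?_,
    one_ne_zero, ENNReal.one_ne_top⟩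
  · have h : Tendsto (fun n => ENNReal.ofReal (1 - Real.log δ * (Real.log (ε n))⁻¹)) atTop
        (𝓝 (ENNReal.ofReal (1 - Real.log δ * 0))) :=
      ENNReal.tendsto_ofReal (tendsto_const_nhds.sub
        ((tendsto_inv_atBot_zero.comp hlog).const_mul _))
    rw [mul_zero, sub_zero, ENNReal.ofReal_one] at h
    refine h.congr' ?_
    filter_upwards [hgt, hε0.eventually (gt_mem_nhds hδ), hlog.eventually (eventually_lt_atBot 0)]
      with n hn hnδ hneg
    have e : Ioi (ε n) ∩ Ioo 0 δ = Ioo (ε n) δ := by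
      ext r
      simp only [mem_inter_iff, mem_Ioi, mem_Ioo]
      exact ⟨fun h => ⟨h.1, h.2.2⟩, fun h => ⟨h.1, hn.trans h.1, h.2⟩⟩
    rw [setLIntegral_powerKernel_mul_rpow measurableSet_Ioi measurableSet_Ioo Ioo_subset_Ioi_self,
      e, hm, show (d : ℝ) - 1 - (d + p) + p = -1 by ring, setLIntegral_Ioo_rpow_neg_one hn hnδ.le,
      abs_of_neg hneg, ← ENNReal.ofReal_inv_of_pos (by linarith),
      ← ENNReal.ofReal_mul (inv_nonneg.2 (by linarith))]
    congr 1
    have := hneg.ne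
    field_simp
    ring
  · have h : Tendsto (fun n => (ENNReal.ofReal |Real.log (ε n)|)⁻¹ *
        ENNReal.ofReal (δ ^ (-p) / p)) atTop (𝓝 (0 * ENNReal.ofReal (δ ^ (-p) / p))) := by
      refine ENNReal.Tendsto.mul_const ?_ (Or.inr ENNReal.ofReal_ne_top)
      rw [← ENNReal.inv_top, tendsto_inv_iff]
      exact ENNReal.tendsto_ofReal_atTop.comp (tendsto_abs_atBot_atTop.comp hlog)
    rw [zero_mul] at h
    refine tendsto_of_tendsto_of_tendsto_of_le_of_le tendsto_const_nhds h (fun _ => zero_le)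
      fun n => ?_
    dsimp only
    rw [setLIntegral_powerKernel measurableSet_Ioi measurableSet_Ici (Ici_subset_Ioi_zero hδ), hm,
      show (d : ℝ) - 1 - (d + p) = -1 - p by ring, ← setLIntegral_Ici_rpow hp0 hδ]
    gcongr
    exact inter_subset_right

local notation "Eu" => EuclideanSpace ℝ (Fin d)

theorem energy_powerKernel {C : ℝ≥0∞} (hC : C ≠ ⊤) {S : Set ℝ} (hS : MeasurableSet S) (p q : ℝ)
    (A B : Set Eu) (u : Eu → ℝ) :
    energy p (powerKernel C S q) A B u =
      C * ∫⁻ x in A, ∫⁻ y in B ∩ {y | ‖x - y‖ ∈ S}, ‖u x - u y‖ₑ ^ p / ‖x - y‖ₑ ^ q := by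
  rw [energy, ← lintegral_const_mul' _ _ hC]
  refine lintegral_congr fun x => ?_
  have hm : MeasurableSet {y : Eu | ‖x - y‖ ∈ S} :=
    (by fun_prop : Measurable fun y : Eu => ‖x - y‖) hS
  rw [← lintegral_const_mul' _ _ hC, inter_comm, ← Measure.restrict_restrict hm,
    ← lintegral_indicator hm]
  refine lintegral_congr fun y => ?_
  by_cases hy : ‖x - y‖ ∈ S
  · rw [indicator_of_mem (show y ∈ {y : Eu | ‖x - y‖ ∈ S} from hy), powerKernel,
      indicator_of_mem hy, ofReal_norm, div_eq_mul_inv]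
    ring
  · rw [indicator_of_notMem (show y ∉ {y : Eu | ‖x - y‖ ∈ S} from hy), powerKernel,
      indicator_of_notMem hy, mul_zero, zero_mul]

theorem sphereArea_mul_sphereMean (hd : 1 ≤ d) (p : ℝ) (e : Eu) :
    sphereArea d * sphereMean p e = sphereMoment p e := by
  have := finrank_ne_zero_nontrivial hd
  have h0 : sphereMeasure d univ ≠ 0 := by
    rw [Measure.measure_univ_ne_zero]
    exact Measure.toSphere_ne_zero _
  have : IsFiniteMeasure (sphereMeasure d) := inferInstanceAs (IsFiniteMeasure (Measure.toSphere _))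
  rw [sphereArea, sphereMean, laverage_eq, ENNReal.mul_div_cancel h0 (measure_ne_top _ _)]
  rfl

end Kernels

end BBM

/-! ### The three limits. -/

theorem mainTheorem10 {d : ℕ} (hd : 1 ≤ d) (Ω : Set (EuclideanSpace ℝ (Fin d)))
    (p : ℝ) (hp : 1 ≤ p) (u : EuclideanSpace ℝ (Fin d) → ℝ)
    (hu : MemLp u (ENNReal.ofReal p) (volume.restrict Ω))
    (e : EuclideanSpace ℝ (Fin d)) (he : ‖e‖ = 1)
    -- `G` is the quantity denoted by `‖∇u‖_{L^p(Ω)}^p` (it is `|u|_{BV(Ω)}` in the `BV` case)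
    (G : ℝ≥0∞)
    (hG : (BBM.IsSobolevExtensionDomain Ω p ∧ (1 < p ∨ BBM.MemSobolev Ω p u) ∧
          G = BBM.gradNormPow Ω p u) ∨
        (BBM.IsBVExtensionDomain Ω ∧ p = 1 ∧ G = BBM.variation Ω u)) :
    Tendsto (fun s : ℝ => ENNReal.ofReal (1 - s) *
        ∫⁻ x in Ω, ∫⁻ y in Ω, ‖u x - u y‖ₑ ^ p / ‖x - y‖ₑ ^ (d + s * p))
      (𝓝[<] 1)
      (𝓝 (BBM.sphereArea d / ENNReal.ofReal p * BBM.sphereMean p e * G)) ∧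
    Tendsto (fun ε : ℝ => (ENNReal.ofReal ε ^ d)⁻¹ *
        ∫⁻ x in Ω, ∫⁻ y in Ω ∩ {y | ‖x - y‖ < ε}, ‖u x - u y‖ₑ ^ p / ‖x - y‖ₑ ^ p)
      (𝓝[>] 0)
      (𝓝 (BBM.sphereArea d / d * BBM.sphereMean p e * G)) ∧
    Tendsto (fun ε : ℝ => (ENNReal.ofReal |Real.log ε|)⁻¹ *
        ∫⁻ x in Ω, ∫⁻ y in Ω ∩ {y | ε < ‖x - y‖}, ‖u x - u y‖ₑ ^ p / ‖x - y‖ₑ ^ (d + p))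
      (𝓝[>] 0)
      (𝓝 (BBM.sphereArea d * BBM.sphereMean p e * G)) := by
  have hmean := BBM.sphereArea_mul_sphereMean hd p e
  refine ⟨?_, ?_, ?_⟩
  · refine tendsto_of_seq_tendsto fun s hs => ?_
    -- The limit is taken along an arbitrary sequence of parameters, as Fatou's lemma requires; area
    -- times mean then rewrites the moment in the constant.
    have h := (BBM.concentratingKernel_fractional hd hp hs).tendsto_energy hd hp hu he hG
    rw [← hmean, ← mul_assoc, mul_comm _ (BBM.sphereArea d), ← div_eq_mul_inv] at h
    refine h.congr fun n => ?_
    rw [BBM.energy_powerKernel ENNReal.ofReal_ne_top .univ]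
    simp
  · refine tendsto_of_seq_tendsto fun ε hε => ?_
    have h := (BBM.concentratingKernel_ball (p := p) hd hε).tendsto_energy hd hp hu he hG
    rw [← hmean, ← mul_assoc, mul_comm _ (BBM.sphereArea d), ← div_eq_mul_inv] at h
    refine h.congr' ?_
    -- Positivity of `ε` keeps the prefactor `ε^(-d)` finite, so that it can be pulled out of the
    -- integral.
    filter_upwards [hε self_mem_nhdsWithin] with n hn
    rw [BBM.energy_powerKernel _ measurableSet_Iio]
    · rfl
    · have : ¬ ε n ≤ 0 := not_le.2 hn
      simp [this]
  · refine tendsto_of_seq_tendsto fun ε hε => ?_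
    have h := (BBM.concentratingKernel_log hd hp hε).tendsto_energy hd hp hu he hG
    rw [← hmean, one_mul] at h
    refine h.congr' ?_
    -- Eventually `log ε < 0`, which rules out `ε = 1` and an infinite prefactor.
    filter_upwards [(Real.tendsto_log_nhdsGT_zero.comp hε).eventually (eventually_lt_atBot 0)]
      with n hn
    have hn' : Real.log (ε n) ≠ 0 := ne_of_lt hn
    rw [BBM.energy_powerKernel (by simpa using hn') measurableSet_Ioi]
    rfl
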